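/- **Setting.** Let $H=\sum_{i=1}^{N}H_i$ be a $\kappa$-local stoquastic Hamiltonian on $n$ qubits: each $H_i$ is a real symmetric matrix acting non-trivially on at most $\kappa=O(1)$ qubits, with non-positive off-diagonal entries in the computational basis, and normalized so that its smallest eigenvalue is $0$ (it suffices that it is non-negative). $N$ and the size of the matrix entries of the $H_i$ are at most ${\rm poly}(n)$. Let $|\Phi\rangle=\sum_{x\in\{0,1\}^n}\Phi(x)|x\rangle$ be a normalized state such that (1) for given $x,y$ with $\Phi(x)\ne0$ the ratio $\Phi(y)/\Phi(x)$ can be computed at cost ${\rm poly}(n)$, and (2) samples from $P(x)=|\Phi(x)|^2$ can be drawn at cost ${\rm poly}(n)$. Put $g_I(k)=\langle\Phi|e^{-Hk}|\Phi\rangle$ for $k=0,1,2,\dots$ The computational model is that of randomized while-programs with finitely many registers holding natural numbers, exact real numbers and $n$-bit strings, with unit-cost elementary instructions (arithmetic, comparison, coin tosses with a given real probability, reading the input terms $H_i$), copying of an $n$-bit string at cost $n+1$, and access to $\Phi$ only through (1) and (2), each at the cost mentioned. **Theorem.** For every $\kappa$ there is one randomized program which, given $n$, $N$, $k$ and $\epsilon_{\rm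 trot}\in(0,1]$ and access to $H$ and $\Phi$ as above, halts on all outcomes of its random choices after at most $D=D(n,k,\epsilon_{\rm trot})$ operations and outputs a real number, where the depth satisfies $$D=\mathcal O\big(k^{1+o(1)}\big)\,\mathcal O\big(\epsilon_{\rm trot}^{-o(1)}\big)\times{\rm poly}(n),$$ that is: there is a polynomial $q$ (depending only on $\kappa$ and the polynomial bounds assumed above) such that for every $\gamma>0$ there is a constant $C$ with $D\le C\,(k+1)^{1+\gamma}\,\epsilon_{\rm trot}^{-\gamma}\,q(n)$ for all $n$, all such $H,\Phi$, all $k$ and all $\epsilon_{\rm trot}\in(0,1]$. Moreover, for all $\epsilon\in(0,1]$ and $\delta\in(0,\tfrac12]$: (a) For every $k$, the median-of-means of the outputs of $\Theta(\epsilon^{-2}\log(\delta^{-1}))$ independent runs of the program differs from $g_I(k)$ by at most $\epsilon_{\rm tot}=\epsilon+\epsilon_{\rm trot}$ with probability at least $1-\delta$. (b) For every $K\ge1$, if for each $k=0,\dots,K$ the program is run independently $\Theta\big(\epsilon^{-2}[\log(\delta^{-1})+\log K]\big)$ times, then with probability at least $1-\delta$ the median-of-means estimates of $g_I(k)$ have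 error at most $\epsilon_{\rm tot}$ for all $k=0,\dots,K$ simultaneously. Here the median-of-means of $b\cdot m$ samples is the median of the $b$ empirical means of groups of $m$ samples; the numbers of groups and the group sizes depend only on $\epsilon,\delta$ (and on $K$ in (b)), and the constants hidden in $\Theta$ are absolute. -/

import Mathlib

open scoped ENNReal

noncomputable section

namespace StoqMC

/-! ## Local Hamiltonians on `n` qubits -/

/-- Computational basis labels of `n` qubits, that is, `n`-bit strings. -/
abbrev BitStr (n : ℕ) : Type := Fin n → Bool

/-- The operator on `n` qubits that acts as the real matrix `h` on the qubits listed by `S` and as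
the identity on all other qubits. -/
def embed {n a : ℕ} (S : Fin a ↪ Fin n) (h : Matrix (BitStr a) (BitStr a) ℝ) :
    Matrix (BitStr n) (BitStr n) ℝ :=
  fun x y => if ∀ j, (∀ i, S i ≠ j) → x j = y j then h (x ∘ S) (y ∘ S) else 0

/-- A real `κ`-local Hamiltonian on `n` qubits, presented as a sum of Hermitian (real symmetric)
terms, each acting on at most `κ` qubits. -/
structure LocalHamiltonian (κ n : ℕ) where
  numTerms : ℕ
  arity : Fin numTerms → ℕ
  arity_le : ∀ i, arity i ≤ κ
  site : ∀ i, Fin (arity i) ↪ Fin n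
  term : ∀ i, Matrix (BitStr (arity i)) (BitStr (arity i)) ℝ
  isHermitian : ∀ i, (term i).IsHermitian

namespace LocalHamiltonian

variable {κ n : ℕ}

/-- The Hamiltonian `H = ∑ i, H_i` as a `2 ^ n` by `2 ^ n` matrix. -/
def toMatrix (H : LocalHamiltonian κ n) : Matrix (BitStr n) (BitStr n) ℝ :=
  ∑ i, embed (H.site i) (H.term i)

/-- Stoquastic: every local term has non-positive off-diagonal entries. -/
def IsStoquastic (H : LocalHamiltonian κ n) : Prop :=
  ∀ i x y, x ≠ y → H.term i x y ≤ 0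

/-- Every local term has smallest eigenvalue at least `0`. -/
def TermsNonneg (H : LocalHamiltonian κ n) : Prop :=
  ∀ i, (H.term i).PosSemidef

end LocalHamiltonian

/-- A normalized pure state of `n` qubits. -/
structure PureState (n : ℕ) where
  amp : BitStr n → ℂ
  normalized : ∑ x, ‖amp x‖ ^ 2 = 1

/-- The distribution `x ↦ |Φ(x)|²` on `n`-bit strings. -/
def PureState.born {n : ℕ} (Φ : PureState n) : PMF (BitStr n) :=
  PMF.ofFintype (fun x => ENNReal.ofReal (‖Φ.amp x‖ ^ 2)) (by
    rw [← ENNReal.ofReal_sum_of_nonneg (fun x _ => by positivity), Φ.normalized,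
      ENNReal.ofReal_one])

/-- The data of one instance: a local Hamiltonian, a state, and access to the state.
One query to the state (drawing a sample from `|Φ(x)|²`, or evaluating an amplitude ratio) takes
`queryCost` elementary operations. Nothing is assumed about `ratio x y` when `Φ(x) = 0`. -/
structure Problem (κ n : ℕ) where
  H : LocalHamiltonian κ n
  Φ : PureState n
  ratio : BitStr n → BitStr n → ℂ
  ratio_spec : ∀ x y, Φ.amp x ≠ 0 → ratio x y = Φ.amp y / Φ.amp x
  queryCost : ℕ

namespace Problem

variable {κ n : ℕ}

/-- The imaginary-time signal `g_I(k) = ⟨Φ| e^{-H k} |Φ⟩`. -/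
def signal (I : Problem κ n) (k : ℕ) : ℂ :=
  star I.Φ.amp ⬝ᵥ
    ((NormedSpace.exp (-((k : ℂ) • I.H.toMatrix.map Complex.ofReal))).mulVec I.Φ.amp)

/-- The number of terms, the size of the matrix entries of the terms, and the cost of one query to
the state are all at most `p(n)`. -/
structure PolyBounded (I : Problem κ n) (p : Polynomial ℕ) : Prop where
  numTerms_le : I.H.numTerms ≤ p.eval n
  entry_le : ∀ i x y, |I.H.term i x y| ≤ (p.eval n : ℕ)
  queryCost_le : I.queryCost ≤ p.eval n

end Problem

/-! ## The machine model: randomized while-programs with exact real arithmetic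

A machine has registers of three sorts: natural numbers, real numbers and `n`-bit strings. A program
mentions finitely many registers, and neither the program nor its register names depend on `n` or on
the instance. The instance can be accessed only through the reading and query instructions. -/

/-- The memory of a machine that works on `n`-bit strings. -/
structure State (n : ℕ) where
  nat : ℕ → ℕ
  real : ℕ → ℝ
  str : ℕ → BitStr n

namespace State

variable {n : ℕ}

def setNat (s : State n) (r v : ℕ) : State n := { s with nat := Function.update s.nat r v }

def setReal (s : State n) (r : ℕ) (v : ℝ) : State n :=
  { s with real := Function.update s.real r v }

def setStr (s : State n) (r : ℕ) (v : BitStr n) : State n :=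
  { s with str := Function.update s.str r v }

end State

/-- Elementary instructions. All arguments that are natural numbers are register names, except the
constant in `natConst`. -/
inductive Instr where
  /-- `nat r := c` -/
  | natConst (r c : ℕ)
  /-- `nat r := nat a + nat b` -/
  | natAdd (r a b : ℕ)
  /-- `nat r := nat a - nat b`, truncated at `0` -/
  | natSub (r a b : ℕ)
  /-- `real r := c` -/
  | realConst (r : ℕ) (c : ℚ)
  /-- `real r := nat a` -/
  | realOfNat (r a : ℕ)
  /-- `real r := real a + real b` -/
  | realAdd (r a b : ℕ)
  /-- `real r := real a - real b` -/
  | realSub (r a b : ℕ)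
  /-- `real r := real a * real b` -/
  | realMul (r a b : ℕ)
  /-- `real r := real a / real b` (and `0` if `real b = 0`) -/
  | realDiv (r a b : ℕ)
  /-- copy the string `str x` to `str r` -/
  | strCopy (r x : ℕ)
  /-- `nat r :=` bit number `nat j` of `str x` (and `0` if there is no such bit) -/
  | strGet (r x j : ℕ)
  /-- set bit number `nat j` of `str x` to `1` if `nat b ≠ 0` and to `0` otherwise -/
  | strSet (x j b : ℕ)
  /-- toss a coin: `nat r := 1` with probability `real p` (clamped to `[0, 1]`), else `nat r := 0` -/
  | flip (r p : ℕ)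
  /-- `nat r :=` the number of qubits on which term number `nat i` of the Hamiltonian acts -/
  | readArity (r i : ℕ)
  /-- `nat r :=` the `nat j`-th qubit on which term number `nat i` acts -/
  | readSite (r i j : ℕ)
  /-- `real r :=` the local matrix entry of term number `nat i` between the restrictions of the
  strings `str x` and `str y` to the qubits on which this term acts -/
  | readEntry (r i x y : ℕ)
  /-- draw `str x` from `|Φ(x)|²` -/
  | sample (x : ℕ)
  /-- store the real and imaginary parts of `Φ(y) / Φ(x)` for `x = str x`, `y = str y` in `real re`
  and `real im` -/
  | queryRatio (re im x y : ℕ)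

/-- The coin with probability of `true` equal to `p`, clamped to `[0, 1]`. -/
def coin (p : ℝ) : PMF Bool :=
  PMF.ofFintype
    (fun b => ENNReal.ofReal (if b then max 0 (min p 1) else 1 - max 0 (min p 1))) (by
      have h0 : 0 ≤ max 0 (min p 1) := le_max_left _ _
      have h1 : max 0 (min p 1) ≤ 1 := max_le zero_le_one (min_le_right _ _)
      simp only [Fintype.sum_bool, if_true, Bool.false_eq_true, if_false]
      rw [← ENNReal.ofReal_add h0 (by linarith)]
      simp)

/-- The number of elementary operations charged for an instruction. -/
def Instr.cost {κ n : ℕ} (I : Problem κ n) : Instr → ℕ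
  | .strCopy _ _ => n + 1
  | .sample _ => I.queryCost + 1
  | .queryRatio _ _ _ _ => I.queryCost + 1
  | _ => 1

/-- The (random) effect of an instruction on the memory. -/
def Instr.exec {κ n : ℕ} (I : Problem κ n) (s : State n) : Instr → PMF (State n)
  | .natConst r c => pure (s.setNat r c)
  | .natAdd r a b => pure (s.setNat r (s.nat a + s.nat b))
  | .natSub r a b => pure (s.setNat r (s.nat a - s.nat b))
  | .realConst r c => pure (s.setReal r (c : ℝ))
  | .realOfNat r a => pure (s.setReal r (s.nat a : ℝ))
  | .realAdd r a b => pure (s.setReal r (s.real a + s.real b))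
  | .realSub r a b => pure (s.setReal r (s.real a - s.real b))
  | .realMul r a b => pure (s.setReal r (s.real a * s.real b))
  | .realDiv r a b => pure (s.setReal r (s.real a / s.real b))
  | .strCopy r x => pure (s.setStr r (s.str x))
  | .strGet r x j =>
      pure (s.setNat r (if h : s.nat j < n then (s.str x ⟨s.nat j, h⟩).toNat else 0))
  | .strSet x j b =>
      pure (if h : s.nat j < n then
        s.setStr x (Function.update (s.str x) ⟨s.nat j, h⟩ (decide (s.nat b ≠ 0))) else s)
  | .flip r p => (coin (s.real p)).map fun b => s.setNat r b.toNat
  | .readArity r i =>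
      pure (s.setNat r (if h : s.nat i < I.H.numTerms then I.H.arity ⟨s.nat i, h⟩ else 0))
  | .readSite r i j =>
      pure (s.setNat r (if h : s.nat i < I.H.numTerms then
        (if h' : s.nat j < I.H.arity ⟨s.nat i, h⟩ then
          (I.H.site ⟨s.nat i, h⟩ ⟨s.nat j, h'⟩ : ℕ) else 0) else 0))
  | .readEntry r i x y =>
      pure (s.setReal r (if h : s.nat i < I.H.numTerms then
        I.H.term ⟨s.nat i, h⟩ (s.str x ∘ I.H.site ⟨s.nat i, h⟩)
          (s.str y ∘ I.H.site ⟨s.nat i, h⟩) else 0))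
  | .sample x => I.Φ.born.map fun v => s.setStr x v
  | .queryRatio re im x y =>
      pure ((s.setReal re (I.ratio (s.str x) (s.str y)).re).setReal im
        (I.ratio (s.str x) (s.str y)).im)

/-- Tests on which a program can branch. -/
inductive Test where
  /-- `nat a < nat b` -/
  | natLt (a b : ℕ)
  /-- `real a < real b` -/
  | realLt (a b : ℕ)

def Test.Holds {n : ℕ} (s : State n) : Test → Prop
  | .natLt a b => s.nat a < s.nat b
  | .realLt a b => s.real a < s.real b

/-- While-programs. -/
inductive Prog where
  | op (i : Instr)
  | seq (c d : Prog)
  | ite (t : Test) (c d : Prog)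
  | loop (t : Test) (c : Prog)

/-- A configuration: the programs still to be executed, the memory, and the number of elementary
operations spent so far. The machine has halted when nothing is left to be executed. -/
structure Config (n : ℕ) where
  todo : List Prog
  state : State n
  time : ℕ

open Classical in
/-- One step of the machine. -/
def step {κ n : ℕ} (I : Problem κ n) (c : Config n) : PMF (Config n) :=
  match c.todo with
  | [] => pure c
  | .op i :: K => (i.exec I c.state).map fun s => ⟨K, s, c.time + i.cost I⟩
  | .seq a b :: K => pure ⟨a :: b :: K, c.state, c.time + 1⟩
  | .ite t a b :: K => pure ⟨(if t.Holds c.state then a else b) :: K, c.state, c.time + 1⟩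
  | .loop t a :: K =>
      pure ⟨if t.Holds c.state then a :: .loop t a :: K else K, c.state, c.time + 1⟩

/-- The distribution of the configuration after `T` steps. -/
def steps {κ n : ℕ} (I : Problem κ n) : ℕ → Config n → PMF (Config n)
  | 0, c => pure c
  | T + 1, c => (step I c).bind (steps I T)

/-- The starting configuration: `n`, the number of terms of the Hamiltonian and `k` are in the first
three natural number registers, the Trotter error is in the first real register, and all other
registers are zero. -/
def startConfig {κ n : ℕ} (I : Problem κ n) (P : Prog) (k : ℕ) (εtrot : ℝ) : Config n where
  todo := [P]
  state :=
    { nat := fun r => if r = 0 then n else if r = 1 then I.H.numTerms else if r = 2 then k else 0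
      real := fun r => if r = 0 then εtrot else 0
      str := fun _ _ => false }
  time := 0

/-- On every outcome of its random choices, the program `P` halts after at most `D` elementary
operations, and the number that it leaves in its first real register has distribution `μ`. -/
def RunsWithin {κ n : ℕ} (I : Problem κ n) (P : Prog) (k : ℕ) (εtrot : ℝ) (D : ℕ) (μ : PMF ℝ) :
    Prop :=
  ∃ T : ℕ,
    (∀ c ∈ (steps I T (startConfig I P k εtrot)).support, c.todo = [] ∧ c.time ≤ D) ∧
    (steps I T (startConfig I P k εtrot)).map (fun c => c.state.real 0) = μ

/-! ## The median-of-means estimator -/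

/-- `a i` is a median of `a`. -/
def IsMedianAt {b : ℕ} (a : Fin b → ℝ) (i : Fin b) : Prop :=
  b ≤ 2 * (Finset.univ.filter fun j => a j ≤ a i).card ∧
    b ≤ 2 * (Finset.univ.filter fun j => a i ≤ a j).card

/-- Every nonempty tuple has a median. -/
theorem exists_isMedianAt {b : ℕ} (hb : 0 < b) (a : Fin b → ℝ) : ∃ i, IsMedianAt a i := by
  classical
  have : Nonempty (Fin b) := ⟨⟨0, hb⟩⟩
  let A : Finset (Fin b) :=
    Finset.univ.filter fun i => b ≤ 2 * (Finset.univ.filter fun j => a j ≤ a i).card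
  have hA : A.Nonempty := by
    obtain ⟨m, -, hm⟩ := Finset.exists_max_image Finset.univ a Finset.univ_nonempty
    refine ⟨m, Finset.mem_filter.2 ⟨Finset.mem_univ _, ?_⟩⟩
    rw [Finset.filter_true_of_mem fun j _ => hm j (Finset.mem_univ j), Finset.card_univ,
      Fintype.card_fin]
    omega
  obtain ⟨i, hiA, hi⟩ := Finset.exists_min_image A a hA
  refine ⟨i, (Finset.mem_filter.1 hiA).2, ?_⟩
  have hsplit : (Finset.univ.filter fun j => a j < a i).card +
      (Finset.univ.filter fun j => a i ≤ a j).card = b := by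
    have h := Finset.card_filter_add_card_filter_not (s := (Finset.univ : Finset (Fin b)))
      (fun j => a j < a i)
    simpa only [not_lt, Finset.card_univ, Fintype.card_fin] using h
  have hlt : 2 * (Finset.univ.filter fun j => a j < a i).card ≤ b := by
    rcases (Finset.univ.filter fun j => a j < a i).eq_empty_or_nonempty with h | h
    · rw [h]; simp
    · obtain ⟨m, hm, hmax⟩ := Finset.exists_max_image _ a h
      have hmi : a m < a i := (Finset.mem_filter.1 hm).2
      have hnot : m ∉ A := fun hmA => absurd (hi m hmA) (not_le.2 hmi)
      have h2 : 2 * (Finset.univ.filter fun j => a j ≤ a m).card < b := by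
        by_contra hcon
        exact hnot (Finset.mem_filter.2 ⟨Finset.mem_univ _, not_lt.1 hcon⟩)
      have hsub : (Finset.univ.filter fun j => a j < a i) ⊆
          Finset.univ.filter fun j => a j ≤ a m := fun j hj =>
        Finset.mem_filter.2 ⟨Finset.mem_univ _, hmax j hj⟩
      have := Finset.card_le_card hsub
      omega
  omega

open Classical in
/-- The median `M(a_1, …, a_b)`: the value `a i` for the smallest index `i` at which there is a
median (for `b = 0`, where there is none, it is set to `0`). -/
def median {b : ℕ} (a : Fin b → ℝ) : ℝ :=
  if h : (Finset.univ.filter fun i => IsMedianAt a i).Nonempty then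
    a ((Finset.univ.filter fun i => IsMedianAt a i).min' h)
  else 0

/-- The median-of-means of `b * m` samples that are divided into `b` groups of size `m`. -/
def medianOfMeans {b m : ℕ} (ω : Fin b × Fin m → ℝ) : ℝ :=
  median fun j => (∑ i, ω (j, i)) / m

/-- The joint distribution of the outputs of `b * m` independent runs, each with output distribution
`μ`. -/
def independentRuns (b m : ℕ) (μ : PMF ℝ) : MeasureTheory.Measure (Fin b × Fin m → ℝ) :=
  MeasureTheory.Measure.pi fun _ => μ.toMeasure

end StoqMC

end

namespace StoqMC

/-! ## Big-step reasoning about the machine -/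

/-! No Trotter product is needed. Let `s` be one plus the sum of the traces of all terms, `N` the
number of terms and `lam = k * N * s`. With `A_i = H_i / s` and `B` the average over `i` of `1 -
A_i`, one has `-kH = -lam + lam B`, hence `e^{-kH} = e^{-lam} ∑ lam^m / m! B^m` exactly
(`exp_neg_smul_toMatrix`). The signal is therefore a Poisson mixture of the numbers `⟨Φ|B^m|Φ⟩`.
Each `A_i` is positive semidefinite of trace below one, so `B` is a contraction, and cutting the
series at a length `R` with `2 e^lam ≤ ε_trot 2^R` and renormalizing costs at most `ε_trot`
(`abs_truncated_sub_le`). The Trotter error of the theorem is this truncation error.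

The powers of `B` are estimated by a weighted walk. A term `i` is chosen uniformly, and some of the
bits on its sites are flipped. Stoquasticity makes `1 - A_i` entrywise non-negative, but its row
sums may exceed one, and uncontrolled weights would make the variance exponential in the number of
steps. The remedy is a positive local guiding vector `g` with `(1 - A_i) g ≤ (1 + η) g`. From `u`
one moves to `v` with probability `(1 - A_i)(u,v) g(v) / ((1 - A_i) g)(u)`, and the weight is
multiplied by `((1 - A_i) g)(u) / g(v)`. Probability times weight is the matrix entry, so the walk
is unbiased (`stepE_linear`). By symmetry of `A_i` and two uses of the inequality for `g`, the
squared weights entering any fixed configuration have total at most `(1 + η)^2`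
(`sum_transProb_mul_sq_le`).

A ground state of `A_i` would be the natural guide, but it need not be strictly positive. Instead
`g` solves `(A_i + η) g = det (A_i + η)` and is given by Cramer's rule. It is positive because `A_i
+ η` is positive definite with non-positive off-diagonal entries (`supersolution_pos`), and it is an
arithmetic expression of size depending only on `κ`.

The walk starts at `x` drawn from `|Φ(x)|²`, ends at `y` with weight `W`, and outputs `W
Re(Φ(y)/Φ(x))`. Its mean is the renormalized truncated series (`abs_outE_sub_le`). With `η = 1/(2R)`
its second moment is at most `(1 + η)^{2R} ≤ e ≤ 3` (`outE_sq_le`). Chebyshev's inequality in each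
group and a union bound over the possible majorities of bad groups then give the median-of-means
guarantees (`exists_badEvent`).

The length `R` is linear in `lam` and in `log(1/ε_trot)`, and each step costs a multiple of `N + 1`
elementary operations, so the depth is linear in `k`; the power `ε_trot^{-γ}` only serves to bound
the logarithm (`depth_le`). It remains to write the walk as one while-program. Programs are
described by a calculus of outcomes and expectation functionals (`Yields`), in which sequencing
composes the functionals. -/

theorem pmf_bind_congr {α β : Type*} {p : PMF α} {f g : α → PMF β}
    (h : ∀ a ∈ p.support, f a = g a) : p.bind f = p.bind g := by
  ext b
  simp only [PMF.bind_apply]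
  refine tsum_congr fun a => ?_
  by_cases ha : a ∈ p.support
  · rw [h a ha]
  · rw [(PMF.apply_eq_zero_iff p a).2 ha, zero_mul, zero_mul]

section Machine

variable {κ n : ℕ}

/-- An upper bound for the cost of every elementary step. -/
def Problem.unitCost (I : Problem κ n) : ℕ := n + I.queryCost + 1

variable (I : Problem κ n)

theorem Instr.cost_le (i : Instr) : i.cost I ≤ I.unitCost := by
  cases i <;> simp only [Instr.cost, Problem.unitCost] <;> omega

theorem one_le_unitCost : 1 ≤ I.unitCost := by
  simp only [Problem.unitCost]; omega

theorem steps_nil (T : ℕ) (s : State n) (t : ℕ) :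
    steps I T ⟨[], s, t⟩ = pure ⟨[], s, t⟩ := by
  induction T with
  | zero => rfl
  | succ T ih =>
    change (pure _ : PMF _).bind (steps I T) = _
    exact (PMF.pure_bind _ _).trans ih

theorem steps_add (T T' : ℕ) (c : Config n) :
    steps I (T + T') c = (steps I T c).bind (steps I T') := by
  induction T generalizing c with
  | zero => rw [Nat.zero_add]; exact (PMF.pure_bind _ _).symm
  | succ T ih =>
    rw [Nat.add_right_comm]
    change (step I c).bind (steps I (T + T')) = ((step I c).bind (steps I T)).bind _
    rw [PMF.bind_bind]
    congr 1
    funext c'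
    exact ih c'

/-- From the memory `s`, the programs `todo` are executed in at most `D` steps, and the final memory
has distribution `μ`. -/
def HaltsIn (todo : List Prog) (s : State n) (D : ℕ) (μ : PMF (State n)) : Prop :=
  ∀ t, (∀ c ∈ (steps I D ⟨todo, s, t⟩).support,
      c.todo = [] ∧ c.time ≤ t + D * I.unitCost) ∧
    (steps I D ⟨todo, s, t⟩).map Config.state = μ

variable {I}

theorem HaltsIn.nil (s : State n) : HaltsIn I [] s 0 (PMF.pure s) := by
  intro t
  rw [steps_nil]
  refine ⟨fun c hc => ?_, PMF.pure_map _ _⟩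
  have : c = ⟨[], s, t⟩ := by simpa using (PMF.mem_support_pure_iff _ _).1 hc
  subst this
  exact ⟨rfl, by simp⟩

/-- A halted configuration is a fixed point of `step`, so surplus steps change nothing. This allows
branches of different length to share one step count. -/
theorem HaltsIn.add {todo : List Prog} {s : State n} {D : ℕ} {μ : PMF (State n)}
    (h : HaltsIn I todo s D μ) (D' : ℕ) : HaltsIn I todo s (D + D') μ := by
  intro t
  obtain ⟨h1, h2⟩ := h t
  have key : steps I (D + D') ⟨todo, s, t⟩ = steps I D ⟨todo, s, t⟩ := by
    rw [steps_add]
    conv_rhs => rw [← PMF.bind_pure (steps I D ⟨todo, s, t⟩)]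
    refine pmf_bind_congr fun c hc => ?_
    obtain ⟨td, s', t'⟩ := c
    obtain rfl : td = [] := (h1 _ hc).1
    exact steps_nil I D' s' t'
  rw [key]
  refine ⟨fun c hc => ⟨(h1 c hc).1, (h1 c hc).2.trans ?_⟩, h2⟩
  gcongr
  omega

theorem HaltsIn.mono {todo : List Prog} {s : State n} {D D' : ℕ} {μ : PMF (State n)}
    (h : HaltsIn I todo s D μ) (hD : D ≤ D') : HaltsIn I todo s D' μ := by
  obtain ⟨d, rfl⟩ := Nat.exists_eq_add_of_le hD
  exact h.add d

/-- The rule for a single machine step. Charging every step at most `unitCost` makes the elapsed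
time follow from the number of steps alone. -/
theorem HaltsIn.of_step {todo next : List Prog} {s : State n} {D cost : ℕ} {ν : PMF (State n)}
    {μ : State n → PMF (State n)} (hcost : cost ≤ I.unitCost)
    (hstep : ∀ t, step I ⟨todo, s, t⟩ = ν.map fun s' => ⟨next, s', t + cost⟩)
    (h : ∀ s' ∈ ν.support, HaltsIn I next s' D (μ s')) :
    HaltsIn I todo s (D + 1) (ν.bind μ) := by
  intro t
  have key : steps I (D + 1) ⟨todo, s, t⟩ =
      ν.bind fun s' => steps I D ⟨next, s', t + cost⟩ := by
    change (step I _).bind (steps I D) = _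
    rw [hstep, PMF.bind_map]
    rfl
  rw [key]
  constructor
  · intro c hc
    obtain ⟨s', hs', hc'⟩ := (PMF.mem_support_bind_iff _ _ _).1 hc
    obtain ⟨h1, h2⟩ := ((h s' hs') (t + cost)).1 c hc'
    exact ⟨h1, h2.trans (by rw [add_mul, one_mul]; omega)⟩
  · rw [PMF.map_bind]
    exact pmf_bind_congr fun s' hs' => ((h s' hs') (t + cost)).2

variable (I) in
/-- Executing `c` from the memory `s` takes at most `D` steps and leaves a memory with
distribution `ν`. -/
def Exec (c : Prog) (s : State n) (D : ℕ) (ν : PMF (State n)) : Prop :=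
  ∀ (K : List Prog) (D' : ℕ) (μ : State n → PMF (State n)),
    (∀ s' ∈ ν.support, HaltsIn I K s' D' (μ s')) → HaltsIn I (c :: K) s (D + D') (ν.bind μ)

theorem Exec.mono {c : Prog} {s : State n} {D E : ℕ} {ν : PMF (State n)}
    (h : Exec I c s D ν) (hD : D ≤ E) : Exec I c s E ν := fun K D' μ hμ =>
  (h K D' μ hμ).mono (by omega)

theorem Exec.op (i : Instr) (s : State n) : Exec I (.op i) s 1 (i.exec I s) := by
  intro K D' μ hμ
  rw [add_comm]
  exact HaltsIn.of_step (i.cost_le I) (fun t => rfl) hμ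

/-- Since `Exec` quantifies over all continuations, `a` can be run with `b :: K` waiting and then
`b` with `K` waiting. The extra unit is the step that unfolds the sequence. -/
theorem Exec.seq {a b : Prog} {s : State n} {D₁ D₂ : ℕ} {ν : PMF (State n)}
    {ν' : State n → PMF (State n)} (ha : Exec I a s D₁ ν)
    (hb : ∀ s' ∈ ν.support, Exec I b s' D₂ (ν' s')) :
    Exec I (.seq a b) s (D₁ + D₂ + 1) (ν.bind ν') := by
  intro K D' μ hμ
  have h2 : HaltsIn I (a :: b :: K) s (D₁ + (D₂ + D')) (ν.bind fun s' => (ν' s').bind μ) :=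
    ha _ _ _ fun s' hs' => hb s' hs' K D' μ fun s'' hs'' =>
      hμ s'' ((PMF.mem_support_bind_iff _ _ _).2 ⟨s', hs', hs''⟩)
  have h3 := HaltsIn.of_step (I := I) (todo := .seq a b :: K) (next := a :: b :: K) (s := s)
    (cost := 1) (ν := PMF.pure s) (μ := fun _ => ν.bind fun s' => (ν' s').bind μ)
    (one_le_unitCost I) (fun t => by rw [PMF.pure_map]; rfl)
    (fun s' hs' => by
      obtain rfl := (PMF.mem_support_pure_iff _ _).1 hs'
      exact h2)
  rw [PMF.pure_bind] at h3
  rw [PMF.bind_bind]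
  convert h3 using 1
  omega

theorem Exec.ite {t : Test} {a b : Prog} {s : State n} {D : ℕ} {ν : PMF (State n)}
    (ha : t.Holds s → Exec I a s D ν) (hb : ¬ t.Holds s → Exec I b s D ν) :
    Exec I (.ite t a b) s (D + 1) ν := by
  intro K D' μ hμ
  by_cases h : t.Holds s
  · have h3 := HaltsIn.of_step (I := I) (todo := .ite t a b :: K) (next := a :: K) (s := s)
      (cost := 1) (ν := PMF.pure s) (μ := fun _ => ν.bind μ) (one_le_unitCost I)
      (fun t' => by rw [PMF.pure_map]; simp only [step, if_pos h]; rfl)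
      (fun s' hs' => by
        obtain rfl := (PMF.mem_support_pure_iff _ _).1 hs'
        exact ha h K D' μ hμ)
    rw [PMF.pure_bind] at h3
    convert h3 using 1
    omega
  · have h3 := HaltsIn.of_step (I := I) (todo := .ite t a b :: K) (next := b :: K) (s := s)
      (cost := 1) (ν := PMF.pure s) (μ := fun _ => ν.bind μ) (one_le_unitCost I)
      (fun t' => by rw [PMF.pure_map]; simp only [step, if_neg h]; rfl)
      (fun s' hs' => by
        obtain rfl := (PMF.mem_support_pure_iff _ _).1 hs'
        exact hb h K D' μ hμ)
    rw [PMF.pure_bind] at h3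
    convert h3 using 1
    omega

theorem Exec.loop_false {t : Test} {a : Prog} {s : State n} (h : ¬ t.Holds s) :
    Exec I (.loop t a) s 1 (PMF.pure s) := by
  intro K D' μ hμ
  rw [add_comm]
  exact HaltsIn.of_step (cost := 1) (one_le_unitCost I)
    (fun t' => by rw [PMF.pure_map]; simp only [step, if_neg h]; rfl) hμ

theorem Exec.loop_true {t : Test} {a : Prog} {s : State n} {D₁ D₂ : ℕ} {ν : PMF (State n)}
    {ν' : State n → PMF (State n)} (h : t.Holds s) (ha : Exec I a s D₁ ν)
    (hb : ∀ s' ∈ ν.support, Exec I (.loop t a) s' D₂ (ν' s')) :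
    Exec I (.loop t a) s (D₁ + D₂ + 1) (ν.bind ν') := by
  intro K D' μ hμ
  have h2 : HaltsIn I (a :: .loop t a :: K) s (D₁ + (D₂ + D'))
      (ν.bind fun s' => (ν' s').bind μ) :=
    ha _ _ _ fun s' hs' => hb s' hs' K D' μ fun s'' hs'' =>
      hμ s'' ((PMF.mem_support_bind_iff _ _ _).2 ⟨s', hs', hs''⟩)
  have h3 := HaltsIn.of_step (I := I) (todo := .loop t a :: K) (next := a :: .loop t a :: K)
    (s := s) (cost := 1) (ν := PMF.pure s) (μ := fun _ => ν.bind fun s' => (ν' s').bind μ)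
    (one_le_unitCost I) (fun t' => by rw [PMF.pure_map]; simp only [step, if_pos h]; rfl)
    (fun s' hs' => by
      obtain rfl := (PMF.mem_support_pure_iff _ _).1 hs'
      exact h2)
  rw [PMF.pure_bind] at h3
  rw [PMF.bind_bind]
  convert h3 using 1
  omega

theorem Exec.runsWithin {P : Prog} {k : ℕ} {εtrot : ℝ} {D : ℕ} {ν : PMF (State n)}
    (h : Exec I P (startConfig I P k εtrot).state D ν) :
    RunsWithin I P k εtrot (D * I.unitCost) (ν.map fun s => s.real 0) := by
  have h1 := h [] 0 PMF.pure (fun s' _ => HaltsIn.nil s')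
  rw [PMF.bind_pure, add_zero] at h1
  obtain ⟨h2, h3⟩ := h1 0
  refine ⟨D, fun c hc => ⟨(h2 c hc).1, by simpa using (h2 c hc).2⟩, ?_⟩
  rw [← h3, PMF.map_comp]
  rfl

end Machine

/-! ## Named registers and expressions -/

section Views

variable {κ n : ℕ}

/-- The memory without the real scratch registers, which are the ones of odd index. -/
def view (s : State n) : State n where
  nat := s.nat
  real := fun m => s.real (2 * m)
  str := s.str

@[ext]
theorem State.ext {s t : State n} (h₁ : s.nat = t.nat) (h₂ : s.real = t.real)
    (h₃ : s.str = t.str) : s = t := by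
  cases s; cases t; simp_all

theorem view_setReal (s : State n) (r : ℕ) (v : ℝ) :
    view (s.setReal (2 * r) v) = (view s).setReal r v := by
  ext m
  · rfl
  · simp only [view, State.setReal, Function.update_apply]
    simp
  · rfl

theorem view_setReal_odd (s : State n) (r : ℕ) (v : ℝ) :
    view (s.setReal (2 * r + 1) v) = view s := by
  ext m
  · rfl
  · simp only [view, State.setReal, Function.update_apply]
    rw [if_neg (by omega)]
  · rfl

variable (I : Problem κ n)

/-- The program `c` deterministically changes the view `v` to the view `v'`. -/
def Det (c : Prog) (v : State n) (D : ℕ) (v' : State n) : Prop :=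
  ∀ s, view s = v → ∃ s', view s' = v' ∧ Exec I c s D (PMF.pure s')

/-- The test `t` has the truth value `p` at the view `v`. -/
def Decides (t : Test) (v : State n) (p : Prop) : Prop :=
  ∀ s, view s = v → (t.Holds s ↔ p)

variable {I}

theorem Decides.natLt (a b : ℕ) (v : State n) :
    Decides (.natLt a b) v (v.nat a < v.nat b) := by
  rintro s rfl; rfl

theorem Decides.realLt (a b : ℕ) (v : State n) :
    Decides (.realLt (2 * a) (2 * b)) v (v.real a < v.real b) := by
  rintro s rfl; rfl

theorem Det.of_exec {i : Instr} {v v' : State n} (F : State n → State n)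
    (h : ∀ s : State n, i.exec I s = PMF.pure (F s)) (hF : ∀ s, view s = v → view (F s) = v') :
    Det I (.op i) v 1 v' := by
  intro s hs
  exact ⟨F s, hF s hs, h s ▸ Exec.op i s⟩

theorem Det.natConst (r c : ℕ) (v : State n) : Det I (.op (.natConst r c)) v 1 (v.setNat r c) :=
  .of_exec _ (fun _ => rfl) (by rintro s rfl; rfl)

theorem Det.natAdd (r a b : ℕ) (v : State n) :
    Det I (.op (.natAdd r a b)) v 1 (v.setNat r (v.nat a + v.nat b)) :=
  .of_exec _ (fun _ => rfl) (by rintro s rfl; rfl)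

theorem Det.natSub (r a b : ℕ) (v : State n) :
    Det I (.op (.natSub r a b)) v 1 (v.setNat r (v.nat a - v.nat b)) :=
  .of_exec _ (fun _ => rfl) (by rintro s rfl; rfl)

theorem Det.strCopy (r x : ℕ) (v : State n) :
    Det I (.op (.strCopy r x)) v 1 (v.setStr r (v.str x)) :=
  .of_exec _ (fun _ => rfl) (by rintro s rfl; rfl)

theorem Det.strGet (r x j : ℕ) (v : State n) :
    Det I (.op (.strGet r x j)) v 1
      (v.setNat r (if h : v.nat j < n then (v.str x ⟨v.nat j, h⟩).toNat else 0)) :=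
  .of_exec _ (fun _ => rfl) (by rintro s rfl; rfl)

theorem Det.strSet (x j b : ℕ) (v : State n) :
    Det I (.op (.strSet x j b)) v 1
      (if h : v.nat j < n then
        v.setStr x (Function.update (v.str x) ⟨v.nat j, h⟩ (decide (v.nat b ≠ 0))) else v) := by
  refine .of_exec _ (fun _ => rfl) ?_
  rintro s rfl
  by_cases h : s.nat j < n
  · have h' : (view s).nat j < n := h
    rw [dif_pos h, dif_pos h']; rfl
  · have h' : ¬ (view s).nat j < n := h
    rw [dif_neg h, dif_neg h']

theorem Det.readArity (r i : ℕ) (v : State n) :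
    Det I (.op (.readArity r i)) v 1
      (v.setNat r (if h : v.nat i < I.H.numTerms then I.H.arity ⟨v.nat i, h⟩ else 0)) :=
  .of_exec _ (fun _ => rfl) (by rintro s rfl; rfl)

theorem Det.readSite (r i j : ℕ) (v : State n) :
    Det I (.op (.readSite r i j)) v 1
      (v.setNat r (if h : v.nat i < I.H.numTerms then
        (if h' : v.nat j < I.H.arity ⟨v.nat i, h⟩ then
          (I.H.site ⟨v.nat i, h⟩ ⟨v.nat j, h'⟩ : ℕ) else 0) else 0)) :=
  .of_exec _ (fun _ => rfl) (by rintro s rfl; rfl)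

theorem Det.readEntry (r i x y : ℕ) (v : State n) :
    Det I (.op (.readEntry (2 * r) i x y)) v 1
      (v.setReal r (if h : v.nat i < I.H.numTerms then
        I.H.term ⟨v.nat i, h⟩ (v.str x ∘ I.H.site ⟨v.nat i, h⟩)
          (v.str y ∘ I.H.site ⟨v.nat i, h⟩) else 0)) :=
  .of_exec _ (fun _ => rfl) (by rintro s rfl; exact view_setReal _ _ _)

theorem Det.queryRatio (re im x y : ℕ) (v : State n) :
    Det I (.op (.queryRatio (2 * re) (2 * im) x y)) v 1
      ((v.setReal re (I.ratio (v.str x) (v.str y)).re).setReal im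
        (I.ratio (v.str x) (v.str y)).im) :=
  .of_exec _ (fun _ => rfl) (by rintro s rfl; rw [view_setReal, view_setReal]; rfl)

theorem Exec.seq_pure {a b : Prog} {s s' : State n} {D₁ D₂ : ℕ} {ν : PMF (State n)}
    (ha : Exec I a s D₁ (PMF.pure s')) (hb : Exec I b s' D₂ ν) :
    Exec I (.seq a b) s (D₁ + D₂ + 1) ν := by
  have := ha.seq (ν' := fun _ => ν) (D₂ := D₂) (b := b) (fun t ht => by
    obtain rfl := (PMF.mem_support_pure_iff _ _).1 ht
    exact hb)
  rwa [PMF.pure_bind] at this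

theorem Det.seq {a b : Prog} {v v' v'' : State n} {D₁ D₂ : ℕ} (ha : Det I a v D₁ v')
    (hb : Det I b v' D₂ v'') : Det I (.seq a b) v (D₁ + D₂ + 1) v'' := fun s hs =>
  let ⟨s', h1, h2⟩ := ha s hs
  let ⟨s'', h3, h4⟩ := hb s' h1
  ⟨s'', h3, h2.seq_pure h4⟩

theorem Det.loop_false {t : Test} {a : Prog} {v : State n} {p : Prop}
    (ht : Decides t v p) (hp : ¬ p) : Det I (.loop t a) v 1 v :=
  fun s hs => ⟨s, hs, Exec.loop_false fun h => hp ((ht s hs).1 h)⟩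

/-- Arithmetic expressions in the named real registers. -/
inductive Ex where
  | reg (m : ℕ)
  | nat (a : ℕ)
  | const (q : ℚ)
  | add (x y : Ex)
  | sub (x y : Ex)
  | mul (x y : Ex)
  | div (x y : Ex)

/-- The value of an expression at a view. -/
noncomputable def Ex.eval (v : State n) : Ex → ℝ
  | .reg m => v.real m
  | .nat a => v.nat a
  | .const q => q
  | .add x y => x.eval v + y.eval v
  | .sub x y => x.eval v - y.eval v
  | .mul x y => x.eval v * y.eval v
  | .div x y => x.eval v / y.eval v

/-- A straight-line program that evaluates an expression into the scratch register number `j`. -/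
def Ex.compile : Ex → ℕ → Prog
  | .reg m, j => .seq (.op (.realConst (2 * j + 1) 0))
      (.op (.realAdd (2 * j + 1) (2 * j + 1) (2 * m)))
  | .nat a, j => .op (.realOfNat (2 * j + 1) a)
  | .const q, j => .op (.realConst (2 * j + 1) q)
  | .add x y, j => .seq (x.compile j) (.seq (y.compile (j + 1))
      (.op (.realAdd (2 * j + 1) (2 * j + 1) (2 * (j + 1) + 1))))
  | .sub x y, j => .seq (x.compile j) (.seq (y.compile (j + 1))
      (.op (.realSub (2 * j + 1) (2 * j + 1) (2 * (j + 1) + 1))))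
  | .mul x y, j => .seq (x.compile j) (.seq (y.compile (j + 1))
      (.op (.realMul (2 * j + 1) (2 * j + 1) (2 * (j + 1) + 1))))
  | .div x y, j => .seq (x.compile j) (.seq (y.compile (j + 1))
      (.op (.realDiv (2 * j + 1) (2 * j + 1) (2 * (j + 1) + 1))))

/-- The number of steps that a loop-free program takes at most. -/
def Prog.len : Prog → ℕ
  | .op _ => 1
  | .seq a b => a.len + b.len + 1
  | .ite _ a b => max a.len b.len + 1
  | .loop _ _ => 0

/-- The state `s'` agrees with `s` on the view and on the first `j` scratch registers, and the
scratch register number `j` holds `x`. -/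
def Holding (s s' : State n) (j : ℕ) (x : ℝ) : Prop :=
  view s' = view s ∧ (∀ i < j, s'.real (2 * i + 1) = s.real (2 * i + 1)) ∧
    s'.real (2 * j + 1) = x

theorem Holding.set {s s' : State n} {j : ℕ} (h : view s' = view s)
    (h' : ∀ i < j, s'.real (2 * i + 1) = s.real (2 * i + 1)) (x : ℝ) :
    Holding s (s'.setReal (2 * j + 1) x) j x := by
  refine ⟨by rw [view_setReal_odd, h], fun i hi => ?_, ?_⟩
  · simp only [State.setReal]
    rw [Function.update_of_ne (by omega), h' i hi]
  · simp [State.setReal]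

/-- The left operand waits in scratch register `j` while the right one is evaluated into `j + 1`.
This is the reason why `Holding` records that the scratch registers below the target survive. -/
theorem exec_binary {x y : Ex} {j : ℕ} {s : State n} {i : Instr} (o : ℝ → ℝ → ℝ)
    (hx : ∀ (j : ℕ) (s : State n),
      ∃ s', Holding s s' j (x.eval (view s)) ∧ Exec I (x.compile j) s (x.compile j).len
        (PMF.pure s'))
    (hy : ∀ (j : ℕ) (s : State n),
      ∃ s', Holding s s' j (y.eval (view s)) ∧ Exec I (y.compile j) s (y.compile j).len
        (PMF.pure s'))
    (hi : ∀ s : State n, i.exec I s = PMF.pure (s.setReal (2 * j + 1)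
      (o (s.real (2 * j + 1)) (s.real (2 * (j + 1) + 1))))) :
    ∃ s', Holding s s' j (o (x.eval (view s)) (y.eval (view s))) ∧
      Exec I (.seq (x.compile j) (.seq (y.compile (j + 1)) (.op i))) s
        (Prog.len (.seq (x.compile j) (.seq (y.compile (j + 1)) (.op i)))) (PMF.pure s') := by
  obtain ⟨s₁, ⟨h1, h2, h3⟩, h4⟩ := hx j s
  obtain ⟨s₂, ⟨g1, g2, g3⟩, g4⟩ := hy (j + 1) s₁
  have g5 := Exec.op (I := I) i s₂
  rw [hi, g3, g2 j (by omega), h3, h1] at g5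
  exact ⟨_, Holding.set (g1.trans h1)
    (fun k hk => (g2 k (by omega)).trans (h2 k hk)) _, h4.seq_pure (g4.seq_pure g5)⟩

theorem Ex.exec_compile (e : Ex) : ∀ (j : ℕ) (s : State n),
    ∃ s', Holding s s' j (e.eval (view s)) ∧
      Exec I (e.compile j) s (e.compile j).len (PMF.pure s') := by
  induction e with
  | reg m =>
    intro j s
    have h1 := Exec.op (I := I) (.realConst (2 * j + 1) 0) s
    have h2 := Exec.op (I := I) (.realAdd (2 * j + 1) (2 * j + 1) (2 * m))
      (s.setReal (2 * j + 1) ((0 : ℚ) : ℝ))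
    refine ⟨_, ?_, h1.seq_pure h2⟩
    have h3 : (s.setReal (2 * j + 1) ((0 : ℚ) : ℝ)).real (2 * j + 1) +
        (s.setReal (2 * j + 1) ((0 : ℚ) : ℝ)).real (2 * m) = (Ex.reg m).eval (view s) := by
      simp only [State.setReal, Function.update_self, Ex.eval, view]
      rw [Function.update_of_ne (by omega)]
      simp
    rw [h3]
    refine Holding.set (view_setReal_odd _ _ _) (fun i hi => ?_) _
    simp only [State.setReal]
    rw [Function.update_of_ne (by omega)]
  | nat a =>
    intro j s
    exact ⟨_, Holding.set rfl (fun _ _ => rfl) _, Exec.op (I := I) (.realOfNat (2 * j + 1) a) s⟩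
  | const q =>
    intro j s
    exact ⟨_, Holding.set rfl (fun _ _ => rfl) _, Exec.op (I := I) (.realConst (2 * j + 1) q) s⟩
  | add x y hx hy => exact fun j s => exec_binary (· + ·) hx hy fun _ => rfl
  | sub x y hx hy => exact fun j s => exec_binary (· - ·) hx hy fun _ => rfl
  | mul x y hx hy => exact fun j s => exec_binary (· * ·) hx hy fun _ => rfl
  | div x y hx hy => exact fun j s => exec_binary (· / ·) hx hy fun _ => rfl

/-- Store the value of an expression in a named register. -/
def assign (m : ℕ) (e : Ex) : Prog :=
  .seq (e.compile 0) (.seq (.op (.realConst (2 * m) 0))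
    (.op (.realAdd (2 * m) (2 * m) (2 * 0 + 1))))

theorem Det.assign (m : ℕ) (e : Ex) (v : State n) :
    Det I (assign m e) v (assign m e).len (v.setReal m (e.eval v)) := by
  rintro s rfl
  obtain ⟨s₁, ⟨h1, h2, h3⟩, h4⟩ := e.exec_compile (I := I) 0 s
  have g1 := Exec.op (I := I) (.realConst (2 * m) 0) s₁
  have g2 := Exec.op (I := I) (.realAdd (2 * m) (2 * m) (2 * 0 + 1))
    (s₁.setReal (2 * m) ((0 : ℚ) : ℝ))
  refine ⟨_, ?_, h4.seq_pure (g1.seq_pure g2)⟩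
  rw [view_setReal, view_setReal, h1]
  have : (s₁.setReal (2 * m) ((0 : ℚ) : ℝ)).real (2 * m) +
      (s₁.setReal (2 * m) ((0 : ℚ) : ℝ)).real (2 * 0 + 1) = e.eval (view s) := by
    rw [← h3]
    simp only [State.setReal, Function.update_self]
    rw [Function.update_of_ne (by omega)]
    simp
  rw [this]
  simp [State.setReal]

/-- Execute a list of programs one after the other. -/
def seqs : List Prog → Prog
  | [] => .op (.natConst 3 0)
  | c :: l => .seq c (seqs l)

end Views

/-! ## Expectations -/

/-- The expectation of a real function. -/
noncomputable def pexp {α : Type*} (p : PMF α) (f : α → ℝ) : ℝ := ∑' a, (p a).toReal * f a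

theorem pexp_eq_sum {α : Type*} {p : PMF α} {s : Finset α} (hs : p.support ⊆ s) (f : α → ℝ) :
    pexp p f = ∑ a ∈ s, (p a).toReal * f a := by
  refine tsum_eq_sum fun a ha => ?_
  have : p a = 0 := (PMF.apply_eq_zero_iff p a).2 fun h => ha (hs h)
  rw [this]; simp

theorem pexp_congr {α : Type*} {p : PMF α} {f g : α → ℝ} (h : ∀ a ∈ p.support, f a = g a) :
    pexp p f = pexp p g := by
  refine tsum_congr fun a => ?_
  by_cases ha : a ∈ p.support
  · rw [h a ha]
  · rw [(PMF.apply_eq_zero_iff p a).2 ha]; simp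

theorem pexp_pure {α : Type*} (a : α) (f : α → ℝ) : pexp (PMF.pure a) f = f a := by
  rw [pexp_eq_sum (s := {a}) (by simp)]
  simp

theorem support_bind_finite {α β : Type*} {p : PMF α} {q : α → PMF β} (hp : p.support.Finite)
    (hq : ∀ a ∈ p.support, (q a).support.Finite) : (p.bind q).support.Finite := by
  rw [PMF.support_bind]
  exact hp.biUnion hq

theorem support_map_finite {α β : Type*} {p : PMF α} (f : α → β) (hp : p.support.Finite) :
    (p.map f).support.Finite := by
  rw [PMF.support_map]
  exact hp.image f

/-- Finite supports reduce both sides to finite sums, so that exchanging the summations needs no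
summability argument, whatever the function `f`. -/
theorem pexp_bind {α β : Type*} {p : PMF α} {q : α → PMF β} (hp : p.support.Finite)
    (hq : ∀ a ∈ p.support, (q a).support.Finite) (f : β → ℝ) :
    pexp (p.bind q) f = pexp p fun a => pexp (q a) f := by
  have hb := support_bind_finite hp hq
  rw [pexp_eq_sum (s := hb.toFinset) (by simp), pexp_eq_sum (s := hp.toFinset) (by simp)]
  have h1 : ∀ a ∈ hp.toFinset, pexp (q a) f = ∑ b ∈ hb.toFinset, ((q a) b).toReal * f b := by
    intro a ha
    refine pexp_eq_sum (fun b hb' => ?_) f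
    rw [Set.Finite.coe_toFinset]
    exact (PMF.mem_support_bind_iff _ _ _).2 ⟨a, by simpa using ha, hb'⟩
  have h2 : ∑ a ∈ hp.toFinset, (p a).toReal * pexp (q a) f =
      ∑ a ∈ hp.toFinset, ∑ b ∈ hb.toFinset, (p a).toReal * (((q a) b).toReal * f b) :=
    Finset.sum_congr rfl fun a ha => by rw [h1 a ha, Finset.mul_sum]
  rw [h2, Finset.sum_comm]
  refine Finset.sum_congr rfl fun b _ => ?_
  rw [PMF.bind_apply, tsum_eq_sum (s := hp.toFinset), ENNReal.toReal_sum, Finset.sum_mul]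
  · refine Finset.sum_congr rfl fun a _ => ?_
    rw [ENNReal.toReal_mul, mul_assoc]
  · intro a _
    exact ENNReal.mul_ne_top (PMF.apply_ne_top _ _) (PMF.apply_ne_top _ _)
  · intro a ha
    have : p a = 0 := (PMF.apply_eq_zero_iff p a).2 fun h => ha (by simpa using h)
    rw [this, zero_mul]

theorem pexp_map {α β : Type*} {p : PMF α} (g : α → β) (hp : p.support.Finite) (f : β → ℝ) :
    pexp (p.map g) f = pexp p (f ∘ g) := by
  rw [← PMF.bind_pure_comp, pexp_bind hp]
  · simp only [Function.comp_def, pexp_pure]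
  · intro a _
    simp

/-! ### Random outcomes of programs and their expectation functionals -/

section Yields

variable {κ n : ℕ}

/-- With the empty continuation and a common step count, both distributions are the final memory of
the same run. Uniqueness makes the law of a continuation a function of the memory alone. -/
theorem Exec.unique {I : Problem κ n} {c : Prog} {s : State n} {D D' : ℕ} {ν ν' : PMF (State n)}
    (h : Exec I c s D ν) (h' : Exec I c s D' ν') : ν = ν' := by
  have h1 := (h.mono (le_max_left D D')) [] 0 PMF.pure (fun s' _ => HaltsIn.nil s') 0
  have h2 := (h'.mono (le_max_right D D')) [] 0 PMF.pure (fun s' _ => HaltsIn.nil s') 0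
  rw [PMF.bind_pure] at h1 h2
  exact h1.2.symm.trans h2.2

variable (I : Problem κ n)

/-- From the view `v`, the program `c` produces in at most `D` steps a random outcome in `α` with
expectation functional `L`; the view after an outcome `a` is related to `a` by `Q`. -/
def Yields {α : Type*} (c : Prog) (v : State n) (D : ℕ) (Q : α → State n → Prop)
    (L : (α → ℝ) → ℝ) : Prop :=
  ∀ s, view s = v → ∃ J : PMF (α × State n), J.support.Finite ∧
    Exec I c s D (J.map Prod.snd) ∧ (∀ p ∈ J.support, Q p.1 (view p.2)) ∧
    ∀ f : α → ℝ, pexp J (fun p => f p.1) = L f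

variable {I} {α β : Type*}

theorem Det.yields {c : Prog} {v v' : State n} {D : ℕ} {Q : α → State n → Prop}
    (h : Det I c v D v') {a : α} (hQ : Q a v') : Yields I c v D Q (fun f => f a) := by
  intro s hs
  obtain ⟨s', h1, h2⟩ := h s hs
  refine ⟨PMF.pure (a, s'), by simp, by rwa [PMF.pure_map], fun p hp => ?_,
    fun f => pexp_pure _ _⟩
  obtain rfl := (PMF.mem_support_pure_iff _ _).1 hp
  simpa [h1] using hQ

theorem Yields.mono {c : Prog} {v : State n} {D E : ℕ} {Q : α → State n → Prop}
    {L : (α → ℝ) → ℝ} (h : Yields I c v D Q L) (hD : D ≤ E) : Yields I c v E Q L := fun s hs =>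
  let ⟨J, h1, h2, h3⟩ := h s hs
  ⟨J, h1, h2.mono hD, h3⟩

theorem Yields.map {c : Prog} {v : State n} {D : ℕ} {Q : α → State n → Prop}
    {Q' : β → State n → Prop} {L : (α → ℝ) → ℝ} (h : Yields I c v D Q L) (g : α → β)
    (hQ : ∀ a v', Q a v' → Q' (g a) v') : Yields I c v D Q' (fun f => L (f ∘ g)) := by
  intro s hs
  obtain ⟨J, h1, h2, h3, h4⟩ := h s hs
  refine ⟨J.map (Prod.map g id), support_map_finite _ h1, ?_, ?_, fun f => ?_⟩
  · rw [PMF.map_comp]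
    exact h2
  · intro p hp
    obtain ⟨q, hq, rfl⟩ := (PMF.mem_support_map_iff _ _ _).1 hp
    exact hQ _ _ (h3 q hq)
  · rw [pexp_map _ h1]
    exact h4 (f ∘ g)

theorem Yields.imp {c : Prog} {v : State n} {D : ℕ} {Q Q' : α → State n → Prop}
    {L : (α → ℝ) → ℝ} (h : Yields I c v D Q L)
    (hQ : ∀ a v', Q a v' → Q' a v') : Yields I c v D Q' L := h.map id hQ

theorem Yields.congr {c : Prog} {v : State n} {D : ℕ} {Q : α → State n → Prop}
    {L L' : (α → ℝ) → ℝ} (h : Yields I c v D Q L) (hL : ∀ f, L f = L' f) :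
    Yields I c v D Q L' := by
  obtain rfl : L = L' := funext hL
  exact h

/-- The joint distribution after a first random outcome and a program that is run thereafter. -/
theorem exists_joint {b : Prog} {J : PMF (α × State n)} {D : ℕ} {Q₁ : α → State n → Prop}
    {Q₂ : β → State n → Prop} {L₂ : α → (β → ℝ) → ℝ} (hJ : J.support.Finite)
    (hQ : ∀ p ∈ J.support, Q₁ p.1 (view p.2))
    (hb : ∀ x v', Q₁ x v' → Yields I b v' D Q₂ (L₂ x)) :
    ∃ (J' : PMF (β × State n)) (ν' : State n → PMF (State n)), J'.support.Finite ∧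
      (∀ s' ∈ (J.map Prod.snd).support, Exec I b s' D (ν' s')) ∧
      J'.map Prod.snd = (J.map Prod.snd).bind ν' ∧
      (∀ p ∈ J'.support, Q₂ p.1 (view p.2)) ∧
      ∀ f : β → ℝ, pexp J' (fun p => f p.1) = pexp J fun p => L₂ p.1 f := by
  classical
  have h1 : ∀ p : α × State n, ∃ J₂ : PMF (β × State n), p ∈ J.support →
      (J₂.support.Finite ∧ Exec I b p.2 D (J₂.map Prod.snd) ∧
        (∀ q ∈ J₂.support, Q₂ q.1 (view q.2)) ∧
        ∀ f : β → ℝ, pexp J₂ (fun q => f q.1) = L₂ p.1 f) := by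
    intro p
    by_cases hp : p ∈ J.support
    · obtain ⟨J₂, h⟩ := hb p.1 _ (hQ p hp) p.2 rfl
      exact ⟨J₂, fun _ => h⟩
    -- Outside the support any distribution will do; one is borrowed from a point of the support so
    -- that the choice is total.
    · obtain ⟨q, hq⟩ := J.support_nonempty
      obtain ⟨J₂, -⟩ := hb q.1 _ (hQ q hq) q.2 rfl
      exact ⟨J₂, fun h => absurd h hp⟩
  choose J₂ hJ₂ using h1
  -- Different outcomes may come with the same memory, whereas `Exec.seq` needs a law depending on
  -- the memory only. A representative outcome is chosen; by `Exec.unique` the choice does not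
  -- matter.
  let ν' : State n → PMF (State n) := fun s' =>
    if h : ∃ p ∈ J.support, p.2 = s' then (J₂ h.choose).map Prod.snd else PMF.pure s'
  have hν : ∀ p ∈ J.support, ν' p.2 = (J₂ p).map Prod.snd := by
    intro p hp
    have h : ∃ q ∈ J.support, q.2 = p.2 := ⟨p, hp, rfl⟩
    have h2 := (hJ₂ _ h.choose_spec.1).2.1
    rw [h.choose_spec.2] at h2
    simp only [ν', dif_pos h]
    exact h2.unique (hJ₂ p hp).2.1
  refine ⟨J.bind J₂, ν', support_bind_finite hJ fun p hp => (hJ₂ p hp).1, ?_, ?_, ?_, ?_⟩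
  · intro s' hs'
    obtain ⟨p, hp, rfl⟩ := (PMF.mem_support_map_iff _ _ _).1 hs'
    rw [hν p hp]
    exact (hJ₂ p hp).2.1
  · rw [PMF.map_bind, PMF.bind_map]
    exact pmf_bind_congr fun p hp => (hν p hp).symm
  · intro q hq
    obtain ⟨p, hp, hq'⟩ := (PMF.mem_support_bind_iff _ _ _).1 hq
    exact (hJ₂ p hp).2.2.1 q hq'
  · intro f
    rw [pexp_bind hJ fun p hp => (hJ₂ p hp).1]
    exact pexp_congr fun p hp => (hJ₂ p hp).2.2.2 f

theorem Yields.seq {a b : Prog} {v : State n} {D₁ D₂ : ℕ} {Q₁ : α → State n → Prop}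
    {Q₂ : β → State n → Prop} {L₁ : (α → ℝ) → ℝ} {L₂ : α → (β → ℝ) → ℝ}
    (ha : Yields I a v D₁ Q₁ L₁) (hb : ∀ x v', Q₁ x v' → Yields I b v' D₂ Q₂ (L₂ x)) :
    Yields I (.seq a b) v (D₁ + D₂ + 1) Q₂ (fun f => L₁ fun x => L₂ x f) := by
  intro s hs
  obtain ⟨J, h1, h2, h3, h4⟩ := ha s hs
  obtain ⟨J', ν', g1, g2, g3, g4, g5⟩ := exists_joint h1 h3 hb
  exact ⟨J', g1, g3 ▸ h2.seq g2, g4, fun f => (g5 f).trans (h4 fun x => L₂ x f)⟩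

theorem Det.seq_yields {a b : Prog} {v v' : State n} {D₁ D₂ : ℕ} {Q : α → State n → Prop}
    {L : (α → ℝ) → ℝ} (ha : Det I a v D₁ v') (hb : Yields I b v' D₂ Q L) :
    Yields I (.seq a b) v (D₁ + D₂ + 1) Q L :=
  (ha.yields (Q := fun (_ : Unit) w => w = v') (a := ()) rfl).seq
    (fun _ _ h => h ▸ hb)

theorem Yields.ite {t : Test} {a b : Prog} {v : State n} {D : ℕ} {Q : α → State n → Prop}
    {L : (α → ℝ) → ℝ} {p : Prop} (ht : Decides t v p) (ha : p → Yields I a v D Q L)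
    (hb : ¬ p → Yields I b v D Q L) : Yields I (.ite t a b) v (D + 1) Q L := by
  intro s hs
  by_cases hp : p
  · obtain ⟨J, h1, h2, h3⟩ := ha hp s hs
    exact ⟨J, h1, Exec.ite (fun _ => h2) (fun h => absurd ((ht s hs).2 hp) h), h3⟩
  · obtain ⟨J, h1, h2, h3⟩ := hb hp s hs
    exact ⟨J, h1, Exec.ite (fun h => absurd ((ht s hs).1 h) hp) (fun _ => h2), h3⟩

theorem Yields.loop_true {t : Test} {a : Prog} {v : State n} {D₁ D₂ : ℕ}
    {Q₁ : α → State n → Prop} {Q₂ : β → State n → Prop} {L₁ : (α → ℝ) → ℝ}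
    {L₂ : α → (β → ℝ) → ℝ} {p : Prop} (ht : Decides t v p) (hp : p)
    (ha : Yields I a v D₁ Q₁ L₁)
    (hb : ∀ x v', Q₁ x v' → Yields I (.loop t a) v' D₂ Q₂ (L₂ x)) :
    Yields I (.loop t a) v (D₁ + D₂ + 1) Q₂ (fun f => L₁ fun x => L₂ x f) := by
  intro s hs
  obtain ⟨J, h1, h2, h3, h4⟩ := ha s hs
  obtain ⟨J', ν', g1, g2, g3, g4, g5⟩ := exists_joint h1 h3 hb
  exact ⟨J', g1, g3 ▸ Exec.loop_true ((ht s hs).2 hp) h2 g2, g4,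
    fun f => (g5 f).trans (h4 fun x => L₂ x f)⟩

theorem coin_toReal (p : ℝ) (b : Bool) :
    (coin p b).toReal = if b then max 0 (min p 1) else 1 - max 0 (min p 1) := by
  have h0 : 0 ≤ max 0 (min p 1) := le_max_left _ _
  have h1 : max 0 (min p 1) ≤ 1 := max_le zero_le_one (min_le_right _ _)
  rw [coin, PMF.ofFintype_apply, ENNReal.toReal_ofReal]
  split_ifs <;> linarith

/-- The outcome also records that it had positive probability. This excludes impossible branches
later, such as continuing when no probability mass is left. -/
theorem Yields.flip {r p : ℕ} {v : State n} (h0 : 0 ≤ v.real p) (h1 : v.real p ≤ 1) :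
    Yields I (.op (.flip r (2 * p))) v 1
      (fun (b : Bool) v' => v' = v.setNat r b.toNat ∧ (b = true → 0 < v.real p) ∧
        (b = false → v.real p < 1))
      (fun f => v.real p * f true + (1 - v.real p) * f false) := by
  rintro s rfl
  change 0 ≤ s.real (2 * p) at h0
  change s.real (2 * p) ≤ 1 at h1
  have hc : max 0 (min (s.real (2 * p)) 1) = s.real (2 * p) := by
    rw [min_eq_left h1, max_eq_right h0]
  have hcoin := coin_toReal (s.real (2 * p))
  rw [hc] at hcoin
  refine ⟨(coin (s.real (2 * p))).map fun b => (b, s.setNat r b.toNat),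
    support_map_finite _ (Set.toFinite _), ?_, ?_, ?_⟩
  · rw [PMF.map_comp]
    exact Exec.op _ _
  · intro q hq
    obtain ⟨b, hb, rfl⟩ := (PMF.mem_support_map_iff _ _ _).1 hq
    have hb' : (coin (s.real (2 * p)) b).toReal ≠ 0 :=
      ENNReal.toReal_ne_zero.2 ⟨hb, PMF.apply_ne_top _ _⟩
    rw [hcoin] at hb'
    refine ⟨rfl, ?_, ?_⟩
    · rintro rfl
      have h2 : s.real (2 * p) ≠ 0 := by simpa using hb'
      exact lt_of_le_of_ne h0 h2.symm
    · rintro rfl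
      exact lt_of_le_of_ne h1 fun h => hb' (by
        change s.real (2 * p) = 1 at h
        simp [h])
  · intro f
    rw [pexp_map _ (Set.toFinite _), pexp_eq_sum (s := Finset.univ) (fun _ _ => by simp)]
    simp [hcoin, view]

theorem Yields.sample {x : ℕ} {v : State n} :
    Yields I (.op (.sample x)) v 1
      (fun y v' => v' = v.setStr x y ∧ I.Φ.amp y ≠ 0)
      (fun f => ∑ y, ‖I.Φ.amp y‖ ^ 2 * f y) := by
  rintro s rfl
  refine ⟨I.Φ.born.map fun y => (y, s.setStr x y), support_map_finite _ (Set.toFinite _), ?_,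
    ?_, ?_⟩
  · rw [PMF.map_comp]
    exact Exec.op _ _
  · intro q hq
    obtain ⟨y, hy, rfl⟩ := (PMF.mem_support_map_iff _ _ _).1 hq
    refine ⟨rfl, fun h => (PMF.mem_support_iff _ _).1 hy ?_⟩
    simp [PureState.born, PMF.ofFintype_apply, h]
  · intro f
    rw [pexp_map _ (Set.toFinite _), pexp_eq_sum (s := Finset.univ) (by simp)]
    refine Finset.sum_congr rfl fun y _ => ?_
    rw [PureState.born, PMF.ofFintype_apply, ENNReal.toReal_ofReal (by positivity)]
    rfl

end Yields

/-! ## Positive supersolutions of local terms -/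

section Local

open Matrix

variable {ι : Type*} [Fintype ι]

theorem dotProduct_mulVec_nonneg_of_posSemidef {A : Matrix ι ι ℝ} (hA : A.PosSemidef)
    (v : ι → ℝ) : 0 ≤ v ⬝ᵥ A *ᵥ v := by
  simpa using hA.dotProduct_mulVec_nonneg v

theorem symm_of_posSemidef {ι : Type*} {A : Matrix ι ι ℝ} (hA : A.PosSemidef) (x y : ι) :
    A x y = A y x := by
  have := congrFun (congrFun hA.1 x) y
  simpa using this.symm

theorem dotProduct_mulVec_comm {A : Matrix ι ι ℝ} (hA : A.PosSemidef) (v w : ι → ℝ) :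
    v ⬝ᵥ A *ᵥ w = w ⬝ᵥ A *ᵥ v := by
  simp only [dotProduct, mulVec, Finset.mul_sum]
  rw [Finset.sum_comm]
  refine Finset.sum_congr rfl fun i _ => Finset.sum_congr rfl fun j _ => ?_
  rw [symm_of_posSemidef hA j i]; ring

theorem diag_le_trace {A : Matrix ι ι ℝ} (hA : A.PosSemidef) (x : ι) :
    A x x ≤ A.trace :=
  Finset.single_le_sum (f := fun i => A i i) (fun _ _ => hA.diag_nonneg) (Finset.mem_univ x)

variable [DecidableEq ι]

/-- Cauchy-Schwarz for the form of a positive semidefinite matrix, applied to a basis vector. -/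
theorem sq_mulVec_le {A : Matrix ι ι ℝ} (hA : A.PosSemidef) (v : ι → ℝ) (x : ι) :
    (A *ᵥ v) x ^ 2 ≤ A x x * (v ⬝ᵥ A *ᵥ v) := by
  -- The form at `v + r e_x` is a quadratic polynomial in `r` without sign changes, so its
  -- discriminant is non-positive.
  have h : ∀ r : ℝ, 0 ≤ A x x * (r * r) + (2 * (A *ᵥ v) x) * r + v ⬝ᵥ A *ᵥ v := by
    intro r
    have h1 := dotProduct_mulVec_nonneg_of_posSemidef hA (v + r • Pi.single x 1)
    have h2 : v ⬝ᵥ A *ᵥ Pi.single x 1 = (A *ᵥ v) x := by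
      rw [dotProduct_mulVec_comm hA]; simp
    have h3 : (Pi.single x 1 : ι → ℝ) ⬝ᵥ A *ᵥ Pi.single x 1 = A x x := by simp
    have h4 : (Pi.single x 1 : ι → ℝ) ⬝ᵥ A *ᵥ v = (A *ᵥ v) x := by simp
    rw [mulVec_add, mulVec_smul, add_dotProduct, dotProduct_add, dotProduct_add, dotProduct_smul,
      smul_dotProduct, smul_dotProduct, dotProduct_smul, h2, h3, h4] at h1
    simp only [smul_eq_mul] at h1
    linarith
  have := discrim_le_zero h
  rw [discrim] at this
  nlinarith

/-- Summing `sq_mulVec_le` over `x` gives `‖Av‖² ≤ tr(A) ⟨v, Av⟩ ≤ ⟨v, Av⟩`. In the expansion of `‖v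
- Av‖²` this is absorbed by the cross term `-2⟨v, Av⟩`. The trace serves as a computable substitute
for the operator norm. -/
theorem sum_sq_sub_mulVec_le {A : Matrix ι ι ℝ} (hA : A.PosSemidef) (htr : A.trace ≤ 1)
    (v : ι → ℝ) : ∑ x, (v x - (A *ᵥ v) x) ^ 2 ≤ ∑ x, v x ^ 2 := by
  have h0 := dotProduct_mulVec_nonneg_of_posSemidef hA v
  have h1 : ∑ x, (A *ᵥ v) x ^ 2 ≤ v ⬝ᵥ A *ᵥ v := by
    calc ∑ x, (A *ᵥ v) x ^ 2 ≤ ∑ x, A x x * (v ⬝ᵥ A *ᵥ v) :=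
          Finset.sum_le_sum fun x _ => sq_mulVec_le hA v x
      _ = A.trace * (v ⬝ᵥ A *ᵥ v) := by rw [← Finset.sum_mul]; rfl
      _ ≤ _ := by nlinarith
  have h2 : ∑ x, (v x - (A *ᵥ v) x) ^ 2 =
      ∑ x, v x ^ 2 - 2 * (v ⬝ᵥ A *ᵥ v) + ∑ x, (A *ᵥ v) x ^ 2 := by
    rw [dotProduct, Finset.mul_sum, ← Finset.sum_sub_distrib, ← Finset.sum_add_distrib]
    exact Finset.sum_congr rfl fun x _ => by ring
  linarith

/-- The solution `g` of `(A + η) g = det (A + η)`. -/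
noncomputable def supersolution (A : Matrix ι ι ℝ) (η : ℝ) : ι → ℝ :=
  Matrix.cramer (A + η • (1 : Matrix ι ι ℝ)) (fun _ => 1)

variable {A : Matrix ι ι ℝ} {η : ℝ}

theorem posDef_add_smul_one {ι : Type*} [DecidableEq ι] {A : Matrix ι ι ℝ} {η : ℝ}
    (hA : A.PosSemidef) (hη : 0 < η) :
    (A + η • (1 : Matrix ι ι ℝ)).PosDef :=
  (PosDef.posSemidef_add hA (PosDef.one.smul hη))

theorem mulVec_supersolution (x : ι) : (A *ᵥ supersolution A η) x + η * supersolution A η x =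
    (A + η • (1 : Matrix ι ι ℝ)).det := by
  have := congrFun (mulVec_cramer (A + η • (1 : Matrix ι ι ℝ)) (fun _ => (1 : ℝ))) x
  rw [add_mulVec, smul_mulVec, one_mulVec] at this
  simpa [supersolution] using this

theorem det_add_smul_one_pos (hA : A.PosSemidef) (hη : 0 < η) :
    0 < (A + η • (1 : Matrix ι ι ℝ)).det :=
  (posDef_add_smul_one hA hη).det_pos

/-- The M-matrix argument: test `(A + η) g = det` against the negative part `w` of `g`. As the
off-diagonal entries are non-positive, the pairing is at most `-⟨w, Aw⟩ - η‖w‖² ≤ 0`, while it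
equals `det * ∑ w` with `det > 0`. Hence `w = 0`. -/
theorem supersolution_nonneg (hA : A.PosSemidef) (hoff : ∀ x y, x ≠ y → A x y ≤ 0) (hη : 0 < η)
    (x : ι) : 0 ≤ supersolution A η x := by
  set g := supersolution A η
  let w : ι → ℝ := fun x => max (-g x) 0
  have hw : ∀ x, 0 ≤ w x := fun x => le_max_right _ _
  have hd := det_add_smul_one_pos hA hη
  have h1 : 0 ≤ w ⬝ᵥ A *ᵥ w := dotProduct_mulVec_nonneg_of_posSemidef hA w
  have hle : ∀ x, w x * ((A *ᵥ g) x + η * g x) ≤ -(w x * (A *ᵥ w) x) - η * w x ^ 2 := by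
    intro x
    have h3 : w x * g x = - w x ^ 2 := by
      rcases le_total (-g x) 0 with h | h
      · simp [w, max_eq_right h]
      · simp only [w, max_eq_left h]; ring
    have h4 : w x * (A *ᵥ g) x ≤ -(w x * (A *ᵥ w) x) := by
      simp only [mulVec, dotProduct, Finset.mul_sum, ← Finset.sum_neg_distrib]
      refine Finset.sum_le_sum fun y _ => ?_
      by_cases hxy : x = y
      · subst hxy
        have : w x * (A x x * g x) = A x x * (w x * g x) := by ring
        rw [this, h3]
        apply le_of_eq; ring
      · have h5 : 0 ≤ g y + w y := by
          have := le_max_left (-g y) 0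
          simp only [w]; linarith
        nlinarith [mul_nonneg (mul_nonneg (hw x) (neg_nonneg.2 (hoff x y hxy))) h5]
    nlinarith
  have hsum : ∑ x, w x * (A + η • (1 : Matrix ι ι ℝ)).det ≤ -(w ⬝ᵥ A *ᵥ w) - η * ∑ x, w x ^ 2 := by
    rw [dotProduct, Finset.mul_sum, ← Finset.sum_neg_distrib, ← Finset.sum_sub_distrib]
    refine Finset.sum_le_sum fun x _ => ?_
    rw [← mulVec_supersolution x]
    exact hle x
  have h6 : 0 ≤ ∑ x, w x ^ 2 := Finset.sum_nonneg fun x _ => sq_nonneg _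
  have h7 : ∑ x, w x * (A + η • (1 : Matrix ι ι ℝ)).det ≤ 0 := by nlinarith
  have h8 := (Finset.sum_eq_zero_iff_of_nonneg
    (fun x _ => mul_nonneg (hw x) hd.le)).1 (le_antisymm h7
      (Finset.sum_nonneg fun x _ => mul_nonneg (hw x) hd.le)) x (Finset.mem_univ x)
  have h9 : w x = 0 := by
    rcases mul_eq_zero.1 h8 with h | h
    · exact h
    · exact absurd h hd.ne'
  have := le_max_left (-g x) 0
  simp only [w] at h9
  linarith

/-- If `g` vanished at `x`, only off-diagonal entries would contribute to `(A g)(x)`, which would be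
non-positive, although `(A g)(x) + η g(x)` is the positive determinant. -/
theorem supersolution_pos (hA : A.PosSemidef) (hoff : ∀ x y, x ≠ y → A x y ≤ 0) (hη : 0 < η)
    (x : ι) : 0 < supersolution A η x := by
  have hn := supersolution_nonneg hA hoff hη
  refine lt_of_le_of_ne (hn x) fun h => ?_
  have h1 := mulVec_supersolution (A := A) (η := η) x
  have h2 : (A *ᵥ supersolution A η) x ≤ 0 := by
    refine Finset.sum_nonpos fun y _ => ?_
    by_cases hxy : x = y
    · subst hxy; simp [← h]
    · exact mul_nonpos_of_nonpos_of_nonneg (hoff x y hxy) (hn y)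
  have h3 := det_add_smul_one_pos hA hη
  rw [← h] at h1
  linarith

theorem one_sub_apply_nonneg {ι : Type*} [DecidableEq ι] {A : Matrix ι ι ℝ}
    (htr : ∀ x, A x x < 1) (hoff : ∀ x y, x ≠ y → A x y ≤ 0) (x y : ι) :
    0 ≤ (1 - A) x y := by
  by_cases h : x = y
  · subst h; simpa using (htr x).le
  · simpa [one_apply_ne h] using hoff x y h

theorem one_sub_mulVec_supersolution_pos (hA : A.PosSemidef) (htr : ∀ x, A x x < 1)
    (hoff : ∀ x y, x ≠ y → A x y ≤ 0) (hη : 0 < η) (x : ι) :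
    0 < ((1 - A) *ᵥ supersolution A η) x := by
  refine Finset.sum_pos' (fun y _ => mul_nonneg (one_sub_apply_nonneg htr hoff x y)
    (supersolution_nonneg hA hoff hη y)) ⟨x, Finset.mem_univ x, ?_⟩
  refine mul_pos ?_ (supersolution_pos hA hoff hη x)
  simpa using htr x

/-- The left side is `(1 + η) g - det (A + η)`, and the determinant is positive. -/
theorem one_sub_mulVec_supersolution_le (hA : A.PosSemidef) (hη : 0 < η) (x : ι) :
    ((1 - A) *ᵥ supersolution A η) x ≤ (1 + η) * supersolution A η x := by
  have h1 := mulVec_supersolution (A := A) (η := η) x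
  have h3 := det_add_smul_one_pos hA hη
  rw [sub_mulVec, one_mulVec, Pi.sub_apply]
  linarith

end Local

/-! ## Flipping bits -/

section Flip

open Matrix

variable {a n : ℕ}

/-- Bitwise addition modulo two. -/
def xorStr (z w : BitStr a) : BitStr a := fun j => xor (z j) (w j)

/-- Flip the bits of `x` at the sites `S i` with `z i = 1`. -/
def flipBits (S : Fin a ↪ Fin n) (z : BitStr a) (x : BitStr n) : BitStr n :=
  fun j => xor (x j) (decide (∃ i, S i = j ∧ z i = true))

variable (S : Fin a ↪ Fin n)

theorem xorStr_xorStr_cancel (u z : BitStr a) : xorStr u (xorStr u z) = z := by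
  funext j; simp [xorStr]

theorem xorStr_right_cancel (u z : BitStr a) : xorStr (xorStr u z) z = u := by
  funext j; simp [xorStr]

theorem xorStr_assoc (u v w : BitStr a) : xorStr (xorStr u v) w = xorStr u (xorStr v w) := by
  funext j; simp [xorStr]

/-- Translation by `u` as a permutation. -/
def xorEquiv (u : BitStr a) : BitStr a ≃ BitStr a where
  toFun := xorStr u
  invFun := xorStr u
  left_inv := xorStr_xorStr_cancel u
  right_inv := xorStr_xorStr_cancel u

theorem xorEquiv_apply (u z : BitStr a) : xorEquiv u z = xorStr u z := rfl

theorem flipBits_site (z : BitStr a) (x : BitStr n) (i : Fin a) :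
    flipBits S z x (S i) = xor (x (S i)) (z i) := by
  have : (∃ i', S i' = S i ∧ z i' = true) ↔ z i = true := by
    constructor
    · rintro ⟨i', h, h'⟩
      rwa [← S.injective h]
    · exact fun h => ⟨i, rfl, h⟩
  simp only [flipBits, this, Bool.decide_eq_true]

theorem flipBits_of_ne (z : BitStr a) (x : BitStr n) {j : Fin n} (hj : ∀ i, S i ≠ j) :
    flipBits S z x j = x j := by
  have : ¬ ∃ i, S i = j ∧ z i = true := fun ⟨i, h, _⟩ => hj i h
  simp [flipBits, this]

theorem flipBits_comp (z : BitStr a) (x : BitStr n) :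
    flipBits S z x ∘ S = xorStr (x ∘ S) z := by
  funext i; exact flipBits_site S z x i

theorem flipBits_flipBits (z w : BitStr a) (x : BitStr n) :
    flipBits S z (flipBits S w x) = flipBits S (xorStr w z) x := by
  funext j
  by_cases hj : ∃ i, S i = j
  · obtain ⟨i, rfl⟩ := hj
    simp only [flipBits_site, xorStr, Bool.xor_assoc]
  · push Not at hj
    simp only [flipBits_of_ne S _ _ hj]

theorem xorStr_self (z : BitStr a) : xorStr z z = fun _ => false := by
  funext j; simp [xorStr]

theorem flipBits_zero (x : BitStr n) : flipBits S (fun _ => false) x = x := by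
  funext j; simp [flipBits]

theorem flipBits_invol (z : BitStr a) (x : BitStr n) : flipBits S z (flipBits S z x) = x := by
  rw [flipBits_flipBits, xorStr_self, flipBits_zero]

theorem sum_flipBits (z : BitStr a) (F : BitStr n → ℝ) :
    ∑ x, F (flipBits S z x) = ∑ x, F x :=
  Equiv.sum_comp (Function.Involutive.toPerm _ (flipBits_invol S z)) F

/-- Only configurations that agree with `x` off the sites contribute to row `x`, and each of them is
`x` with a unique pattern `z` flipped. -/
theorem embed_mulVec (h : Matrix (BitStr a) (BitStr a) ℝ) (f : BitStr n → ℝ) (x : BitStr n) :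
    (embed S h *ᵥ f) x = ∑ z, h (x ∘ S) (xorStr (x ∘ S) z) * f (flipBits S z x) := by
  symm
  refine Fintype.sum_of_injective (fun z => flipBits S z x) ?_ _ _ ?_ ?_
  · intro z w hzw
    have h1 : flipBits S z x ∘ S = flipBits S w x ∘ S := by
      simp only at hzw; rw [hzw]
    rw [flipBits_comp, flipBits_comp] at h1
    exact (xorEquiv (x ∘ S)).injective h1
  · intro y hy
    have hne : embed S h x y = 0 := if_neg ?_
    · exact mul_eq_zero_of_left hne _
    intro hagree
    refine hy ⟨xorStr (x ∘ S) (y ∘ S), ?_⟩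
    funext j
    by_cases hj : ∃ i, S i = j
    · obtain ⟨i, rfl⟩ := hj
      simp [flipBits_site, xorStr]
    · push Not at hj
      simp only [flipBits_of_ne S _ _ hj]
      exact hagree j hj
  · intro z
    have heq : embed S h x (flipBits S z x) = h (x ∘ S) (flipBits S z x ∘ S) :=
      if_pos fun j hj => (flipBits_of_ne S z x hj).symm
    simp only [heq, flipBits_comp]

/-- The embedded operator acts on the bits of the sites like the translated local matrix. -/
theorem embed_mulVec_flipBits (h : Matrix (BitStr a) (BitStr a) ℝ) (f : BitStr n → ℝ)
    (x : BitStr n) (w : BitStr a) :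
    (embed S h *ᵥ f) (flipBits S w x) =
      (h.submatrix (xorEquiv (x ∘ S)) (xorEquiv (x ∘ S)) *ᵥ fun z => f (flipBits S z x)) w := by
  rw [embed_mulVec, mulVec, dotProduct, ← Equiv.sum_comp (xorEquiv w)]
  refine Finset.sum_congr rfl fun z _ => ?_
  rw [flipBits_comp, flipBits_flipBits, submatrix_apply, xorEquiv_apply, xorEquiv_apply,
    xorEquiv_apply, xorStr_xorStr_cancel, xorStr_assoc, xorStr_xorStr_cancel]

theorem sum_sq_eq_average (f : BitStr n → ℝ) :
    (2 : ℝ) ^ a * ∑ x, f x ^ 2 = ∑ x, ∑ z : BitStr a, f (flipBits S z x) ^ 2 := by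
  rw [Finset.sum_comm, Finset.sum_congr rfl fun z _ => sum_flipBits S z fun x => f x ^ 2]
  simp

/-- On the orbit of `x` under flips of the sites, the embedded operator is `A` with its indices
translated by `x ∘ S`, so the local contraction bound applies with the same trace. Averaging over
all base points counts every configuration `2 ^ a` times. -/
theorem sum_sq_sub_embed_le {A : Matrix (BitStr a) (BitStr a) ℝ} (hA : A.PosSemidef)
    (htr : A.trace ≤ 1) (f : BitStr n → ℝ) :
    ∑ x, (f x - (embed S A *ᵥ f) x) ^ 2 ≤ ∑ x, f x ^ 2 := by
  refine le_of_mul_le_mul_left ?_ (pow_pos (zero_lt_two' ℝ) a)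
  rw [sum_sq_eq_average S, sum_sq_eq_average S]
  refine Finset.sum_le_sum fun x _ => ?_
  simp only [embed_mulVec_flipBits]
  refine sum_sq_sub_mulVec_le (hA.submatrix _) ?_ _
  rw [trace] at htr ⊢
  simp only [diag_apply, submatrix_apply] at htr ⊢
  rwa [Equiv.sum_comp (xorEquiv (x ∘ S)) fun z => A z z]

theorem embed_smul (c : ℝ) (h : Matrix (BitStr a) (BitStr a) ℝ) :
    embed S (c • h) = c • embed S h := by
  ext x y
  simp only [embed, Matrix.smul_apply, smul_eq_mul]
  split_ifs <;> simp

end Flip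

open Matrix

/-! ## The random walk and its first two moments -/

section Walk

variable {κ n : ℕ}

/-- The local term divided by the scale `s`. -/
noncomputable def LocalHamiltonian.scaled (H : LocalHamiltonian κ n) (s : ℝ)
    (i : Fin H.numTerms) : Matrix (BitStr (H.arity i)) (BitStr (H.arity i)) ℝ := s⁻¹ • H.term i

/-- The conditions on the scale `s` under which the walk is well defined. -/
structure LocalHamiltonian.ScaleOk (H : LocalHamiltonian κ n) (s : ℝ) : Prop where
  pos : 0 < s
  stoq : H.IsStoquastic
  nonneg : H.TermsNonneg
  trace_lt : ∀ i, (H.term i).trace < s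

variable {H : LocalHamiltonian κ n} {s η : ℝ}

namespace LocalHamiltonian.ScaleOk

theorem posSemidef (h : H.ScaleOk s) (i : Fin H.numTerms) : (H.scaled s i).PosSemidef :=
  (h.nonneg i).smul (inv_nonneg.2 h.pos.le)

theorem off_nonpos (h : H.ScaleOk s) (i : Fin H.numTerms) (x y : BitStr (H.arity i))
    (hxy : x ≠ y) : H.scaled s i x y ≤ 0 :=
  mul_nonpos_of_nonneg_of_nonpos (inv_nonneg.2 h.pos.le) (h.stoq i x y hxy)

theorem trace_lt_one (h : H.ScaleOk s) (i : Fin H.numTerms) : (H.scaled s i).trace < 1 := by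
  rw [LocalHamiltonian.scaled, trace_smul, smul_eq_mul, inv_mul_lt_iff₀ h.pos, mul_one]
  exact h.trace_lt i

theorem diag_lt_one (h : H.ScaleOk s) (i : Fin H.numTerms) (x : BitStr (H.arity i)) :
    H.scaled s i x x < 1 :=
  (diag_le_trace (h.posSemidef i) x).trans_lt (h.trace_lt_one i)

end LocalHamiltonian.ScaleOk

variable (H s η)

/-- The positive vector that defines the transition probabilities for the term number `i`. -/
noncomputable def guide (i : Fin H.numTerms) : BitStr (H.arity i) → ℝ :=
  supersolution (H.scaled s i) η

/-- The normalization of the transition probabilities. -/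
noncomputable def guideNext (i : Fin H.numTerms) : BitStr (H.arity i) → ℝ :=
  (1 - H.scaled s i) *ᵥ guide H s η i

/-- The probability of flipping the bits `z` in the local configuration `u`. -/
noncomputable def transProb (i : Fin H.numTerms) (u z : BitStr (H.arity i)) : ℝ :=
  (1 - H.scaled s i) u (xorStr u z) * guide H s η i (xorStr u z) / guideNext H s η i u

/-- The weight of that transition. -/
noncomputable def transWeight (i : Fin H.numTerms) (u z : BitStr (H.arity i)) : ℝ :=
  guideNext H s η i u / guide H s η i (xorStr u z)

variable {H s η}

theorem guideNext_eq_sum (i : Fin H.numTerms) (u : BitStr (H.arity i)) : guideNext H s η i u =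
    ∑ z, (1 - H.scaled s i) u (xorStr u z) * guide H s η i (xorStr u z) :=
  (Equiv.sum_comp (xorEquiv u) fun y => (1 - H.scaled s i) u y * guide H s η i y).symm

theorem guide_pos (h : H.ScaleOk s) (hη : 0 < η) (i : Fin H.numTerms) (u : BitStr (H.arity i)) :
    0 < guide H s η i u :=
  supersolution_pos (h.posSemidef i) (h.off_nonpos i) hη u

theorem guideNext_pos (h : H.ScaleOk s) (hη : 0 < η) (i : Fin H.numTerms)
    (u : BitStr (H.arity i)) : 0 < guideNext H s η i u :=
  one_sub_mulVec_supersolution_pos (h.posSemidef i) (h.diag_lt_one i) (h.off_nonpos i) hη u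

theorem transProb_nonneg (h : H.ScaleOk s) (hη : 0 < η) (i : Fin H.numTerms)
    (u z : BitStr (H.arity i)) : 0 ≤ transProb H s η i u z :=
  div_nonneg (mul_nonneg (one_sub_apply_nonneg (h.diag_lt_one i) (h.off_nonpos i) _ _)
    (guide_pos h hη i _).le) (guideNext_pos h hη i u).le

/-- The importance sampling identity: the guiding vector and the normalization cancel. -/
theorem transProb_mul_transWeight (h : H.ScaleOk s) (hη : 0 < η) (i : Fin H.numTerms)
    (u z : BitStr (H.arity i)) :
    transProb H s η i u z * transWeight H s η i u z = (1 - H.scaled s i) u (xorStr u z) := by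
  have h1 := (guide_pos h hη i (xorStr u z)).ne'
  have h2 := (guideNext_pos h hη i u).ne'
  rw [transProb, transWeight]
  field_simp

/-- The sum runs over the predecessors of `u`, since flipping `z` in `xorStr u z` leads to `u`. One
factor of the weight turns the probability into a matrix entry. Bounding the other by `(1 + η) g`
rebuilds `((1 - A) g)(u)`, to which the supersolution inequality applies once more. -/
theorem sum_transProb_mul_sq_le (h : H.ScaleOk s) (hη : 0 < η) (i : Fin H.numTerms)
    (u : BitStr (H.arity i)) :
    ∑ z, transProb H s η i (xorStr u z) z * transWeight H s η i (xorStr u z) z ^ 2 ≤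
      (1 + η) ^ 2 := by
  have hg := guide_pos h hη i u
  have hle : ∀ v, guideNext H s η i v ≤ (1 + η) * guide H s η i v := fun v =>
    one_sub_mulVec_supersolution_le (h.posSemidef i) hη v
  calc ∑ z, transProb H s η i (xorStr u z) z * transWeight H s η i (xorStr u z) z ^ 2
      = ∑ z, (1 - H.scaled s i) u (xorStr u z) * guideNext H s η i (xorStr u z) /
          guide H s η i u := by
        refine Finset.sum_congr rfl fun z _ => ?_
        rw [pow_two, ← mul_assoc, transProb_mul_transWeight h hη, transWeight,
          xorStr_right_cancel, mul_div_assoc]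
        congr 1
        -- Symmetry of the local term turns the sum over column `u` into a sum over row `u`.
        have := symm_of_posSemidef (h.posSemidef i) (xorStr u z) u
        rw [Matrix.sub_apply, Matrix.sub_apply, this, one_apply, one_apply]
        congr 2
        exact propext eq_comm
    _ ≤ ∑ z, (1 - H.scaled s i) u (xorStr u z) * ((1 + η) * guide H s η i (xorStr u z)) /
          guide H s η i u := by
        refine Finset.sum_le_sum fun z _ => ?_
        gcongr
        · exact one_sub_apply_nonneg (h.diag_lt_one i) (h.off_nonpos i) _ _
        · exact hle _
    _ = (1 + η) * guideNext H s η i u / guide H s η i u := by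
        rw [← Finset.sum_div, guideNext_eq_sum, Finset.mul_sum]
        congr 1
        exact Finset.sum_congr rfl fun z _ => by ring
    _ ≤ (1 + η) ^ 2 := by
        rw [div_le_iff₀ hg, pow_two, mul_assoc]
        exact mul_le_mul_of_nonneg_left (hle u) (by linarith)

variable (H s η)

/-- The expectation after one step of the walk: a term is chosen uniformly, and some of its bits are
flipped. -/
noncomputable def stepE (p : BitStr n × ℝ) (F : BitStr n × ℝ → ℝ) : ℝ :=
  ∑ i, (H.numTerms : ℝ)⁻¹ * ∑ z, transProb H s η i (p.1 ∘ H.site i) z *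
    F (flipBits (H.site i) z p.1, p.2 * transWeight H s η i (p.1 ∘ H.site i) z)

/-- The operator whose powers the walk estimates. -/
noncomputable def avgOp : Matrix (BitStr n) (BitStr n) ℝ :=
  (H.numTerms : ℝ)⁻¹ • ∑ i, (1 - embed (H.site i) (H.scaled s i))

/-- The operator that governs the second moment. -/
noncomputable def secondOp (g : BitStr n → ℝ) (x : BitStr n) : ℝ :=
  ∑ i, (H.numTerms : ℝ)⁻¹ * ∑ z, transProb H s η i (x ∘ H.site i) z *
    transWeight H s η i (x ∘ H.site i) z ^ 2 * g (flipBits (H.site i) z x)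

variable {H s η}

theorem stepE_congr {F G : BitStr n × ℝ → ℝ} (p : BitStr n × ℝ) (h : ∀ q, F q = G q) :
    stepE H s η p F = stepE H s η p G := by
  rw [funext h]

theorem stepE_const_mul (c : ℝ) (p : BitStr n × ℝ) (F : BitStr n × ℝ → ℝ) :
    stepE H s η p (fun q => c * F q) = c * stepE H s η p F := by
  simp only [stepE, Finset.mul_sum]
  exact Finset.sum_congr rfl fun i _ => Finset.sum_congr rfl fun z _ => by ring

theorem avgOp_mulVec (f : BitStr n → ℝ) (x : BitStr n) :
    (avgOp H s *ᵥ f) x =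
      ∑ i, (H.numTerms : ℝ)⁻¹ * (f x - (embed (H.site i) (H.scaled s i) *ᵥ f) x) := by
  rw [avgOp, smul_mulVec, sum_mulVec, Pi.smul_apply, Finset.sum_apply, smul_eq_mul,
    Finset.mul_sum]
  refine Finset.sum_congr rfl fun i _ => ?_
  rw [sub_mulVec, one_mulVec, Pi.sub_apply]

/-- In the sum over flip patterns, the identity matrix contributes only through the empty pattern.
-/
theorem sum_one_sub_mul (i : Fin H.numTerms) (f : BitStr n → ℝ) (x : BitStr n) :
    ∑ z, (1 - H.scaled s i) (x ∘ H.site i) (xorStr (x ∘ H.site i) z) *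
      f (flipBits (H.site i) z x) = f x - (embed (H.site i) (H.scaled s i) *ᵥ f) x := by
  rw [embed_mulVec]
  simp only [Matrix.sub_apply, sub_mul, Finset.sum_sub_distrib]
  congr 1
  rw [Finset.sum_eq_single fun _ => false]
  · rw [flipBits_zero]
    have : xorStr (x ∘ H.site i) (fun _ => false) = x ∘ H.site i := by
      funext j; simp [xorStr]
    rw [this, one_apply_eq, one_mul]
  · intro z _ hz
    rw [one_apply_ne, zero_mul]
    intro h
    apply hz
    rw [← xorStr_xorStr_cancel (x ∘ H.site i) z, ← h, xorStr_self]
  · simp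

theorem stepE_linear (h : H.ScaleOk s) (hη : 0 < η) (x : BitStr n) (W : ℝ) (g : BitStr n → ℝ) :
    stepE H s η (x, W) (fun q => q.2 * g q.1) = W * (avgOp H s *ᵥ g) x := by
  rw [avgOp_mulVec, stepE, Finset.mul_sum]
  refine Finset.sum_congr rfl fun i _ => ?_
  rw [← sum_one_sub_mul, mul_left_comm W]
  congr 1
  rw [Finset.mul_sum]
  refine Finset.sum_congr rfl fun z _ => ?_
  rw [← transProb_mul_transWeight h hη]
  ring

theorem stepE_sq (x : BitStr n) (W : ℝ) (g : BitStr n → ℝ) :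
    stepE H s η (x, W) (fun q => q.2 ^ 2 * g q.1) = W ^ 2 * secondOp H s η g x := by
  rw [secondOp, stepE, Finset.mul_sum]
  refine Finset.sum_congr rfl fun i _ => ?_
  rw [mul_left_comm (W ^ 2)]
  congr 1
  rw [Finset.mul_sum]
  exact Finset.sum_congr rfl fun z _ => by ring

theorem secondOp_mono (h : H.ScaleOk s) (hη : 0 < η) {f g : BitStr n → ℝ} (hfg : ∀ x, f x ≤ g x)
    (x : BitStr n) : secondOp H s η f x ≤ secondOp H s η g x := by
  refine Finset.sum_le_sum fun i _ => ?_
  gcongr with z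
  · exact mul_nonneg (transProb_nonneg h hη i _ _) (sq_nonneg _)
  · exact hfg _

theorem secondOp_const_mul (c : ℝ) (g : BitStr n → ℝ) (x : BitStr n) :
    secondOp H s η (fun y => c * g y) x = c * secondOp H s η g x := by
  simp only [secondOp, Finset.mul_sum]
  exact Finset.sum_congr rfl fun i _ => Finset.sum_congr rfl fun z _ => by ring

/-- Exchanging the sums groups the transitions by their end point instead of their starting point;
`sum_transProb_mul_sq_le` bounds what enters each end point, for every choice of the term. -/
theorem sum_secondOp_le (h : H.ScaleOk s) (hη : 0 < η) {g : BitStr n → ℝ} (hg : ∀ x, 0 ≤ g x) :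
    ∑ x, secondOp H s η g x ≤ (1 + η) ^ 2 * ∑ x, g x := by
  have hsum : 0 ≤ ∑ x, g x := Finset.sum_nonneg fun x _ => hg x
  have key : ∀ i : Fin H.numTerms, ∑ x, ∑ z, transProb H s η i (x ∘ H.site i) z *
      transWeight H s η i (x ∘ H.site i) z ^ 2 * g (flipBits (H.site i) z x) ≤
        (1 + η) ^ 2 * ∑ x, g x := by
    intro i
    calc ∑ x, ∑ z, transProb H s η i (x ∘ H.site i) z *
        transWeight H s η i (x ∘ H.site i) z ^ 2 * g (flipBits (H.site i) z x)
        = ∑ x, (∑ z, transProb H s η i (xorStr (x ∘ H.site i) z) z *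
            transWeight H s η i (xorStr (x ∘ H.site i) z) z ^ 2) * g x := by
          rw [Finset.sum_comm]
          simp only [Finset.sum_mul]
          rw [Finset.sum_comm (s := (Finset.univ : Finset (BitStr n)))]
          refine Finset.sum_congr rfl fun z _ => ?_
          rw [← sum_flipBits (H.site i) z]
          refine Finset.sum_congr rfl fun x _ => ?_
          rw [flipBits_invol, flipBits_comp]
      _ ≤ ∑ x, (1 + η) ^ 2 * g x := by
          refine Finset.sum_le_sum fun x _ => ?_
          exact mul_le_mul_of_nonneg_right (sum_transProb_mul_sq_le h hη i _) (hg x)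
      _ = _ := by rw [Finset.mul_sum]
  calc ∑ x, secondOp H s η g x = ∑ i, (H.numTerms : ℝ)⁻¹ *
        ∑ x, ∑ z, transProb H s η i (x ∘ H.site i) z *
          transWeight H s η i (x ∘ H.site i) z ^ 2 * g (flipBits (H.site i) z x) := by
        simp only [secondOp]
        rw [Finset.sum_comm]
        exact Finset.sum_congr rfl fun i _ => by rw [Finset.mul_sum]
    _ ≤ ∑ i : Fin H.numTerms, (H.numTerms : ℝ)⁻¹ * ((1 + η) ^ 2 * ∑ x, g x) := by
        refine Finset.sum_le_sum fun i _ => ?_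
        exact mul_le_mul_of_nonneg_left (key i) (by positivity)
    _ ≤ (1 + η) ^ 2 * ∑ x, g x := by
        rw [Finset.sum_const, Finset.card_univ, Fintype.card_fin, nsmul_eq_mul, ← mul_assoc]
        -- An inequality rather than an equality, in order to include a Hamiltonian without terms.
        have : (H.numTerms : ℝ) * (H.numTerms : ℝ)⁻¹ ≤ 1 := mul_inv_le_one
        exact mul_le_of_le_one_left (by positivity) this

/-- An average of contractions is a contraction, by the Cauchy-Schwarz inequality for the sum over
terms. -/
theorem sum_sq_avgOp_le (h : H.ScaleOk s) (f : BitStr n → ℝ) :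
    ∑ x, (avgOp H s *ᵥ f) x ^ 2 ≤ ∑ x, f x ^ 2 := by
  have hf : 0 ≤ ∑ x, f x ^ 2 := Finset.sum_nonneg fun x _ => sq_nonneg _
  set d : Fin H.numTerms → BitStr n → ℝ :=
    fun i x => f x - (embed (H.site i) (H.scaled s i) *ᵥ f) x
  calc ∑ x, (avgOp H s *ᵥ f) x ^ 2
      ≤ ∑ x, (H.numTerms : ℝ)⁻¹ ^ 2 * (H.numTerms * ∑ i, d i x ^ 2) := by
        refine Finset.sum_le_sum fun x _ => ?_
        rw [avgOp_mulVec, ← Finset.mul_sum, mul_pow]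
        refine mul_le_mul_of_nonneg_left ?_ (by positivity)
        have := sq_sum_le_card_mul_sum_sq (s := Finset.univ) (f := fun i => d i x)
        rwa [Finset.card_univ, Fintype.card_fin] at this
    _ = (H.numTerms : ℝ)⁻¹ ^ 2 * (H.numTerms * ∑ i, ∑ x, d i x ^ 2) := by
        rw [← Finset.mul_sum, ← Finset.mul_sum, Finset.sum_comm]
    _ ≤ (H.numTerms : ℝ)⁻¹ ^ 2 * (H.numTerms * ∑ i : Fin H.numTerms, ∑ x, f x ^ 2) := by
        refine mul_le_mul_of_nonneg_left (mul_le_mul_of_nonneg_left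
          (Finset.sum_le_sum fun i _ => ?_) (by positivity)) (by positivity)
        exact sum_sq_sub_embed_le (H.site i) (h.posSemidef i) (h.trace_lt_one i).le f
    _ = ((H.numTerms : ℝ) * (H.numTerms : ℝ)⁻¹) ^ 2 * ∑ x, f x ^ 2 := by
        rw [Finset.sum_const, Finset.card_univ, Fintype.card_fin, nsmul_eq_mul]; ring
    _ ≤ ∑ x, f x ^ 2 := by
        have h1 : (H.numTerms : ℝ) * (H.numTerms : ℝ)⁻¹ ≤ 1 := mul_inv_le_one
        exact mul_le_of_le_one_left hf (pow_le_one₀ (by positivity) h1)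

theorem sum_sq_avgOp_pow_le (h : H.ScaleOk s) (m : ℕ) (f : BitStr n → ℝ) :
    ∑ x, ((avgOp H s ^ m) *ᵥ f) x ^ 2 ≤ ∑ x, f x ^ 2 := by
  induction m with
  | zero => simp
  | succ m ih =>
    rw [pow_succ', ← mulVec_mulVec]
    exact (sum_sq_avgOp_le h _).trans ih

theorem abs_dotProduct_avgOp_pow_le (h : H.ScaleOk s) (m : ℕ) (f : BitStr n → ℝ) :
    |f ⬝ᵥ (avgOp H s ^ m) *ᵥ f| ≤ ∑ x, f x ^ 2 := by
  have h1 := sum_sq_avgOp_pow_le h m f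
  set g := (avgOp H s ^ m) *ᵥ f
  calc |f ⬝ᵥ g| ≤ ∑ x, |f x * g x| := Finset.abs_sum_le_sum_abs _ _
    _ ≤ ∑ x, (f x ^ 2 + g x ^ 2) / 2 := by
        refine Finset.sum_le_sum fun x _ => ?_
        rw [abs_mul, ← sq_abs (f x), ← sq_abs (g x)]
        nlinarith [sq_nonneg (|f x| - |g x|)]
    _ = (∑ x, f x ^ 2 + ∑ x, g x ^ 2) / 2 := by
        rw [← Finset.sum_div, Finset.sum_add_distrib]
    _ ≤ _ := by linarith

/-! ### Walks of random length -/

/-- The term number `j` of the exponential series. -/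
noncomputable def expTerm (lam : ℝ) (j : ℕ) : ℝ := lam ^ j / j.factorial

/-- The sum of the terms number `j, …, j + r` of the exponential series. -/
noncomputable def expTail (lam : ℝ) (r j : ℕ) : ℝ := ∑ m ∈ Finset.range (r + 1), expTerm lam (j + m)

theorem expTerm_nonneg {lam : ℝ} (hl : 0 ≤ lam) (j : ℕ) : 0 ≤ expTerm lam j := by
  rw [expTerm]; positivity

theorem expTail_nonneg {lam : ℝ} (hl : 0 ≤ lam) (r j : ℕ) : 0 ≤ expTail lam r j :=
  Finset.sum_nonneg fun _ _ => expTerm_nonneg hl _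

theorem expTail_zero (lam : ℝ) (j : ℕ) : expTail lam 0 j = expTerm lam j := by
  simp [expTail]

theorem expTail_succ (lam : ℝ) (r j : ℕ) :
    expTail lam (r + 1) j = expTerm lam j + expTail lam r (j + 1) := by
  rw [expTail, Finset.sum_range_succ', add_comm, add_zero, expTail]
  congr 1
  exact Finset.sum_congr rfl fun m _ => by rw [add_assoc, add_comm 1 m]

theorem expTerm_succ (lam : ℝ) (j : ℕ) :
    expTerm lam (j + 1) = expTerm lam j * lam / ((j : ℝ) + 1) := by
  rw [expTerm, expTerm, Nat.factorial_succ]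
  push_cast
  field_simp
  ring

variable (H s η) in
/-- The expectation at the end of the walk, when after `j` steps at most `r` steps remain. -/
noncomputable def chainE (lam : ℝ) : ℕ → ℕ → BitStr n × ℝ → (BitStr n × ℝ → ℝ) → ℝ
  | 0, _, p, F => F p
  | r + 1, j, p, F => expTerm lam j / expTail lam (r + 1) j * F p +
      (1 - expTerm lam j / expTail lam (r + 1) j) *
        stepE H s η p fun q => chainE lam r (j + 1) q F

/-- Stopping after `j` steps with probability `expTerm lam j / expTail lam r j` is the hazard rate
of the Poisson law truncated to `j, …, j + r`. Multiplication by the remaining mass telescopes these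
conditional probabilities and leaves the plain terms of the series. -/
theorem expTail_mul_chainE (h : H.ScaleOk s) (hη : 0 < η) {lam : ℝ} (hl : 0 ≤ lam) (r : ℕ) :
    ∀ j, 0 < expTail lam r j → ∀ (x : BitStr n) (W : ℝ) (g : BitStr n → ℝ),
      expTail lam r j * chainE H s η lam r j (x, W) (fun q => q.2 * g q.1) =
        W * ∑ m ∈ Finset.range (r + 1), expTerm lam (j + m) * ((avgOp H s ^ m) *ᵥ g) x := by
  induction r with
  | zero =>
    intro j _ x W g
    simp only [expTail_zero, chainE, zero_add, Finset.sum_range_one, add_zero, pow_zero,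
      one_mulVec]
    ring
  | succ r ih =>
    intro j ht x W g
    rw [chainE, Finset.sum_range_succ', pow_zero, one_mulVec, add_zero]
    have h1 : expTail lam (r + 1) j * (1 - expTerm lam j / expTail lam (r + 1) j) =
        expTail lam r (j + 1) := by
      rw [mul_sub, mul_div_cancel₀ _ ht.ne', expTail_succ]; ring
    have h2 : expTail lam r (j + 1) * stepE H s η (x, W)
        (fun q => chainE H s η lam r (j + 1) q fun q => q.2 * g q.1) =
        W * ∑ m ∈ Finset.range (r + 1),
          expTerm lam (j + (m + 1)) * ((avgOp H s ^ (m + 1)) *ᵥ g) x := by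
      -- If no mass remains, as for `lam = 0`, the walk stops almost surely and all later terms of
      -- the series vanish, so both sides are zero.
      rcases (expTail_nonneg hl r (j + 1)).eq_or_lt with h0 | h0
      · rw [← h0, zero_mul, Finset.sum_eq_zero, mul_zero]
        intro m hm
        have := (Finset.sum_eq_zero_iff_of_nonneg
          fun m _ => expTerm_nonneg hl (j + 1 + m)).1 h0.symm m hm
        rw [add_comm m 1, ← add_assoc, this, zero_mul]
      · rw [← stepE_const_mul]
        rw [stepE_congr (G := fun q => q.2 * (∑ m ∈ Finset.range (r + 1),
          expTerm lam (j + 1 + m) • ((avgOp H s ^ m) *ᵥ g)) q.1)]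
        · rw [stepE_linear h hη, mulVec_sum, Finset.sum_apply]
          congr 1
          refine Finset.sum_congr rfl fun m _ => ?_
          rw [mulVec_smul, Pi.smul_apply, smul_eq_mul, mulVec_mulVec, ← pow_succ',
            add_comm m 1, add_assoc]
        · intro q
          rw [ih (j + 1) h0, Finset.sum_apply]
          rfl
    rw [mul_add, ← mul_assoc, mul_div_cancel₀ _ ht.ne', ← mul_assoc (expTail lam (r + 1) j) (_ - _),
      h1, h2]
    ring

variable (H s η) in
/-- The second moment operator of the walk of random length. -/
noncomputable def chainSecond (lam : ℝ) : ℕ → ℕ → (BitStr n → ℝ) → BitStr n → ℝ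
  | 0, _, g, x => g x
  | r + 1, j, g, x => expTerm lam j / expTail lam (r + 1) j * g x +
      (1 - expTerm lam j / expTail lam (r + 1) j) *
        secondOp H s η (chainSecond lam r (j + 1) g) x

theorem chainE_sq (lam : ℝ) (r : ℕ) : ∀ (j : ℕ) (x : BitStr n) (W : ℝ) (g : BitStr n → ℝ),
    chainE H s η lam r j (x, W) (fun q => q.2 ^ 2 * g q.1) =
      W ^ 2 * chainSecond H s η lam r j g x := by
  induction r with
  | zero => intro j x W g; rfl
  | succ r ih =>
    intro j x W g
    rw [chainE, chainSecond, stepE_congr (G := fun q => q.2 ^ 2 *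
      chainSecond H s η lam r (j + 1) g q.1) _ fun q => ih (j + 1) q.1 q.2 g, stepE_sq]
    ring

theorem expTerm_div_nonneg {lam : ℝ} (hl : 0 ≤ lam) (r j : ℕ) :
    0 ≤ expTerm lam j / expTail lam r j :=
  div_nonneg (expTerm_nonneg hl j) (expTail_nonneg hl r j)

theorem expTerm_div_le_one {lam : ℝ} (hl : 0 ≤ lam) (r j : ℕ) :
    expTerm lam j / expTail lam r j ≤ 1 := by
  refine div_le_one_of_le₀ ?_ (expTail_nonneg hl r j)
  cases r with
  | zero => rw [expTail_zero]
  | succ r =>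
    rw [expTail_succ]
    linarith [expTail_nonneg hl r (j + 1)]

theorem chainSecond_mono (h : H.ScaleOk s) (hη : 0 < η) {lam : ℝ} (hl : 0 ≤ lam) (r : ℕ) :
    ∀ (j : ℕ) {f g : BitStr n → ℝ} (_ : ∀ x, f x ≤ g x) (x : BitStr n),
      chainSecond H s η lam r j f x ≤ chainSecond H s η lam r j g x := by
  induction r with
  | zero => intro j f g hfg x; exact hfg x
  | succ r ih =>
    intro j f g hfg x
    rw [chainSecond, chainSecond]
    refine add_le_add (mul_le_mul_of_nonneg_left (hfg x) (expTerm_div_nonneg hl _ _))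
      (mul_le_mul_of_nonneg_left (secondOp_mono h hη (ih (j + 1) hfg) x) ?_)
    linarith [expTerm_div_le_one hl (r + 1) j]

theorem chainSecond_const_mul (lam : ℝ) (r : ℕ) : ∀ (j : ℕ) (c : ℝ) (g : BitStr n → ℝ)
    (x : BitStr n), chainSecond H s η lam r j (fun y => c * g y) x =
      c * chainSecond H s η lam r j g x := by
  induction r with
  | zero => intro j c g x; rfl
  | succ r ih =>
    intro j c g x
    rw [chainSecond, chainSecond, funext (ih (j + 1) c g), secondOp_const_mul]
    ring

theorem chainSecond_nonneg (h : H.ScaleOk s) (hη : 0 < η) {lam : ℝ} (hl : 0 ≤ lam) (r j : ℕ)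
    {g : BitStr n → ℝ} (hg : ∀ x, 0 ≤ g x) (x : BitStr n) :
    0 ≤ chainSecond H s η lam r j g x := by
  have h1 := chainSecond_const_mul (H := H) (s := s) (η := η) lam r j 0 g x
  rw [zero_mul] at h1
  rw [← h1]
  exact chainSecond_mono h hη hl r j (fun y => by simpa using hg y) x

/-- Stopping early only helps: both branches are bounded by the factor for the maximal number of
steps, and a convex combination preserves the bound. -/
theorem sum_chainSecond_le (h : H.ScaleOk s) (hη : 0 < η) {lam : ℝ} (hl : 0 ≤ lam) (r : ℕ) :
    ∀ (j : ℕ) {g : BitStr n → ℝ} (_ : ∀ x, 0 ≤ g x),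
      ∑ x, chainSecond H s η lam r j g x ≤ ((1 + η) ^ 2) ^ r * ∑ x, g x := by
  induction r with
  | zero => intro j g hg; simp [chainSecond]
  | succ r ih =>
    intro j g hg
    have hsum : 0 ≤ ∑ x, g x := Finset.sum_nonneg fun x _ => hg x
    have h1 : (1 : ℝ) ≤ ((1 + η) ^ 2) ^ (r + 1) :=
      one_le_pow₀ (one_le_pow₀ (by linarith))
    have h2 : ∑ x, secondOp H s η (chainSecond H s η lam r (j + 1) g) x ≤
        ((1 + η) ^ 2) ^ (r + 1) * ∑ x, g x := by
      refine (sum_secondOp_le h hη (chainSecond_nonneg h hη hl r (j + 1) hg)).trans ?_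
      rw [pow_succ' ((1 + η) ^ 2) r, mul_assoc]
      exact mul_le_mul_of_nonneg_left (ih (j + 1) hg) (by positivity)
    have ha := expTerm_div_nonneg hl (r + 1) j
    have hb := expTerm_div_le_one hl (r + 1) j
    simp only [chainSecond]
    rw [Finset.sum_add_distrib, ← Finset.mul_sum, ← Finset.mul_sum]
    set c := expTerm lam j / expTail lam (r + 1) j
    calc c * ∑ x, g x + (1 - c) * ∑ x, secondOp H s η (chainSecond H s η lam r (j + 1) g) x
        ≤ c * (((1 + η) ^ 2) ^ (r + 1) * ∑ x, g x) +
          (1 - c) * (((1 + η) ^ 2) ^ (r + 1) * ∑ x, g x) := by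
          refine add_le_add (mul_le_mul_of_nonneg_left ?_ ha)
            (mul_le_mul_of_nonneg_left h2 (by linarith))
          exact le_mul_of_one_le_left hsum h1
      _ = _ := by ring

end Walk

open Matrix

/-! ## The truncated exponential series -/

section Series

theorem hasSum_expTerm (lam : ℝ) : HasSum (expTerm lam) (Real.exp lam) := by
  rw [Real.exp_eq_exp_ℝ]
  exact NormedSpace.expSeries_div_hasSum_exp lam

theorem expTail_zero_pos {lam : ℝ} (hl : 0 ≤ lam) (R : ℕ) : 0 < expTail lam R 0 := by
  have h1 : expTerm lam (0 + 0) ≤ expTail lam R 0 :=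
    Finset.single_le_sum (f := fun m => expTerm lam (0 + m)) (fun m _ => expTerm_nonneg hl _)
      (Finset.mem_range.2 (Nat.succ_pos R))
  refine lt_of_lt_of_le ?_ h1
  simp [expTerm]

/-- A Chernoff bound for the Poisson tail: beyond index `R` one has `2 ^ R ≤ 2 ^ m`, and the series
with the additional factors `2 ^ m` sums to `e^{2 lam}`. -/
theorem exp_sub_expTail_le {lam : ℝ} (hl : 0 ≤ lam) (R : ℕ) :
    2 ^ R * (Real.exp lam - expTail lam R 0) ≤ Real.exp lam ^ 2 := by
  have h1 : HasSum (fun m => expTerm lam (m + (R + 1))) (Real.exp lam - expTail lam R 0) := by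
    have := (hasSum_nat_add_iff' (R + 1)).2 (hasSum_expTerm lam)
    simpa [expTail] using this
  have h2 : HasSum (fun m => (2 : ℝ) ^ m * expTerm lam m) (Real.exp (2 * lam)) := by
    have := hasSum_expTerm (2 * lam)
    refine this.congr_fun ?_
    intro m
    simp only [expTerm, mul_pow]
    ring
  have h3 : HasSum (fun m => (2 : ℝ) ^ (m + (R + 1)) * expTerm lam (m + (R + 1)))
      (Real.exp (2 * lam) - ∑ m ∈ Finset.range (R + 1), (2 : ℝ) ^ m * expTerm lam m) :=
    (hasSum_nat_add_iff' (R + 1)).2 h2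
  have h4 := hasSum_le (fun m => ?_) (h1.mul_left (2 ^ R)) h3
  · refine h4.trans ?_
    rw [← Real.exp_nat_mul]
    have : 0 ≤ ∑ m ∈ Finset.range (R + 1), (2 : ℝ) ^ m * expTerm lam m :=
      Finset.sum_nonneg fun m _ => mul_nonneg (by positivity) (expTerm_nonneg hl m)
    push_cast
    linarith
  · refine mul_le_mul_of_nonneg_right ?_ (expTerm_nonneg hl _)
    exact pow_le_pow_right₀ one_le_two (by omega)

/-- There are two errors, the discarded tail and the normalization by the truncated sum in place of
`e^lam`. Relative to `e^lam`, each is at most the missing mass times `C`, that is `ε C / 2`. -/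
theorem abs_truncated_sub_le {lam ε C : ℝ} (hl : 0 ≤ lam) {R : ℕ}
    (hR : 2 * Real.exp lam ≤ ε * 2 ^ R) {b : ℕ → ℝ} (hb : ∀ m, |b m| ≤ C) {S : ℝ}
    (hS : HasSum (fun m => expTerm lam m * b m) S) :
    |(∑ m ∈ Finset.range (R + 1), expTerm lam (0 + m) * b m) / expTail lam R 0 -
      Real.exp (-lam) * S| ≤ ε * C := by
  have hC : 0 ≤ C := (abs_nonneg _).trans (hb 0)
  have ht := expTail_zero_pos hl R
  set t := expTail lam R 0 with htdef
  have hexp := Real.exp_pos lam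
  have htail := exp_sub_expTail_le hl R
  rw [← htdef] at htail
  have h1 : HasSum (fun m => expTerm lam (m + (R + 1))) (Real.exp lam - t) := by
    have := (hasSum_nat_add_iff' (R + 1)).2 (hasSum_expTerm lam)
    simpa [htdef, expTail] using this
  have h0 : 0 ≤ Real.exp lam - t := h1.nonneg fun m => expTerm_nonneg hl _
  have h2 : HasSum (fun m => expTerm lam (m + (R + 1)) * b (m + (R + 1)))
      (S - ∑ m ∈ Finset.range (R + 1), expTerm lam m * b m) :=
    (hasSum_nat_add_iff' (R + 1)).2 hS
  set P := ∑ m ∈ Finset.range (R + 1), expTerm lam m * b m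
  have hP : ∑ m ∈ Finset.range (R + 1), expTerm lam (0 + m) * b m = P := by
    simp only [zero_add]; rfl
  have h3 : |S - P| ≤ (Real.exp lam - t) * C := by
    rw [abs_le]
    constructor
    · refine hasSum_le (fun m => ?_) (h1.mul_right C).neg h2
      have := mul_le_mul_of_nonneg_left (neg_le_of_abs_le (hb (m + (R + 1))))
        (expTerm_nonneg hl (m + (R + 1)))
      linarith
    · refine hasSum_le (fun m => ?_) h2 (h1.mul_right C)
      exact mul_le_mul_of_nonneg_left (le_of_abs_le (hb _)) (expTerm_nonneg hl _)
  have h4 : |P| ≤ t * C := by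
    refine (Finset.abs_sum_le_sum_abs _ _).trans ?_
    rw [htdef, expTail, Finset.sum_mul]
    refine Finset.sum_le_sum fun m _ => ?_
    rw [abs_mul, zero_add, abs_of_nonneg (expTerm_nonneg hl m)]
    exact mul_le_mul_of_nonneg_left (hb m) (expTerm_nonneg hl m)
  have h5 : 2 * (Real.exp lam - t) ≤ ε * Real.exp lam := by
    have h6 : 2 ^ R * (2 * (Real.exp lam - t)) ≤ 2 ^ R * (ε * Real.exp lam) := by
      nlinarith
    exact le_of_mul_le_mul_left h6 (by positivity)
  rw [hP, Real.exp_neg]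
  -- The exact splitting into the normalization error and the tail.
  have h7 : P / t - (Real.exp lam)⁻¹ * S =
      (Real.exp lam)⁻¹ * ((P / t) * (Real.exp lam - t) - (S - P)) := by
    field_simp
    ring
  have h8 : |P / t| ≤ C := by
    rw [abs_div, abs_of_pos ht, div_le_iff₀ ht]
    linarith
  rw [h7, abs_mul, abs_of_pos (inv_pos.2 hexp), inv_mul_le_iff₀ hexp]
  calc |P / t * (Real.exp lam - t) - (S - P)|
      ≤ |P / t * (Real.exp lam - t)| + |S - P| := abs_sub _ _
    _ ≤ C * (Real.exp lam - t) + (Real.exp lam - t) * C := by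
        rw [abs_mul, abs_of_nonneg h0]
        gcongr
    _ = 2 * (Real.exp lam - t) * C := by ring
    _ ≤ ε * Real.exp lam * C := mul_le_mul_of_nonneg_right h5 hC
    _ = _ := by ring

theorem hasSum_dotProduct_exp {ι : Type*} [Fintype ι] [DecidableEq ι] (B : Matrix ι ι ℝ)
    (lam : ℝ) (v : ι → ℝ) :
    HasSum (fun m => expTerm lam m * (v ⬝ᵥ (B ^ m) *ᵥ v))
      (v ⬝ᵥ NormedSpace.exp (lam • B) *ᵥ v) := by
  open scoped Matrix.Norms.Operator in
  have h1 := NormedSpace.exp_series_hasSum_exp' (𝕂 := ℝ) (lam • B)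
  let φ : Matrix ι ι ℝ →ₗ[ℝ] ℝ :=
    { toFun := fun M => v ⬝ᵥ M *ᵥ v
      map_add' := fun M N => by rw [add_mulVec, dotProduct_add]
      map_smul' := fun c M => by rw [smul_mulVec, dotProduct_smul]; rfl }
  have hφ : Continuous φ := φ.continuous_of_finiteDimensional
  have h2 := h1.map φ hφ
  refine h2.congr_fun ?_
  intro m
  simp only [Function.comp_apply, map_smul, smul_pow, smul_eq_mul, expTerm]
  change _ = (m.factorial : ℝ)⁻¹ * (lam ^ m * (v ⬝ᵥ (B ^ m) *ᵥ v))
  ring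

end Series

/-! ## The signal -/

section Signal

variable {κ n : ℕ}

/-- The real signal. -/
noncomputable def Problem.realSignal (I : Problem κ n) (k : ℕ) : ℝ :=
  let E : Matrix (BitStr n) (BitStr n) ℝ := NormedSpace.exp (-((k : ℝ) • I.H.toMatrix))
  (fun x => (I.Φ.amp x).re) ⬝ᵥ E *ᵥ (fun x => (I.Φ.amp x).re) +
    (fun x => (I.Φ.amp x).im) ⬝ᵥ E *ᵥ (fun x => (I.Φ.amp x).im)

theorem embed_transpose {a : ℕ} (S : Fin a ↪ Fin n) (h : Matrix (BitStr a) (BitStr a) ℝ) :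
    (embed S h)ᵀ = embed S hᵀ := by
  ext x y
  have : (∀ j, (∀ i, S i ≠ j) → y j = x j) ↔ (∀ j, (∀ i, S i ≠ j) → x j = y j) :=
    ⟨fun h j hj => (h j hj).symm, fun h j hj => (h j hj).symm⟩
  simp only [transpose_apply, embed, this]

theorem toMatrix_transpose (H : LocalHamiltonian κ n) : H.toMatrixᵀ = H.toMatrix := by
  rw [LocalHamiltonian.toMatrix, transpose_sum]
  refine Finset.sum_congr rfl fun i _ => ?_
  rw [embed_transpose]
  congr 1
  have := H.isHermitian i
  rwa [IsHermitian, conjTranspose_eq_transpose_of_trivial] at this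

/-- For a real symmetric form, the mixed terms of real and imaginary parts cancel, so the value is
real and the two parts can be treated separately. -/
theorem star_dotProduct_map_mulVec {ι : Type*} [Fintype ι] (E : Matrix ι ι ℝ) (hE : Eᵀ = E)
    (v : ι → ℂ) : star v ⬝ᵥ (E.map Complex.ofReal) *ᵥ v =
      (((fun x => (v x).re) ⬝ᵥ E *ᵥ (fun x => (v x).re) +
        (fun x => (v x).im) ⬝ᵥ E *ᵥ (fun x => (v x).im) : ℝ) : ℂ) := by
  have hsymm : ∀ x y, E x y = E y x := fun x y => congrFun (congrFun hE y) x
  have hcross : ∑ x, ∑ y, (v x).re * (E x y * (v y).im) =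
      ∑ x, ∑ y, (v x).im * (E x y * (v y).re) := by
    rw [Finset.sum_comm]
    refine Finset.sum_congr rfl fun x _ => Finset.sum_congr rfl fun y _ => ?_
    rw [hsymm y x]; ring
  simp only [dotProduct, mulVec, Finset.mul_sum, map_apply, Pi.star_apply]
  apply Complex.ext
  · rw [Complex.ofReal_re, Complex.re_sum, ← Finset.sum_add_distrib]
    refine Finset.sum_congr rfl fun x _ => ?_
    rw [Complex.re_sum, ← Finset.sum_add_distrib]
    refine Finset.sum_congr rfl fun y _ => ?_
    simp [Complex.mul_re, Complex.mul_im]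
  · rw [Complex.ofReal_im, Complex.im_sum]
    have : ∑ x, (∑ y, star (v x) * ((E x y : ℂ) * v y)).im =
        ∑ x, ∑ y, ((v x).re * (E x y * (v y).im) - (v x).im * (E x y * (v y).re)) := by
      refine Finset.sum_congr rfl fun x _ => ?_
      rw [Complex.im_sum]
      refine Finset.sum_congr rfl fun y _ => ?_
      simp [Complex.mul_re, Complex.mul_im]
      ring
    rw [this]
    simp only [Finset.sum_sub_distrib]
    rw [hcross, sub_self]

theorem exp_map_ofReal {ι : Type*} [Fintype ι] [DecidableEq ι] (M : Matrix ι ι ℝ) :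
    NormedSpace.exp (M.map Complex.ofReal) = (NormedSpace.exp M).map Complex.ofReal := by
  open scoped Matrix.Norms.Operator in
  have h := NormedSpace.map_exp (Complex.ofRealHom.mapMatrix (m := ι))
    (Continuous.matrix_map continuous_id Complex.continuous_ofReal) M
  exact h.symm

theorem signal_eq (I : Problem κ n) (k : ℕ) : I.signal k = (I.realSignal k : ℂ) := by
  have h1 : -((k : ℂ) • I.H.toMatrix.map Complex.ofReal) =
      (-((k : ℝ) • I.H.toMatrix)).map Complex.ofReal := by
    ext x y
    simp
  rw [Problem.signal, h1, exp_map_ofReal, Problem.realSignal]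
  refine star_dotProduct_map_mulVec _ ?_ _
  rw [← exp_transpose, transpose_neg, transpose_smul, toMatrix_transpose]

/-- Averaging the operators `1 - H_i / s` and multiplying by `k N s` gives `k N s - kH`. The case `N
= 0` is separate because `N * N⁻¹ = 1` is used. -/
theorem smul_toMatrix_eq (H : LocalHamiltonian κ n) {s : ℝ} (hs : s ≠ 0) (k : ℝ) :
    -(k • H.toMatrix) = -(k * H.numTerms * s) • (1 : Matrix (BitStr n) (BitStr n) ℝ) +
      (k * H.numTerms * s) • avgOp H s := by
  by_cases hN : H.numTerms = 0
  · have : H.toMatrix = 0 := by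
      rw [LocalHamiltonian.toMatrix]
      have : IsEmpty (Fin H.numTerms) := by rw [hN]; infer_instance
      exact Finset.sum_of_isEmpty _
    rw [this, hN]
    simp
  · have hN' : (H.numTerms : ℝ) ≠ 0 := Nat.cast_ne_zero.2 hN
    rw [avgOp, smul_smul, mul_right_comm, mul_assoc _ _ (H.numTerms : ℝ)⁻¹, mul_inv_cancel₀ hN',
      mul_one, Finset.sum_sub_distrib, Finset.sum_const, Finset.card_univ, Fintype.card_fin,
      smul_sub, LocalHamiltonian.toMatrix, ← Nat.cast_smul_eq_nsmul ℝ, smul_smul,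
      Finset.smul_sum, Finset.smul_sum]
    have : ∀ i, (k * s) • embed (H.site i) (H.scaled s i) =
        k • embed (H.site i) (H.term i) := by
      intro i
      rw [LocalHamiltonian.scaled, embed_smul, smul_smul, mul_assoc, mul_inv_cancel₀ hs, mul_one]
    rw [Finset.sum_congr rfl fun i _ => this i, mul_right_comm k s]
    module

theorem exp_neg_smul_toMatrix (H : LocalHamiltonian κ n) {s : ℝ} (hs : s ≠ 0) (k : ℝ) :
    NormedSpace.exp (-(k • H.toMatrix)) = Real.exp (-(k * H.numTerms * s)) •
      NormedSpace.exp ((k * H.numTerms * s) • avgOp H s) := by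
  rw [smul_toMatrix_eq H hs, Matrix.exp_add_of_commute]
  · have : NormedSpace.exp (-(k * H.numTerms * s) • (1 : Matrix (BitStr n) (BitStr n) ℝ)) =
        Real.exp (-(k * H.numTerms * s)) • (1 : Matrix (BitStr n) (BitStr n) ℝ) := by
      rw [smul_one_eq_diagonal, exp_diagonal, smul_one_eq_diagonal]
      congr 1
      rw [Pi.exp_def, Real.exp_eq_exp_ℝ]
    rw [this, smul_mul_assoc, one_mul]
  · exact ((Commute.one_left _).smul_left _).smul_right _

/-- The expectation of a function of the output of the algorithm. -/
noncomputable def outE (I : Problem κ n) (s η lam : ℝ) (R : ℕ) (F : ℝ → ℝ) : ℝ :=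
  ∑ x, ‖I.Φ.amp x‖ ^ 2 *
    chainE I.H s η lam R 0 (x, 1) fun q => F (q.2 * (I.ratio x q.1).re)

/-- Sampling from `|Φ(x)|²` cancels the denominator of the ratio and leaves the real part of `conj
Φ(x) Φ(y)`. At a zero of `Φ` both sides vanish, so the unspecified value of the ratio there is
harmless. -/
theorem sq_norm_mul_ratio_re (I : Problem κ n) (x y : BitStr n) :
    ‖I.Φ.amp x‖ ^ 2 * (I.ratio x y).re =
      (I.Φ.amp x).re * (I.Φ.amp y).re + (I.Φ.amp x).im * (I.Φ.amp y).im := by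
  by_cases h : I.Φ.amp x = 0
  · simp [h]
  · rw [I.ratio_spec x y h, Complex.sq_norm, Complex.div_re]
    have : Complex.normSq (I.Φ.amp x) ≠ 0 := fun h' => h (Complex.normSq_eq_zero.1 h')
    field_simp

theorem abs_outE_sub_le (I : Problem κ n) {s η ε : ℝ} (h : I.H.ScaleOk s) (hη : 0 < η) (k : ℕ)
    {lam : ℝ} (hlam : lam = k * I.H.numTerms * s) {R : ℕ}
    (hR : 2 * Real.exp lam ≤ ε * 2 ^ R) :
    |outE I s η lam R id - I.realSignal k| ≤ ε := by
  have hl : 0 ≤ lam := by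
    have := h.pos
    rw [hlam]; positivity
  have ht := expTail_zero_pos hl R
  set u : BitStr n → ℝ := fun x => (I.Φ.amp x).re
  set w : BitStr n → ℝ := fun x => (I.Φ.amp x).im
  set B := avgOp I.H s
  -- As `B` is a contraction and `Φ` is normalized, the coefficients of the series are bounded by
  -- one, which makes the truncation error `ε` itself.
  have hb : ∀ m, |u ⬝ᵥ (B ^ m) *ᵥ u + w ⬝ᵥ (B ^ m) *ᵥ w| ≤ 1 := by
    intro m
    refine (abs_add_le _ _).trans ?_
    refine (add_le_add (abs_dotProduct_avgOp_pow_le h m u)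
      (abs_dotProduct_avgOp_pow_le h m w)).trans (le_of_eq ?_)
    rw [← I.Φ.normalized, ← Finset.sum_add_distrib]
    refine Finset.sum_congr rfl fun x _ => ?_
    rw [Complex.sq_norm, Complex.normSq_apply]
    ring
  have hS := (hasSum_dotProduct_exp B lam u).add (hasSum_dotProduct_exp B lam w)
  simp only [← mul_add] at hS
  have key := abs_truncated_sub_le hl hR hb hS
  rw [mul_one] at key
  have h1 : I.realSignal k = Real.exp (-lam) * (u ⬝ᵥ NormedSpace.exp (lam • B) *ᵥ u +
      w ⬝ᵥ NormedSpace.exp (lam • B) *ᵥ w) := by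
    simp only [Problem.realSignal]
    rw [exp_neg_smul_toMatrix I.H h.pos.ne', ← hlam, smul_mulVec, smul_mulVec, dotProduct_smul,
      dotProduct_smul, smul_eq_mul, smul_eq_mul, mul_add]
  have h2 : outE I s η lam R id = (∑ m ∈ Finset.range (R + 1), expTerm lam (0 + m) *
      (u ⬝ᵥ (B ^ m) *ᵥ u + w ⬝ᵥ (B ^ m) *ᵥ w)) / expTail lam R 0 := by
    rw [eq_div_iff ht.ne', mul_comm, outE, Finset.mul_sum]
    have h3 : ∀ x, expTail lam R 0 * (‖I.Φ.amp x‖ ^ 2 *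
        chainE I.H s η lam R 0 (x, 1) fun q => id (q.2 * (I.ratio x q.1).re)) =
        ∑ m ∈ Finset.range (R + 1), expTerm lam (0 + m) *
          (u x * ((B ^ m) *ᵥ u) x + w x * ((B ^ m) *ᵥ w) x) := by
      intro x
      rw [mul_left_comm]
      have := expTail_mul_chainE h hη hl R 0 ht x 1 (fun y => (I.ratio x y).re)
      simp only [id]
      rw [this, one_mul, Finset.mul_sum]
      refine Finset.sum_congr rfl fun m _ => ?_
      rw [mul_left_comm]
      congr 1
      simp only [mulVec, dotProduct, Finset.mul_sum]
      rw [← Finset.sum_add_distrib]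
      refine Finset.sum_congr rfl fun y _ => ?_
      rw [mul_left_comm, sq_norm_mul_ratio_re]
      ring
    rw [Finset.sum_congr rfl fun x _ => h3 x, Finset.sum_comm]
    refine Finset.sum_congr rfl fun m _ => ?_
    rw [← Finset.mul_sum, Finset.sum_add_distrib]
    rfl
  rw [h1, h2]
  exact key

/-- The squared ratio is at most `|Φ(y)|² / |Φ(x)|²`, so sampling `x` from `|Φ(x)|²` leaves the
second moment operator applied to `|Φ|²`. Its total grows by at most `(1 + η)^2` per step, and `η =
1/(2R)` keeps the product over `R` steps below `e`. -/
theorem outE_sq_le (I : Problem κ n) {s lam : ℝ} (hl : 0 ≤ lam) (h : I.H.ScaleOk s) {R : ℕ}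
    (hR : 0 < R) : outE I s (1 / (2 * R)) lam R (fun y => y ^ 2) ≤ 3 := by
  have hR' : (0 : ℝ) < R := Nat.cast_pos.2 hR
  set η : ℝ := 1 / (2 * R)
  have hη : 0 < η := by positivity
  have h1 : ∀ x, ‖I.Φ.amp x‖ ^ 2 *
      (chainE I.H s η lam R 0 (x, 1) fun q => (q.2 * (I.ratio x q.1).re) ^ 2) ≤
        chainSecond I.H s η lam R 0 (fun y => ‖I.Φ.amp y‖ ^ 2) x := by
    intro x
    have h2 := chainE_sq (H := I.H) (s := s) (η := η) lam R 0 x 1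
      (fun y => (I.ratio x y).re ^ 2)
    simp only [mul_pow]
    rw [h2, one_pow, one_mul, ← chainSecond_const_mul]
    refine chainSecond_mono h hη hl R 0 (fun y => ?_) x
    by_cases hx : I.Φ.amp x = 0
    · simp [hx]
    · rw [I.ratio_spec x y hx]
      have h3 : 0 < ‖I.Φ.amp x‖ := norm_pos_iff.2 hx
      have h4 := Complex.abs_re_le_norm (I.Φ.amp y / I.Φ.amp x)
      rw [norm_div] at h4
      have h5 : (I.Φ.amp y / I.Φ.amp x).re ^ 2 ≤ (‖I.Φ.amp y‖ / ‖I.Φ.amp x‖) ^ 2 := by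
        rw [← sq_abs]
        exact pow_le_pow_left₀ (abs_nonneg _) h4 2
      calc ‖I.Φ.amp x‖ ^ 2 * (I.Φ.amp y / I.Φ.amp x).re ^ 2
          ≤ ‖I.Φ.amp x‖ ^ 2 * (‖I.Φ.amp y‖ / ‖I.Φ.amp x‖) ^ 2 := by gcongr
        _ = ‖I.Φ.amp y‖ ^ 2 := by field_simp
  calc outE I s η lam R (fun y => y ^ 2)
      ≤ ∑ x, chainSecond I.H s η lam R 0 (fun y => ‖I.Φ.amp y‖ ^ 2) x :=
        Finset.sum_le_sum fun x _ => h1 x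
    _ ≤ ((1 + η) ^ 2) ^ R * ∑ y, ‖I.Φ.amp y‖ ^ 2 :=
        sum_chainSecond_le h hη hl R 0 fun y => by positivity
    _ = ((1 + η) ^ 2) ^ R := by rw [I.Φ.normalized, mul_one]
    _ ≤ (Real.exp (1 / R)) ^ R := by
        refine pow_le_pow_left₀ (by positivity) ?_ R
        have : 1 + η ≤ Real.exp η := by linarith [Real.add_one_le_exp η]
        calc (1 + η) ^ 2 ≤ Real.exp η ^ 2 := pow_le_pow_left₀ (by positivity) this 2
          _ = Real.exp (1 / R) := by
            rw [← Real.exp_nat_mul]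
            congr 1
            simp only [η]
            push_cast
            field_simp
    _ = Real.exp 1 := by
        rw [← Real.exp_nat_mul]
        congr 1
        field_simp
    _ ≤ 3 := Real.exp_one_lt_three.le

end Signal

open MeasureTheory ProbabilityTheory

/-! ## Concentration of the median of means -/

section MedianOfMeans

theorem median_spec {b : ℕ} (hb : 0 < b) (a : Fin b → ℝ) :
    ∃ i, IsMedianAt a i ∧ median a = a i := by
  classical
  have h : (Finset.univ.filter fun i => IsMedianAt a i).Nonempty := by
    obtain ⟨i, hi⟩ := exists_isMedianAt hb a
    exact ⟨i, by simpa using hi⟩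
  have h1 := Finset.min'_mem _ h
  refine ⟨_, (Finset.mem_filter.1 h1).2, ?_⟩
  rw [median]
  convert dif_pos h

/-- If the median is off by more than `ε`, then so is every entry on its far side, and these are at
least half of all entries. -/
theorem exists_bad_of_median {b : ℕ} (hb : 0 < b) (a : Fin b → ℝ) (e ε : ℝ)
    (h : ¬ |median a - e| ≤ ε) : ∃ S : Finset (Fin b), b ≤ 2 * S.card ∧ ∀ j ∈ S, ε < |a j - e| := by
  obtain ⟨i, ⟨h1, h2⟩, hi⟩ := median_spec hb a
  rw [hi] at h
  push Not at h
  rcases lt_abs.1 h with h3 | h3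
  · refine ⟨_, h2, fun j hj => lt_abs.2 (Or.inl ?_)⟩
    have := (Finset.mem_filter.1 hj).2
    linarith
  · refine ⟨_, h1, fun j hj => lt_abs.2 (Or.inr ?_)⟩
    have := (Finset.mem_filter.1 hj).2
    linarith

variable {μ : PMF ℝ}

theorem memLp_of_finite_support (hμ : μ.support.Finite) {f : ℝ → ℝ} (hf : Measurable f)
    (p : ℝ≥0∞) : MemLp f p μ.toMeasure := by
  obtain ⟨C, hC⟩ := (hμ.image fun x => ‖f x‖).bddAbove
  refine MemLp.of_bound hf.aestronglyMeasurable C ?_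
  have h1 : μ.toMeasure μ.support = 1 :=
    (PMF.toMeasure_apply_eq_one_iff _ hμ.measurableSet).2 subset_rfl
  have h2 : ∀ᵐ x ∂μ.toMeasure, x ∈ μ.support := by
    rw [← prob_compl_eq_zero_iff hμ.measurableSet] at h1
    exact h1
  filter_upwards [h2] with x hx
  exact hC ⟨x, hx, rfl⟩

theorem integral_eq_pexp (hμ : μ.support.Finite) {f : ℝ → ℝ} (hf : Measurable f) :
    ∫ x, f x ∂μ.toMeasure = pexp μ f :=
  PMF.integral_eq_tsum μ f ((memLp_of_finite_support hμ hf 1).integrable le_rfl)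

/-- Chebyshev's inequality for an empirical mean. -/
theorem measure_mean_le (hμ : μ.support.Finite) {V : ℝ} (hV : pexp μ (fun x => x ^ 2) ≤ V)
    {m : ℕ} (hm : 0 < m) {ε : ℝ} (hε : 0 < ε) :
    Measure.pi (fun _ : Fin m => μ.toMeasure) {y | ε < |(∑ i, y i) / m - pexp μ id|} ≤
      ENNReal.ofReal (V / (m * ε ^ 2)) := by
  have hid := memLp_of_finite_support hμ measurable_id 2
  have hvar : Var[id; μ.toMeasure] ≤ V := by
    refine (variance_le_expectation_sq hid.aestronglyMeasurable).trans ?_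
    refine le_trans (le_of_eq ?_) hV
    rw [← integral_eq_pexp hμ (by fun_prop)]
    rfl
  have hm' : (0 : ℝ) < m := Nat.cast_pos.2 hm
  set ν := Measure.pi (fun _ : Fin m => μ.toMeasure)
  have hcoord : ∀ i : Fin m, MemLp (fun y : Fin m → ℝ => y i) 2 ν := fun i =>
    hid.comp_measurePreserving (measurePreserving_eval (fun _ : Fin m => μ.toMeasure) i)
  have hX : MemLp (fun y : Fin m → ℝ => ∑ i, y i) 2 ν := memLp_finsetSum _ fun i _ => hcoord i
  have hmean : ∫ y, (∑ i, y i) ∂ν = m * pexp μ id := by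
    rw [integral_finsetSum _ fun i _ => (hcoord i).integrable one_le_two]
    have : ∀ i : Fin m, ∫ y, y i ∂ν = pexp μ id := by
      intro i
      rw [← integral_eq_pexp hμ measurable_id,
        ← (measurePreserving_eval (fun _ : Fin m => μ.toMeasure) i).map_eq,
        integral_map (measurable_pi_apply i).aemeasurable (by fun_prop)]
      rfl
    rw [Finset.sum_congr rfl fun i _ => this i]
    simp
  have hvars : Var[fun y : Fin m → ℝ => ∑ i, y i; ν] ≤ m * V := by
    have h1 := variance_sum_pi (μ := fun _ : Fin m => μ.toMeasure) (X := fun _ => id)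
      fun _ => hid
    have h2 : (∑ i : Fin m, fun ω : Fin m → ℝ => id (ω i)) = fun y : Fin m → ℝ => ∑ i, y i := by
      funext y; simp
    rw [h2] at h1
    rw [h1, Finset.sum_const, Finset.card_univ, Fintype.card_fin, nsmul_eq_mul]
    gcongr
  have hcheb := meas_ge_le_variance_div_sq hX (c := m * ε) (by positivity)
  rw [hmean] at hcheb
  refine (measure_mono fun y hy => ?_).trans (hcheb.trans (ENNReal.ofReal_le_ofReal ?_))
  · simp only [Set.mem_ofPred_eq] at hy ⊢
    have : (∑ i, y i) - m * pexp μ id = m * ((∑ i, y i) / m - pexp μ id) := by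
      field_simp
    rw [this, abs_mul, abs_of_pos hm']
    exact mul_le_mul_of_nonneg_left hy.le hm'.le
  · calc _ ≤ m * V / (m * ε) ^ 2 := by gcongr
      _ = V / (m * ε ^ 2) := by field_simp

/-- Regarding the runs as a tuple of groups makes the groups independent by construction. The two
product measures agree on rectangles. -/
theorem independentRuns_eq_map (b m : ℕ) (μ : PMF ℝ) : independentRuns b m μ =
    (Measure.pi fun _ : Fin b => Measure.pi fun _ : Fin m => μ.toMeasure).map
      (fun ω p => ω p.1 p.2) := by
  refine Measure.pi_eq fun s hs => ?_
  rw [Measure.map_apply (by fun_prop) (MeasurableSet.univ_pi hs)]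
  have : (fun (ω : Fin b → Fin m → ℝ) (p : Fin b × Fin m) => ω p.1 p.2) ⁻¹' Set.univ.pi s =
      Set.univ.pi fun j => Set.univ.pi fun i => s (j, i) := by
    ext ω
    simp
  rw [this, Measure.pi_pi]
  simp only [Measure.pi_pi]
  rw [Fintype.prod_prod_type]

instance (b m : ℕ) (μ : PMF ℝ) : IsProbabilityMeasure (independentRuns b m μ) := by
  rw [independentRuns]; infer_instance

theorem measure_groups_le {b m : ℕ} {Bad : Set (Fin m → ℝ)} (hBad : MeasurableSet Bad)
    {c : ℝ≥0∞} (hc : Measure.pi (fun _ : Fin m => μ.toMeasure) Bad ≤ c) (S : Finset (Fin b)) :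
    independentRuns b m μ {ω | ∀ j ∈ S, (fun i => ω (j, i)) ∈ Bad} ≤ c ^ S.card := by
  have hmeas : MeasurableSet {ω : Fin b × Fin m → ℝ | ∀ j ∈ S, (fun i => ω (j, i)) ∈ Bad} := by
    have : {ω : Fin b × Fin m → ℝ | ∀ j ∈ S, (fun i => ω (j, i)) ∈ Bad} =
        ⋂ j ∈ S, (fun (ω : Fin b × Fin m → ℝ) i => ω (j, i)) ⁻¹' Bad := by
      ext ω; simp
    rw [this]
    exact S.measurableSet_biInter fun j _ => hBad.preimage (by fun_prop)
  rw [independentRuns_eq_map, Measure.map_apply (by fun_prop) hmeas]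
  have : (fun (ω : Fin b → Fin m → ℝ) (p : Fin b × Fin m) => ω p.1 p.2) ⁻¹'
      {ω | ∀ j ∈ S, (fun i => ω (j, i)) ∈ Bad} = (S : Set (Fin b)).pi fun _ => Bad := by
    ext ω; simp
  rw [this, Measure.pi_pi_finset, Finset.prod_const]
  gcongr

/-- Outside an event of probability at most `2⁻ᵇ`, the median of means is close to the mean. -/
theorem exists_badEvent (hμ : μ.support.Finite) (hV : pexp μ (fun x => x ^ 2) ≤ 3)
    {b m : ℕ} (hb : 0 < b) {ε : ℝ} (hε : 0 < ε) (hm : 48 ≤ m * ε ^ 2) :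
    ∃ E : Set (Fin b × Fin m → ℝ), independentRuns b m μ E ≤ ENNReal.ofReal ((1 / 2) ^ b) ∧
      ∀ ω, ω ∉ E → |medianOfMeans ω - pexp μ id| ≤ ε := by
  have hm0 : 0 < m := by
    rcases Nat.eq_zero_or_pos m with rfl | h
    · norm_num at hm
    · exact h
  set Bad : Set (Fin m → ℝ) := {y | ε < |(∑ i, y i) / m - pexp μ id|}
  have hBad : MeasurableSet Bad := measurableSet_lt measurable_const (by fun_prop)
  -- Chebyshev's inequality with second moment `3` and `m ε² ≥ 48` bounds the failure probability of
  -- one group by `3 / 48`.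
  have h1 : Measure.pi (fun _ : Fin m => μ.toMeasure) Bad ≤ ENNReal.ofReal (1 / 16) := by
    refine (measure_mean_le hμ hV hm0 hε).trans (ENNReal.ofReal_le_ofReal ?_)
    rw [div_le_div_iff₀ (by linarith) (by norm_num)]
    linarith
  classical
  set T : Finset (Finset (Fin b)) := Finset.univ.filter fun S => b ≤ 2 * S.card
  refine ⟨⋃ S ∈ T, {ω | ∀ j ∈ S, (fun i => ω (j, i)) ∈ Bad}, ?_, fun ω hω => ?_⟩
  · refine (measure_biUnion_finset_le _ _).trans ?_
    -- There are at most `2 ^ b` possible sets of bad groups. Each has at least `b / 2` elements,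
    -- hence probability at most `16^{-b/2} = 4^{-b}`.
    calc ∑ S ∈ T, independentRuns b m μ {ω | ∀ j ∈ S, (fun i => ω (j, i)) ∈ Bad}
        ≤ ∑ S ∈ T, ENNReal.ofReal ((1 / 4) ^ b) := by
          refine Finset.sum_le_sum fun S hS => (measure_groups_le hBad h1 S).trans ?_
          rw [← ENNReal.ofReal_pow (by norm_num)]
          refine ENNReal.ofReal_le_ofReal ?_
          have h2 : (1 / 16 : ℝ) ^ S.card = (1 / 4) ^ (2 * S.card) := by
            rw [pow_mul]; norm_num
          rw [h2]
          exact pow_le_pow_of_le_one (by norm_num) (by norm_num) (Finset.mem_filter.1 hS).2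
      _ = T.card * ENNReal.ofReal ((1 / 4) ^ b) := by rw [Finset.sum_const, nsmul_eq_mul]
      _ ≤ (2 ^ b : ℕ) * ENNReal.ofReal ((1 / 4) ^ b) := by
          gcongr
          refine (Finset.card_le_univ _).trans (le_of_eq ?_)
          simp
      _ = ENNReal.ofReal ((1 / 2) ^ b) := by
          rw [← ENNReal.ofReal_natCast, ← ENNReal.ofReal_mul (by positivity)]
          congr 1
          push_cast
          rw [← mul_pow]
          norm_num
  · by_contra h
    obtain ⟨S, hS, hbad⟩ := exists_bad_of_median hb _ _ _ h
    refine hω (Set.mem_iUnion₂.2 ⟨S, ?_, fun j hj => hbad j hj⟩)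
    simpa [T] using hS

theorem le_measure_of_compl_subset {Ω : Type*} [MeasurableSpace Ω] {ν : Measure Ω}
    [IsProbabilityMeasure ν] {A E : Set Ω} {δ : ℝ} (hδ : 0 ≤ δ) (h : Aᶜ ⊆ E)
    (hE : ν E ≤ ENNReal.ofReal δ) : ENNReal.ofReal (1 - δ) ≤ ν A := by
  rw [ENNReal.ofReal_sub _ hδ, ENNReal.ofReal_one, tsub_le_iff_right]
  calc (1 : ℝ≥0∞) = ν Set.univ := measure_univ.symm
    _ ≤ ν (A ∪ E) := measure_mono fun x _ => by
        by_cases hx : x ∈ A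
        · exact Or.inl hx
        · exact Or.inr (h hx)
    _ ≤ ν A + ν E := measure_union_le _ _
    _ ≤ ν A + ENNReal.ofReal δ := by gcongr

/-- The smallest number of groups with failure probability at most `1 / y`. -/
noncomputable def groupCount (y : ℝ) : ℕ := ⌈Real.log y / Real.log 2⌉₊

/-- The group size at accuracy `ε`. -/
noncomputable def groupSize (ε : ℝ) : ℕ := ⌈48 * ε⁻¹ ^ 2⌉₊

theorem groupCount_pos {y : ℝ} (hy : 2 ≤ y) : 0 < groupCount y :=
  Nat.ceil_pos.2 (div_pos (Real.log_pos (by linarith)) (Real.log_pos one_lt_two))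

theorem half_pow_groupCount_le {y : ℝ} (hy : 0 < y) : (1 / 2 : ℝ) ^ groupCount y ≤ y⁻¹ := by
  have h1 : Real.log y ≤ groupCount y * Real.log 2 := by
    rw [← div_le_iff₀ (Real.log_pos one_lt_two)]
    exact Nat.le_ceil _
  rw [one_div, inv_pow]
  gcongr
  rw [← Real.log_le_log_iff hy (by positivity), Real.log_pow]
  exact h1

theorem le_groupSize {ε : ℝ} (hε : 0 < ε) : 48 ≤ groupSize ε * ε ^ 2 := by
  have h1 : 48 * ε⁻¹ ^ 2 ≤ groupSize ε := Nat.le_ceil _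
  calc (48 : ℝ) = 48 * ε⁻¹ ^ 2 * ε ^ 2 := by field_simp
    _ ≤ _ := by gcongr

theorem le_groupCount_mul_groupSize {y ε : ℝ} (hy : 2 ≤ y) :
    ε⁻¹ ^ 2 * Real.log y ≤ ((groupCount y * groupSize ε : ℕ) : ℝ) := by
  have h1 : 48 * ε⁻¹ ^ 2 ≤ groupSize ε := Nat.le_ceil _
  have h2 : Real.log y / Real.log 2 ≤ groupCount y := Nat.le_ceil _
  have h3 : 0 < Real.log y := Real.log_pos (by linarith)
  have h4 : Real.log y ≤ Real.log y / Real.log 2 := by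
    rw [le_div_iff₀ (Real.log_pos one_lt_two)]
    have := Real.log_two_lt_d9
    nlinarith
  push_cast
  have h5 : 0 ≤ ε⁻¹ ^ 2 := by positivity
  calc ε⁻¹ ^ 2 * Real.log y = Real.log y * ε⁻¹ ^ 2 := mul_comm _ _
    _ ≤ _ := mul_le_mul (h4.trans h2) (by linarith) h5 (by positivity)

/-- The ceilings are absorbed: `log y ≥ log 2 > 1/2` gives at most `4 log y` groups, and `ε ≤ 1`
gives group size at most `49 ε⁻²`; `196` is the product of the constants. -/
theorem groupCount_mul_groupSize_le {y ε : ℝ} (hy : 2 ≤ y) (hε : 0 < ε) (hε1 : ε ≤ 1) :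
    ((groupCount y * groupSize ε : ℕ) : ℝ) ≤ 196 * (ε⁻¹ ^ 2 * Real.log y) := by
  have h0 : 1 ≤ ε⁻¹ ^ 2 := one_le_pow₀ ((one_le_inv₀ hε).2 hε1)
  have h1 : (groupSize ε : ℝ) < 48 * ε⁻¹ ^ 2 + 1 := Nat.ceil_lt_add_one (by positivity)
  have h3 : Real.log 2 ≤ Real.log y := Real.log_le_log two_pos hy
  have h6 := Real.log_two_gt_d9
  have h4 : Real.log y / Real.log 2 ≤ 2 * Real.log y := by
    rw [div_le_iff₀ (Real.log_pos one_lt_two)]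
    nlinarith
  have h2 : (groupCount y : ℝ) < Real.log y / Real.log 2 + 1 :=
    Nat.ceil_lt_add_one (div_nonneg (by linarith) (by linarith))
  push_cast
  calc (groupCount y : ℝ) * groupSize ε ≤ (4 * Real.log y) * (49 * ε⁻¹ ^ 2) :=
        mul_le_mul (by linarith) (by linarith) (by positivity) (by linarith)
    _ = _ := by ring

end MedianOfMeans

/-! ## Finite sums, products and determinants as expressions -/

section Expressions

variable {n : ℕ} {ι : Type*}

def Ex.sum (l : List Ex) : Ex := l.foldr Ex.add (Ex.const 0)

def Ex.prod (l : List Ex) : Ex := l.foldr Ex.mul (Ex.const 1)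

theorem Ex.eval_sum (v : State n) (l : List Ex) :
    (Ex.sum l).eval v = (l.map fun e => e.eval v).sum := by
  induction l with
  | nil => simp [Ex.sum, Ex.eval]
  | cons e l ih =>
    change e.eval v + (Ex.sum l).eval v = _
    rw [ih]; simp

theorem Ex.eval_prod (v : State n) (l : List Ex) :
    (Ex.prod l).eval v = (l.map fun e => e.eval v).prod := by
  induction l with
  | nil => simp [Ex.prod, Ex.eval]
  | cons e l ih =>
    change e.eval v * (Ex.prod l).eval v = _
    rw [ih]; simp

variable [Fintype ι] [DecidableEq ι]

/-- The sum of a finite family of expressions. -/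
noncomputable def Ex.bigSum {ι : Type*} [Fintype ι] (e : ι → Ex) : Ex :=
  Ex.sum (Finset.univ.toList.map e)

theorem Ex.eval_bigSum {ι : Type*} [Fintype ι] (v : State n) (e : ι → Ex) :
    (Ex.bigSum e).eval v = ∑ i, (e i).eval v := by
  rw [Ex.bigSum, Ex.eval_sum, List.map_map]
  exact Finset.sum_map_toList _ _

/-- The determinant of a matrix of expressions. -/
noncomputable def Ex.det (M : ι → ι → Ex) : Ex :=
  Ex.bigSum fun σ : Equiv.Perm ι => Ex.mul (Ex.const ((Equiv.Perm.sign σ : ℤ) : ℚ))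
    (Ex.prod (Finset.univ.toList.map fun i => M (σ i) i))

theorem Ex.eval_det (v : State n) (M : ι → ι → Ex) :
    (Ex.det M).eval v = Matrix.det (Matrix.of fun i j => (M i j).eval v) := by
  rw [Ex.det, Ex.eval_bigSum, Matrix.det_apply']
  refine Finset.sum_congr rfl fun σ _ => ?_
  simp only [Ex.eval, Ex.eval_prod, List.map_map]
  congr 1
  exact Finset.prod_map_toList _ _

end Expressions

/-! ## The registers of the program -/

section Registers

variable {n : ℕ}

/-- The position of a local configuration in a list of all of them. -/
noncomputable def code {a : ℕ} (z : BitStr a) : ℕ := Fintype.equivFin (BitStr a) z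

theorem code_injective {a : ℕ} : Function.Injective (code (a := a)) :=
  Fin.val_injective.comp (Fintype.equivFin (BitStr a)).injective

/-- The string register for the global configuration that differs from the current one by `z`. -/
noncomputable def yReg {a : ℕ} (z : BitStr a) : ℕ := 2 + code z

/-- The real register for the matrix entry between two local configurations. -/
noncomputable def hReg {a : ℕ} (z : BitStr a × BitStr a) : ℕ :=
  10 + 3 * Nat.pair (code z.1) (code z.2)

/-- The real register for the guiding vector. -/
noncomputable def gReg {a : ℕ} (z : BitStr a) : ℕ := 11 + 3 * code z

/-- The real register for the unnormalized transition probabilities. -/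
noncomputable def cReg {a : ℕ} (z : BitStr a) : ℕ := 12 + 3 * code z

theorem yReg_injective {a : ℕ} : Function.Injective (yReg (a := a)) := fun z w h =>
  code_injective (by simpa [yReg] using h)

/-- The registers for matrix entries, guiding vector and probabilities start at `10` and occupy the
residue classes `1`, `2` and `0` modulo `3`. They are therefore disjoint from each other and from
the low registers. -/
theorem hReg_injective {a : ℕ} : Function.Injective (hReg (a := a)) := fun z w h => by
  have h1 : Nat.pair (code z.1) (code z.2) = Nat.pair (code w.1) (code w.2) := by
    simpa [hReg] using h
  rw [Nat.pair_eq_pair] at h1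
  exact Prod.ext (code_injective h1.1) (code_injective h1.2)

theorem gReg_injective {a : ℕ} : Function.Injective (gReg (a := a)) := fun z w h =>
  code_injective (by simpa [gReg] using h)

theorem cReg_injective {a : ℕ} : Function.Injective (cReg (a := a)) := fun z w h =>
  code_injective (by simpa [cReg] using h)

/-- The registers that are not used for intermediate results agree. -/
structure SameLow (v w : State n) : Prop where
  nat : ∀ r < 9, w.nat r = v.nat r
  real : ∀ r < 7, w.real r = v.real r
  str : ∀ r < 2, w.str r = v.str r

@[simp] theorem State.nat_setNat (v : State n) (r x i : ℕ) :
    (v.setNat r x).nat i = if i = r then x else v.nat i := by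
  simp [State.setNat, Function.update_apply]

@[simp] theorem State.real_setNat (v : State n) (r x i : ℕ) :
    (v.setNat r x).real i = v.real i := rfl

@[simp] theorem State.str_setNat (v : State n) (r x i : ℕ) :
    (v.setNat r x).str i = v.str i := rfl

@[simp] theorem State.nat_setReal (v : State n) (r i : ℕ) (x : ℝ) :
    (v.setReal r x).nat i = v.nat i := rfl

@[simp] theorem State.real_setReal (v : State n) (r i : ℕ) (x : ℝ) :
    (v.setReal r x).real i = if i = r then x else v.real i := by
  simp [State.setReal, Function.update_apply]

@[simp] theorem State.str_setReal (v : State n) (r i : ℕ) (x : ℝ) :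
    (v.setReal r x).str i = v.str i := rfl

@[simp] theorem State.nat_setStr (v : State n) (r i : ℕ) (x : BitStr n) :
    (v.setStr r x).nat i = v.nat i := rfl

@[simp] theorem State.real_setStr (v : State n) (r i : ℕ) (x : BitStr n) :
    (v.setStr r x).real i = v.real i := rfl

@[simp] theorem State.str_setStr (v : State n) (r i : ℕ) (x : BitStr n) :
    (v.setStr r x).str i = if i = r then x else v.str i := by
  simp [State.setStr, Function.update_apply]

theorem State.setNat_self (v : State n) {r x : ℕ} (h : v.nat r = x) : v.setNat r x = v := by
  subst h
  ext i <;> simp [State.setNat]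

end Registers

/-! ## Loading the matrix of a local term -/

section Load

variable {κ n : ℕ} {I : Problem κ n}

theorem Det.nop {v : State n} (h : v.nat 3 = 0) : Det I (.op (.natConst 3 0)) v 1 v := by
  have := Det.natConst (I := I) 3 0 v
  rwa [v.setNat_self h] at this

/-- A list of assignments to distinct registers whose values do not depend on these registers. -/
theorem Det.assignments {ι : Type*} {g : ι → Prog} {reg : ι → ℕ} {val : ι → ℝ}
    (hreg : Function.Injective reg) (Pre : State n → Prop) (hPre : ∀ v, Pre v → v.nat 3 = 0)
    (hset : ∀ v c x, Pre v → Pre (v.setReal (reg c) x))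
    (hdet : ∀ v c, Pre v → Det I (g c) v (g c).len (v.setReal (reg c) (val c))) (l : List ι) :
    ∀ v, Pre v → ∃ v', Det I (seqs (l.map g)) v (seqs (l.map g)).len v' ∧ Pre v' ∧
      v'.nat = v.nat ∧ v'.str = v.str ∧ (∀ c ∈ l, v'.real (reg c) = val c) ∧
      ∀ m, (∀ c ∈ l, reg c ≠ m) → v'.real m = v.real m := by
  induction l with
  | nil => exact fun v hv => ⟨v, Det.nop (hPre v hv), hv, rfl, rfl, by simp, fun _ _ => rfl⟩
  | cons c l ih =>
    intro v hv
    obtain ⟨v', h1, h2, h3, h4, h5, h6⟩ := ih _ (hset v c (val c) hv)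
    refine ⟨v', (hdet v c hv).seq h1, h2, h3, h4, fun c' hc' => ?_, fun m hm => ?_⟩
    · by_cases hl : c' ∈ l
      · exact h5 c' hl
      · obtain rfl : c' = c := by simpa [hl] using hc'
        rw [h6 _ fun d hd h => hl ((hreg h : d = c') ▸ hd)]
        simp
    · rw [h6 m fun d hd => hm d (List.mem_cons_of_mem _ hd)]
      have := (hm c List.mem_cons_self).symm
      simp [this]

/-- Flip the bit of `str r` at the site number `j` of the current term if `z j` is set. -/
def flipSite {a : ℕ} (r : ℕ) (z : BitStr a) (j : Fin a) : Prog :=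
  if z j then
    .seq (.op (.natConst 9 j)) (.seq (.op (.readSite 10 5 9)) (.seq (.op (.strGet 11 r 10))
      (.seq (.op (.natSub 11 4 11)) (.op (.strSet r 10 11)))))
  else .op (.natConst 3 0)

theorem arity_lookup (H : LocalHamiltonian κ n) (i : Fin H.numTerms) {m : ℕ} (hm : m = i) :
    (if h : m < H.numTerms then H.arity ⟨m, h⟩ else 0) = H.arity i := by
  subst hm; simp

theorem site_lookup (H : LocalHamiltonian κ n) (i : Fin H.numTerms) (j : Fin (H.arity i))
    {m l : ℕ} (hm : m = i) (hl : l = j) :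
    (if h : m < H.numTerms then (if h' : l < H.arity ⟨m, h⟩ then
      (H.site ⟨m, h⟩ ⟨l, h'⟩ : ℕ) else 0) else 0) = H.site i j := by
  subst hm hl; simp

theorem entry_lookup (H : LocalHamiltonian κ n) (i : Fin H.numTerms) {m : ℕ} (hm : m = i)
    (x y : BitStr n) :
    (if h : m < H.numTerms then H.term ⟨m, h⟩ (x ∘ H.site ⟨m, h⟩) (y ∘ H.site ⟨m, h⟩) else 0) =
      H.term i (x ∘ H.site i) (y ∘ H.site i) := by
  subst hm; simp

/-- What a program that only changes the string register `r` and intermediate results does. -/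
structure StrOnly (r : ℕ) (v w : State n) : Prop where
  nat : ∀ i < 9, w.nat i = v.nat i
  real : w.real = v.real
  str : ∀ i, i ≠ r → w.str i = v.str i

/-- A bit is negated as `1 - b` in natural number arithmetic, with the constant `1` kept in register
`4` and `0` in register `3`. -/
theorem det_flipSite (i : Fin I.H.numTerms) (r : ℕ) (z : BitStr (I.H.arity i))
    (j : Fin (I.H.arity i)) (v : State n) (h5 : v.nat 5 = i) (h3 : v.nat 3 = 0)
    (h4 : v.nat 4 = 1) :
    ∃ v', Det I (flipSite r z j) v (flipSite r z j).len v' ∧ StrOnly r v v' ∧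
      v'.str r = if z j then Function.update (v.str r) (I.H.site i j) (!v.str r (I.H.site i j))
        else v.str r := by
  by_cases hz : z j
  · simp only [flipSite, hz, if_true]
    have d1 := Det.natConst (I := I) 9 j v
    have d2 := Det.readSite (I := I) 10 5 9 (v.setNat 9 j)
    rw [site_lookup I.H i j (by simpa using h5) (by simp)] at d2
    set v2 := (v.setNat 9 j).setNat 10 (I.H.site i j)
    have d3 := Det.strGet (I := I) 11 r 10 v2
    have hv2 : v2.nat 10 = I.H.site i j := by simp [v2]
    have hlt : v2.nat 10 < n := hv2 ▸ (I.H.site i j).2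
    have hfin : (⟨v2.nat 10, hlt⟩ : Fin n) = I.H.site i j := Fin.ext hv2
    rw [dif_pos hlt, hfin] at d3
    have d4 := Det.natSub (I := I) 11 4 11 (v2.setNat 11 (v2.str r (I.H.site i j)).toNat)
    set v4 := (v2.setNat 11 (v2.str r (I.H.site i j)).toNat).setNat 11
      ((v2.setNat 11 (v2.str r (I.H.site i j)).toNat).nat 4 -
        (v2.setNat 11 (v2.str r (I.H.site i j)).toNat).nat 11)
    have d5 := Det.strSet (I := I) r 10 11 v4
    have hv4 : v4.nat 10 = I.H.site i j := by simp [v4, v2]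
    have hlt4 : v4.nat 10 < n := hv4 ▸ (I.H.site i j).2
    have hfin4 : (⟨v4.nat 10, hlt4⟩ : Fin n) = I.H.site i j := Fin.ext hv4
    rw [dif_pos hlt4, hfin4] at d5
    have hbit : decide (v4.nat 11 ≠ 0) = !v.str r (I.H.site i j) := by
      have : v4.nat 11 = 1 - (v.str r (I.H.site i j)).toNat := by simp [v4, v2, h4]
      rw [this]
      cases v.str r (I.H.site i j) <;> simp
    rw [hbit] at d5
    refine ⟨_, d1.seq (d2.seq (d3.seq (d4.seq d5))), ⟨fun m hm => ?_, rfl, fun m hm => ?_⟩, ?_⟩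
    · have h9 : m ≠ 9 := by omega
      have h10 : m ≠ 10 := by omega
      have h11 : m ≠ 11 := by omega
      simp [v4, v2, h9, h10, h11]
    · simp [v4, v2, hm]
    · simp [v4, v2]
  · simp only [flipSite, hz, Bool.false_eq_true, if_false]
    exact ⟨v, Det.nop h3, ⟨fun _ _ => rfl, rfl, fun _ _ => rfl⟩, rfl⟩

theorem StrOnly.trans {r : ℕ} {u v w : State n} (h : StrOnly r u v) (h' : StrOnly r v w) :
    StrOnly r u w :=
  ⟨fun i hi => (h'.nat i hi).trans (h.nat i hi), h'.real.trans h.real,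
    fun i hi => (h'.str i hi).trans (h.str i hi)⟩

/-- No site may be visited twice, as a second flip would undo the first; this uses a list without
repetitions and the injectivity of `site`. -/
theorem det_flipSites (i : Fin I.H.numTerms) (r : ℕ) (z : BitStr (I.H.arity i))
    (l : List (Fin (I.H.arity i))) (hl : l.Nodup) : ∀ v : State n, v.nat 5 = i → v.nat 3 = 0 →
    v.nat 4 = 1 → ∃ v', Det I (seqs (l.map (flipSite r z))) v (seqs (l.map (flipSite r z))).len v' ∧
      StrOnly r v v' ∧ v'.str r = fun q => xor (v.str r q)
        (decide (∃ j ∈ l, I.H.site i j = q ∧ z j = true)) := by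
  induction l with
  | nil =>
    intro v h5 h3 h4
    exact ⟨v, Det.nop h3, ⟨fun _ _ => rfl, rfl, fun _ _ => rfl⟩, by simp⟩
  | cons j l ih =>
    intro v h5 h3 h4
    obtain ⟨v1, d1, s1, e1⟩ := det_flipSite i r z j v h5 h3 h4
    obtain ⟨v2, d2, s2, e2⟩ := ih (List.nodup_cons.1 hl).2 v1
      ((s1.nat 5 (by norm_num)).trans h5) ((s1.nat 3 (by norm_num)).trans h3)
      ((s1.nat 4 (by norm_num)).trans h4)
    refine ⟨v2, d1.seq d2, s1.trans s2, ?_⟩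
    rw [e2, e1]
    have hjl := (List.nodup_cons.1 hl).1
    funext q
    by_cases hz : z j = true
    · rw [if_pos hz]
      by_cases hq : q = I.H.site i j
      · subst hq
        have hn : ¬ ∃ j' ∈ l, I.H.site i j' = I.H.site i j ∧ z j' = true := by
          rintro ⟨j', hj', h, -⟩
          exact hjl ((I.H.site i).injective h ▸ hj')
        have hp : ∃ j' ∈ j :: l, I.H.site i j' = I.H.site i j ∧ z j' = true :=
          ⟨j, List.mem_cons_self, rfl, hz⟩
        rw [decide_eq_false hn, decide_eq_true hp]
        simp
      · have hiff : (∃ j' ∈ j :: l, I.H.site i j' = q ∧ z j' = true) ↔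
            ∃ j' ∈ l, I.H.site i j' = q ∧ z j' = true := by
          simp [Ne.symm hq]
        rw [Function.update_of_ne hq]
        simp only [hiff]
    · have hiff : (∃ j' ∈ j :: l, I.H.site i j' = q ∧ z j' = true) ↔
          ∃ j' ∈ l, I.H.site i j' = q ∧ z j' = true := by
        simp [hz]
      rw [if_neg hz]
      simp only [hiff]

/-- Compute the configuration that differs from the current one by `z` on the current sites. -/
noncomputable def makeY {a : ℕ} (z : BitStr a) : Prog :=
  .seq (.op (.strCopy (yReg z) 0)) (seqs ((List.finRange a).map (flipSite (yReg z) z)))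

theorem det_makeY (i : Fin I.H.numTerms) (z : BitStr (I.H.arity i)) (v : State n)
    (h5 : v.nat 5 = i) (h3 : v.nat 3 = 0) (h4 : v.nat 4 = 1) :
    ∃ v', Det I (makeY z) v (makeY z).len v' ∧ StrOnly (yReg z) v v' ∧
      v'.str (yReg z) = flipBits (I.H.site i) z (v.str 0) := by
  obtain ⟨v', d, s, e⟩ := det_flipSites i (yReg z) z _ (List.nodup_finRange _)
    (v.setStr (yReg z) (v.str 0)) h5 h3 h4
  refine ⟨v', (Det.strCopy _ _ _).seq d, ⟨s.nat, s.real, fun m hm => ?_⟩, ?_⟩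
  · rw [s.str m hm]; simp [hm]
  · rw [e]
    funext q
    simp [flipBits]

noncomputable def makeYs (a : ℕ) : Prog := seqs ((Finset.univ : Finset (BitStr a)).toList.map makeY)

theorem det_makeYs_list (i : Fin I.H.numTerms) (l : List (BitStr (I.H.arity i))) :
    ∀ v : State n, v.nat 5 = i → v.nat 3 = 0 → v.nat 4 = 1 →
    ∃ v', Det I (seqs (l.map makeY)) v (seqs (l.map makeY)).len v' ∧
      (∀ r < 9, v'.nat r = v.nat r) ∧ v'.real = v.real ∧
      (∀ z ∈ l, v'.str (yReg z) = flipBits (I.H.site i) z (v.str 0)) ∧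
      ∀ r, (∀ z ∈ l, yReg z ≠ r) → v'.str r = v.str r := by
  induction l with
  | nil => exact fun v _ h3 _ => ⟨v, Det.nop h3, fun _ _ => rfl, rfl, by simp, fun _ _ => rfl⟩
  | cons z l ih =>
    intro v h5 h3 h4
    obtain ⟨v1, d1, s1, e1⟩ := det_makeY i z v h5 h3 h4
    obtain ⟨v2, d2, g1, g2, g3, g4⟩ := ih v1
      ((s1.nat 5 (by norm_num)).trans h5) ((s1.nat 3 (by norm_num)).trans h3)
      ((s1.nat 4 (by norm_num)).trans h4)
    have hx : v1.str 0 = v.str 0 := s1.str 0 (by simp [yReg]; omega)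
    refine ⟨v2, d1.seq d2, fun r hr => (g1 r hr).trans (s1.nat r hr), g2.trans s1.real,
      fun z' hz' => ?_, fun r hr => ?_⟩
    · by_cases hl : z' ∈ l
      · rw [g3 z' hl, hx]
      · obtain rfl : z' = z := by simpa [hl] using hz'
        rw [g4 _ fun w hw h => hl ((yReg_injective h : w = z') ▸ hw), e1]
    · rw [g4 r fun w hw => hr w (List.mem_cons_of_mem _ hw),
        s1.str r (hr z List.mem_cons_self).symm]

/-- Read the matrix of the current term into registers. -/
noncomputable def readAll (a : ℕ) : Prog :=
  seqs ((Finset.univ : Finset (BitStr a × BitStr a)).toList.map fun c =>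
    .op (.readEntry (2 * hReg c) 5 (yReg c.1) (yReg c.2)))

noncomputable def load (a : ℕ) : Prog := .seq (makeYs a) (readAll a)

/-- The neighbours of the current configuration `x` and the local matrix relative to `x` have been
loaded. -/
structure Loaded (I : Problem κ n) (i : Fin I.H.numTerms) (x : BitStr n) (v : State n) :
    Prop where
  str : ∀ z, v.str (yReg z) = flipBits (I.H.site i) z x
  mat : ∀ z w, v.real (hReg (z, w)) =
    I.H.term i (xorStr (x ∘ I.H.site i) z) (xorStr (x ∘ I.H.site i) w)

/-- Matrix entries are read through pairs of global strings, so all `2 ^ a` neighbours are built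
first. The matrix is thus stored in coordinates relative to the current configuration, with `0`
standing for `x` itself. -/
theorem det_load (i : Fin I.H.numTerms) (v : State n) (h5 : v.nat 5 = i) (h3 : v.nat 3 = 0)
    (h4 : v.nat 4 = 1) :
    ∃ v', Det I (load (I.H.arity i)) v (load (I.H.arity i)).len v' ∧ SameLow v v' ∧
      Loaded I i (v.str 0) v' := by
  obtain ⟨v1, d1, g1, g2, g3, g4⟩ := det_makeYs_list i Finset.univ.toList v h5 h3 h4
  obtain ⟨v2, d2, f1, f2, f3, f4, f5⟩ := Det.assignments (I := I)
    (g := fun c : BitStr (I.H.arity i) × BitStr (I.H.arity i) =>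
      .op (.readEntry (2 * hReg c) 5 (yReg c.1) (yReg c.2)))
    (reg := hReg) (val := fun c => I.H.term i (xorStr (v.str 0 ∘ I.H.site i) c.1)
      (xorStr (v.str 0 ∘ I.H.site i) c.2))
    hReg_injective
    (fun w => w.nat 3 = 0 ∧ w.nat 5 = i ∧ ∀ z : BitStr (I.H.arity i),
      w.str (yReg z) = flipBits (I.H.site i) z (v.str 0))
    (fun w hw => hw.1) (fun w c x hw => hw)
    (fun w c hw => by
      have := Det.readEntry (I := I) (hReg c) 5 (yReg c.1) (yReg c.2) w
      rw [entry_lookup I.H i hw.2.1, hw.2.2, hw.2.2, flipBits_comp, flipBits_comp] at this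
      exact this)
    Finset.univ.toList v1
    ⟨(g1 3 (by norm_num)).trans h3, (g1 5 (by norm_num)).trans h5, fun z => g3 z (by simp)⟩
  refine ⟨v2, d1.seq d2, ⟨fun r hr => ?_, fun r hr => ?_, fun r hr => ?_⟩, fun z => f1.2.2 z,
    fun z w => f4 (z, w) (by simp)⟩
  · rw [f2, g1 r hr]
  · rw [f5 r fun c _ => by simp only [hReg]; omega, g2]
  · rw [f3, g4 r fun z _ => by simp only [yReg]; omega]

/-! ## Selecting the program for the arity of the current term -/

/-- Run `f a`, where `a ≤ b` is the number in `nat 12`. -/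
def dispatchAux (f : ℕ → Prog) : ℕ → Prog
  | 0 => f 0
  | b + 1 => .seq (.op (.natConst 13 b)) (.ite (.natLt 13 12) (f (b + 1)) (dispatchAux f b))

/-- Run `f a`, where `a` is the arity of the current term. -/
def dispatch (κ : ℕ) (f : ℕ → Prog) : Prog :=
  .seq (.op (.readArity 12 5)) (dispatchAux f κ)

/-- Only the natural number registers for intermediate results differ. -/
def NatJunk (v w : State n) : Prop := (∀ r < 9, w.nat r = v.nat r) ∧ w.real = v.real ∧ w.str = v.str

theorem NatJunk.sameLow {v w : State n} (h : NatJunk v w) : SameLow v w :=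
  ⟨h.1, fun r _ => by rw [h.2.1], fun r _ => by rw [h.2.2]⟩

/-- The text of a program cannot depend on the arity of a term. As arities are at most `κ`, a
cascade of comparisons selects among finitely many fixed programs. -/
theorem yields_dispatchAux {α : Type*} {Q : α → State n → Prop} {L : (α → ℝ) → ℝ} (f : ℕ → Prog)
    (a : ℕ) (b : ℕ) (hab : a ≤ b) : ∀ v : State n, v.nat 12 = a →
      (∀ w, NatJunk v w → Yields I (f a) w (f a).len Q L) →
      Yields I (dispatchAux f b) v (dispatchAux f b).len Q L := by
  induction b with
  | zero =>
    intro v _ h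
    obtain rfl : a = 0 := by omega
    exact h v ⟨fun _ _ => rfl, rfl, rfl⟩
  | succ b ih =>
    intro v hv h
    have hj : NatJunk v (v.setNat 13 b) :=
      ⟨fun r hr => by simp; omega, rfl, rfl⟩
    refine (Det.natConst 13 b v).seq_yields ?_
    refine Yields.ite (Decides.natLt 13 12 _) (fun ht => ?_) (fun ht => ?_)
    · have : b < a := by simpa [hv] using ht
      obtain rfl : a = b + 1 := by omega
      exact (h _ hj).mono (le_max_left _ _)
    · have : a ≤ b := by simpa [hv] using ht
      refine (ih this _ (by simpa using hv) fun w hw => h w ?_).mono (le_max_right _ _)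
      exact ⟨fun r hr => (hw.1 r hr).trans (hj.1 r hr), hw.2.1.trans hj.2.1, hw.2.2.trans hj.2.2⟩

theorem yields_dispatch {α : Type*} {Q : α → State n → Prop} {L : (α → ℝ) → ℝ} (f : ℕ → Prog)
    (i : Fin I.H.numTerms) (v : State n) (h5 : v.nat 5 = i)
    (h : ∀ w, NatJunk v w → Yields I (f (I.H.arity i)) w (f (I.H.arity i)).len Q L) :
    Yields I (dispatch κ f) v (dispatch κ f).len Q L := by
  have d := Det.readArity (I := I) 12 5 v
  rw [arity_lookup I.H i h5] at d
  refine d.seq_yields (yields_dispatchAux f _ κ (I.H.arity_le i) _ (by simp) fun w hw => h w ?_)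
  exact ⟨fun r hr => (hw.1 r hr).trans (by simp; omega), hw.2.1, hw.2.2⟩

end Load

/-! ## One step of the walk -/

section LocalStep

variable {κ n : ℕ} {I : Problem κ n}

def zeroStr (a : ℕ) : BitStr a := fun _ => false

/-- Cramer's rule with the Leibniz expansion unrolled: for fixed arity this is straight-line
arithmetic of constant length. Real registers `1` and `3` hold the scale and `η`. -/
noncomputable def guideEx {a : ℕ} (z : BitStr a) : Ex :=
  Ex.det fun x y : BitStr a => if y = z then .const 1
    else if x = y then .add (.div (.reg (hReg (x, y))) (.reg 1)) (.reg 3)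
    else .div (.reg (hReg (x, y))) (.reg 1)

noncomputable def probEx {a : ℕ} (z : BitStr a) : Ex :=
  .mul (.sub (.const (if zeroStr a = z then 1 else 0)) (.div (.reg (hReg (zeroStr a, z))) (.reg 1)))
    (.reg (gReg z))

noncomputable def guides (a : ℕ) : Prog :=
  seqs ((Finset.univ : Finset (BitStr a)).toList.map fun z => assign (gReg z) (guideEx z))

noncomputable def probs (a : ℕ) : Prog :=
  seqs ((Finset.univ : Finset (BitStr a)).toList.map fun z => assign (cReg z) (probEx z))

/-- Sample one of the configurations in the list and move there. -/
noncomputable def select {a : ℕ} : List (BitStr a) → Prog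
  | [] => .op (.natConst 3 0)
  | z :: l => .seq (assign 7 (.div (.reg (cReg z)) (.reg 9))) (.seq (.op (.flip 13 (2 * 7)))
      (.ite (.natLt 3 13)
        (.seq (assign 6 (.mul (.reg 6) (.div (.reg 8) (.reg (gReg z)))))
          (.op (.strCopy 0 (yReg z))))
        (.seq (assign 9 (.sub (.reg 9) (.reg (cReg z)))) (select l))))

noncomputable def localStep (a : ℕ) : Prog :=
  .seq (load a) (.seq (guides a) (.seq (probs a)
    (.seq (assign 8 (Ex.bigSum fun z : BitStr a => .reg (cReg z)))
      (.seq (assign 9 (.reg 8)) (select (Finset.univ : Finset (BitStr a)).toList)))))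

/-- The loaded matrix is the local term reindexed by a translation. Cramer's rule is equivariant
under reindexing and its constant right-hand side is invariant, so the result is the guiding vector
in translated coordinates. -/
theorem eval_guideEx (i : Fin I.H.numTerms) {x : BitStr n} {v : State n} {s η : ℝ}
    (hv : Loaded I i x v) (h1 : v.real 1 = s) (h3 : v.real 3 = η) (z : BitStr (I.H.arity i)) :
    (guideEx z).eval v = guide I.H s η i (xorStr (x ∘ I.H.site i) z) := by
  set u := x ∘ I.H.site i
  have key := congrFun (Matrix.cramer_submatrix_equiv
    (I.H.scaled s i + η • (1 : Matrix (BitStr (I.H.arity i)) (BitStr (I.H.arity i)) ℝ))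
    (xorEquiv u) fun _ => 1) z
  rw [guide, supersolution]
  refine Eq.trans ?_ key
  rw [guideEx, Ex.eval_det, Matrix.cramer_apply]
  congr 1
  ext p q
  rw [Matrix.of_apply, Matrix.updateCol_apply]
  by_cases hq : q = z
  · simp [hq, Ex.eval]
  · rw [if_neg hq, if_neg hq, Matrix.submatrix_apply, Matrix.add_apply, Matrix.smul_apply,
      LocalHamiltonian.scaled, Matrix.smul_apply, smul_eq_mul, smul_eq_mul]
    by_cases hpq : p = q
    · subst hpq
      simp only [if_true, Ex.eval, hv.mat, h1, h3, Matrix.one_apply_eq, mul_one, xorEquiv_apply, u]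
      rw [div_eq_inv_mul]
    · rw [if_neg hpq, Matrix.one_apply_ne fun h => hpq ((xorEquiv u).injective h)]
      simp only [Ex.eval, hv.mat, h1, mul_zero, add_zero, xorEquiv_apply, u]
      rw [div_eq_inv_mul]

theorem xorStr_zeroStr {a : ℕ} (u : BitStr a) : xorStr u (zeroStr a) = u := by
  funext j; simp [xorStr, zeroStr]

theorem eval_probEx (i : Fin I.H.numTerms) {x : BitStr n} {v : State n} {s : ℝ} {g : ℝ}
    (z : BitStr (I.H.arity i)) (hv : Loaded I i x v) (h1 : v.real 1 = s)
    (hg : v.real (gReg z) = g) :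
    (probEx z).eval v = (1 - I.H.scaled s i) (x ∘ I.H.site i) (xorStr (x ∘ I.H.site i) z) * g := by
  simp only [probEx, Ex.eval, hv.mat, h1, hg, xorStr_zeroStr, Matrix.sub_apply,
    LocalHamiltonian.scaled, Matrix.smul_apply, smul_eq_mul, div_eq_inv_mul]
  congr 2
  by_cases hz : zeroStr _ = z
  · subst hz
    rw [xorStr_zeroStr, Matrix.one_apply_eq]; simp
  · rw [if_neg hz, Matrix.one_apply_ne, Rat.cast_zero]
    intro h
    have h' : xorEquiv (x ∘ I.H.site i) (zeroStr _) = xorEquiv (x ∘ I.H.site i) z := by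
      rw [xorEquiv_apply, xorEquiv_apply, xorStr_zeroStr, ← h]
    exact hz ((xorEquiv _).injective h')

/-- The walk has moved to `x` with weight `W`. -/
structure Moved (v : State n) (x : BitStr n) (W : ℝ) (w : State n) : Prop where
  nat : ∀ r < 9, w.nat r = v.nat r
  real : ∀ r < 6, w.real r = v.real r
  weight : w.real 6 = W
  pos : w.str 0 = x
  start : w.str 1 = v.str 1

/-- A finite law is sampled by a sequence of coins: `z` is accepted with its share of the mass not
yet rejected. Register `9` holds that mass, while register `8` keeps the total needed for the
weight. -/
theorem yields_select {a : ℕ} {c g : BitStr a → ℝ} {y : BitStr a → BitStr n} {tot : ℝ}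
    (hc : ∀ z, 0 ≤ c z) (l : List (BitStr a)) : ∀ v : State n, v.nat 3 = 0 →
    (∀ z, v.real (cReg z) = c z) → (∀ z, v.real (gReg z) = g z) →
    (∀ z, v.str (yReg z) = y z) → v.real 8 = tot → v.real 9 = (l.map c).sum →
    0 < v.real 9 →
    Yields I (select l) v (select l).len
      (fun z v' => Moved v (y z) (v.real 6 * (tot / g z)) v')
      (fun f => (l.map fun z => c z / v.real 9 * f z).sum) := by
  induction l with
  | nil =>
    intro v _ _ _ _ _ h9 hpos
    simp [h9] at hpos
  | cons z l ih =>
    intro v hv3 hvc hvg hvy hv8 hv9 hpos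
    have hrest : 0 ≤ (l.map c).sum := List.sum_nonneg (by simpa using fun w _ => hc w)
    have hsum : v.real 9 = c z + (l.map c).sum := by simpa using hv9
    set p := c z / v.real 9 with hp
    have hp0 : 0 ≤ p := div_nonneg (hc z) hpos.le
    have hp1 : p ≤ 1 := div_le_one_of_le₀ (by linarith) hpos.le
    have d1 := Det.assign (I := I) 7 (.div (.reg (cReg z)) (.reg 9)) v
    have hval : (Ex.div (.reg (cReg z)) (.reg 9)).eval v = p := by
      simp only [Ex.eval, hvc, hp]
    rw [hval] at d1
    set v1 := v.setReal 7 p with hv1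
    have hv1p : v1.real 7 = p := by simp [hv1]
    have y2 := Yields.flip (I := I) (r := 13) (p := 7) (v := v1) (hv1p.symm ▸ hp0)
      (hv1p.symm ▸ hp1)
    rw [hv1p] at y2
    have hcR : ∀ w : BitStr a, cReg w ≠ 7 ∧ cReg w ≠ 9 := fun w => by
      simp only [cReg]; omega
    have hgR : ∀ w : BitStr a, gReg w ≠ 7 ∧ gReg w ≠ 9 := fun w => by
      simp only [gReg]; omega
    refine (d1.seq_yields (y2.seq (Q₂ := fun z v' =>
      Moved v (y z) (v.real 6 * (tot / g z)) v') (L₂ := fun b f => if b then f z else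
        (l.map fun w => c w / (v.real 9 - c z) * f w).sum) (D₂ := (max _ _) + 1) ?_)).congr ?_
    · rintro b v2 ⟨rfl, hb1, hb0⟩
      refine Yields.ite (Decides.natLt 3 13 _) (fun ht => ?_) (fun ht => ?_)
      · have hb : b = true := by
          cases b
          · simp at ht
          · rfl
        subst hb
        simp only [if_true]
        have d3 := Det.assign (I := I) 6 (.mul (.reg 6) (.div (.reg 8) (.reg (gReg z))))
          (v1.setNat 13 1)
        have d4 := Det.strCopy (I := I) 0 (yReg z) ((v1.setNat 13 1).setReal 6
          ((Ex.mul (.reg 6) (.div (.reg 8) (.reg (gReg z)))).eval (v1.setNat 13 1)))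
        refine ((d3.seq d4).yields ⟨fun r hr => ?_, fun r hr => ?_, ?_, ?_, ?_⟩).mono
          (le_max_left _ _)
        · have : r ≠ 13 := by omega
          simp [hv1, this]
        · have h6 : r ≠ 6 := by omega
          have h7 : r ≠ 7 := by omega
          simp [hv1, h6, h7]
        · simp [hv1, Ex.eval, hv8, hvg, (hgR z).1]
        · simp [hv1, hvy]
        · simp [hv1]
      · have hb : b = false := by
          cases b
          · rfl
          · simp [hv1, hv3] at ht
        subst hb
        have hlt : p < 1 := hb0 rfl
        have hlt' : c z < v.real 9 := by
          rwa [hp, div_lt_one hpos] at hlt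
        simp only [Bool.false_eq_true, if_false]
        have d3 := Det.assign (I := I) 9 (.sub (.reg 9) (.reg (cReg z))) (v1.setNat 13 0)
        have hval3 : (Ex.sub (.reg 9) (.reg (cReg z))).eval (v1.setNat 13 0) =
            v.real 9 - c z := by
          simp [Ex.eval, hv1, hvc, (hcR z).1]
        rw [hval3] at d3
        set v3 := (v1.setNat 13 0).setReal 9 (v.real 9 - c z) with hv3'
        have hv39 : v3.real 9 = v.real 9 - c z := by simp [hv3']
        have y4 := ih v3 (by simpa [hv3', hv1] using hv3)
          (fun w => by simp [hv3', hv1, (hcR w).1, (hcR w).2, hvc])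
          (fun w => by simp [hv3', hv1, (hgR w).1, (hgR w).2, hvg])
          (fun w => by simp [hv3', hv1, hvy]) (by simpa [hv3', hv1] using hv8)
          (by rw [hv39]; linarith) (by rw [hv39]; linarith)
        rw [hv39] at y4
        refine ((d3.seq_yields y4).imp fun w v' hw => ?_).mono (le_max_right _ _)
        refine ⟨fun r hr => ?_, fun r hr => ?_, ?_, hw.pos, ?_⟩
        · have : r ≠ 13 := by omega
          rw [hw.nat r hr]; simp [hv3', hv1, this]
        · have h9 : r ≠ 9 := by omega
          have h7 : r ≠ 7 := by omega
          rw [hw.real r hr]; simp [hv3', hv1, h9, h7]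
        · rw [hw.weight]; simp [hv3', hv1]
        · rw [hw.start]; simp [hv3', hv1]
    · intro f
      simp only [if_true, Bool.false_eq_true, if_false, List.map_cons, List.sum_cons]
      congr 1
      -- If `z` carries all the remaining mass, the rest of the list has mass zero and the division
      -- by the mass after rejection is meaningless; the terms concerned vanish.
      rcases hp1.eq_or_lt with h | h
      · have hz : (l.map c).sum = 0 := by
          rw [hp, div_eq_one_iff_eq hpos.ne'] at h
          linarith
        have hall : ∀ w ∈ l, c w = 0 := by
          intro w hw
          have h1 := List.single_le_sum (l := l.map c) (by simpa using fun w _ => hc w) (c w)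
            (List.mem_map_of_mem hw)
          linarith [hc w]
        rw [h, sub_self, zero_mul]
        symm
        apply List.sum_eq_zero
        intro x hx
        obtain ⟨w, hw, rfl⟩ := List.mem_map.1 hx
        rw [hall w hw]; simp
      · rw [← List.sum_map_mul_left]
        congr 1
        refine List.map_congr_left fun w _ => ?_
        have hne : v.real 9 - c z ≠ 0 := by
          rw [hp, div_lt_one hpos] at h
          linarith
        have := hpos.ne'
        rw [hp]
        field_simp

theorem yields_localStep (i : Fin I.H.numTerms) {s η : ℝ} (hs : I.H.ScaleOk s) (hη : 0 < η)
    (v : State n) (h5 : v.nat 5 = i) (h3 : v.nat 3 = 0) (h4 : v.nat 4 = 1) (hvs : v.real 1 = s)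
    (hvη : v.real 3 = η) :
    Yields I (localStep (I.H.arity i)) v (localStep (I.H.arity i)).len
      (fun q v' => Moved v q.1 q.2 v')
      (fun f => ∑ z, transProb I.H s η i (v.str 0 ∘ I.H.site i) z *
        f (flipBits (I.H.site i) z (v.str 0),
          v.real 6 * transWeight I.H s η i (v.str 0 ∘ I.H.site i) z)) := by
  set x := v.str 0
  set u := x ∘ I.H.site i
  obtain ⟨v1, d1, s1, l1⟩ := det_load i v h5 h3 h4
  obtain ⟨v2, d2, p2, n2, t2, e2, f2⟩ := Det.assignments (I := I)
    (g := fun z : BitStr (I.H.arity i) => assign (gReg z) (guideEx z))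
    (reg := gReg) (val := fun z => guide I.H s η i (xorStr u z)) gReg_injective
    (fun w => w.nat 3 = 0 ∧ Loaded I i x w ∧ w.real 1 = s ∧ w.real 3 = η)
    (fun w hw => hw.1)
    (fun w c y hw => ⟨hw.1, ⟨hw.2.1.str, fun z z' => by
      have : hReg (z, z') ≠ gReg c := by simp only [hReg, gReg]; omega
      simp [this, hw.2.1.mat]⟩, by
        have : 1 ≠ gReg c := by simp only [gReg]; omega
        simp [this, hw.2.2.1], by
        have : 3 ≠ gReg c := by simp only [gReg]; omega
        simp [this, hw.2.2.2]⟩)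
    (fun w c hw => by
      have := Det.assign (I := I) (gReg c) (guideEx c) w
      rwa [eval_guideEx i hw.2.1 hw.2.2.1 hw.2.2.2] at this)
    Finset.univ.toList v1
    ⟨(s1.nat 3 (by norm_num)).trans h3, l1, (s1.real 1 (by norm_num)).trans hvs,
      (s1.real 3 (by norm_num)).trans hvη⟩
  obtain ⟨v3, d3, p3, n3, t3, e3, f3⟩ := Det.assignments (I := I)
    (g := fun z : BitStr (I.H.arity i) => assign (cReg z) (probEx z))
    (reg := cReg) (val := fun z => (1 - I.H.scaled s i) u (xorStr u z) *
      guide I.H s η i (xorStr u z)) cReg_injective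
    (fun w => w.nat 3 = 0 ∧ Loaded I i x w ∧ w.real 1 = s ∧
      ∀ z : BitStr (I.H.arity i), w.real (gReg z) = guide I.H s η i (xorStr u z))
    (fun w hw => hw.1)
    (fun w c y hw => ⟨hw.1, ⟨hw.2.1.str, fun z z' => by
      have : hReg (z, z') ≠ cReg c := by simp only [hReg, cReg]; omega
      simp [this, hw.2.1.mat]⟩, by
        have : 1 ≠ cReg c := by simp only [cReg]; omega
        simp [this, hw.2.2.1], fun z => by
        have : gReg z ≠ cReg c := by simp only [gReg, cReg]; omega
        simp [this, hw.2.2.2]⟩)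
    (fun w c hw => by
      have := Det.assign (I := I) (cReg c) (probEx c) w
      rwa [eval_probEx i c hw.2.1 hw.2.2.1 (hw.2.2.2 c)] at this)
    Finset.univ.toList v2
    ⟨p2.1, p2.2.1, p2.2.2.1, fun z => e2 z (by simp)⟩
  have d4 := Det.assign (I := I) 8 (Ex.bigSum fun z : BitStr (I.H.arity i) => .reg (cReg z)) v3
  have htot : (Ex.bigSum fun z : BitStr (I.H.arity i) => .reg (cReg z)).eval v3 =
      guideNext I.H s η i u := by
    rw [Ex.eval_bigSum, guideNext_eq_sum]
    exact Finset.sum_congr rfl fun z _ => e3 z (by simp)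
  rw [htot] at d4
  set v4 := v3.setReal 8 (guideNext I.H s η i u) with hv4
  have d5 := Det.assign (I := I) 9 (.reg 8) v4
  have hv48 : (Ex.reg 8).eval v4 = guideNext I.H s η i u := by simp [Ex.eval, hv4]
  rw [hv48] at d5
  set v5 := v4.setReal 9 (guideNext I.H s η i u) with hv5
  have hlow13 : ∀ r < 7, v3.real r = v.real r := fun r hr => by
    rw [f3 r fun c _ => by simp only [cReg]; omega, f2 r fun c _ => by simp only [gReg]; omega,
      s1.real r hr]
  have hnat13 : ∀ r < 9, v3.nat r = v.nat r := fun r hr => by rw [n3, n2, s1.nat r hr]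
  have hstr13 : ∀ r < 2, v3.str r = v.str r := fun r hr => by rw [t3, t2, s1.str r hr]
  have hpos := guideNext_pos hs hη i u
  have y6 := yields_select (I := I)
    (c := fun z => (1 - I.H.scaled s i) u (xorStr u z) * guide I.H s η i (xorStr u z))
    (g := fun z => guide I.H s η i (xorStr u z))
    (y := fun z => flipBits (I.H.site i) z x) (tot := guideNext I.H s η i u)
    (fun z => mul_nonneg (one_sub_apply_nonneg (hs.diag_lt_one i) (hs.off_nonpos i) _ _)
      (guide_pos hs hη i _).le) Finset.univ.toList v5 p3.1
    (fun z => by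
      have h8 : cReg z ≠ 8 := by simp only [cReg]; omega
      have h9 : cReg z ≠ 9 := by simp only [cReg]; omega
      simp [hv5, hv4, h8, h9, e3])
    (fun z => by
      have h8 : gReg z ≠ 8 := by simp only [gReg]; omega
      have h9 : gReg z ≠ 9 := by simp only [gReg]; omega
      simp [hv5, hv4, h8, h9, p3.2.2.2])
    (fun z => p3.2.1.str z) (by simp [hv5, hv4])
    (by
      have h9 : v5.real 9 = guideNext I.H s η i u := by simp [hv5]
      rw [h9, Finset.sum_map_toList, guideNext_eq_sum])
    (by simpa [hv5] using hpos)
  have h9 : v5.real 9 = guideNext I.H s η i u := by simp [hv5]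
  have h6 : v5.real 6 = v.real 6 := by
    rw [← hlow13 6 (by norm_num)]; simp [hv5, hv4]
  rw [h9, h6] at y6
  have y7 := y6.map (fun z => (flipBits (I.H.site i) z x,
    v.real 6 * transWeight I.H s η i u z)) (Q' := fun q v' => Moved v q.1 q.2 v')
    (fun z v' hv' => ⟨fun r hr => (hv'.nat r hr).trans (hnat13 r hr), fun r hr => by
      have h8 : r ≠ 8 := by omega
      have h9 : r ≠ 9 := by omega
      rw [hv'.real r hr, ← hlow13 r (by omega)]
      simp [hv5, hv4, h8, h9], hv'.weight, hv'.pos, by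
      rw [hv'.start, ← hstr13 1 (by norm_num)]; rfl⟩)
  refine (d1.seq_yields (d2.seq_yields (d3.seq_yields (d4.seq_yields
    (d5.seq_yields y7))))).congr fun f => ?_
  exact Finset.sum_map_toList _ _

end LocalStep

/-! ### Choosing a term of the Hamiltonian uniformly -/

section Choose

variable {κ n : ℕ} {I : Problem κ n}

/-- With probability `1 / nat 14` stop, and otherwise go on to the next term. -/
def chooseBody : Prog :=
  .seq (assign 7 (.div (.sub (.nat 14) (.const 1)) (.nat 14))) (.seq (.op (.flip 13 (2 * 7)))
    (.ite (.natLt 3 13) (.seq (.op (.natAdd 5 5 4)) (.op (.natSub 14 14 4)))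
      (.op (.natConst 3 0))))

/-- Choose the index of a term uniformly. -/
def choose : Prog :=
  .seq (.op (.natConst 5 0)) (.seq (.op (.natAdd 14 1 3)) (.seq (.op (.natConst 13 1))
    (.loop (.natLt 3 13) chooseBody)))

/-- The index `i` has been chosen. -/
structure Chosen (v : State n) (i : ℕ) (w : State n) : Prop where
  nat : ∀ r < 9, r ≠ 5 → w.nat r = v.nat r
  idx : w.nat 5 = i
  real : ∀ r < 7, w.real r = v.real r
  str : w.str = v.str

theorem Chosen.trans {u v w : State n} {i j : ℕ} (h : Chosen u i v) (h' : Chosen v j w) :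
    Chosen u j w :=
  ⟨fun r hr h5 => (h'.nat r hr h5).trans (h.nat r hr h5), h'.idx,
    fun r hr => (h'.real r hr).trans (h.real r hr), h'.str.trans h.str⟩

theorem yields_chooseBody (r i : ℕ) (v : State n) (h3 : v.nat 3 = 0) (h4 : v.nat 4 = 1)
    (h14 : v.nat 14 = r + 1) (h5 : v.nat 5 = i) :
    Yields I chooseBody v chooseBody.len
      (fun b w => Chosen v (if b then i + 1 else i) w ∧ w.nat 13 = b.toNat ∧
        (b = true → 0 < r ∧ w.nat 14 = r))
      (fun f => (r / (r + 1) : ℝ) * f true + (1 - r / (r + 1)) * f false) := by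
  have hr : (0 : ℝ) < r + 1 := by positivity
  have d1 := Det.assign (I := I) 7 (.div (.sub (.nat 14) (.const 1)) (.nat 14)) v
  have hval : (Ex.div (.sub (.nat 14) (.const 1)) (.nat 14)).eval v = r / (r + 1) := by
    simp [Ex.eval, h14]
  rw [hval] at d1
  set p : ℝ := r / (r + 1) with hp
  set v1 := v.setReal 7 p with hv1
  have hv1p : v1.real 7 = p := by simp [hv1]
  have hp0 : 0 ≤ p := by positivity
  have hp1 : p ≤ 1 := by rw [hp, div_le_one hr]; linarith
  have y2 := Yields.flip (I := I) (r := 13) (p := 7) (v := v1) (hv1p.symm ▸ hp0) (hv1p.symm ▸ hp1)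
  rw [hv1p] at y2
  refine d1.seq_yields (y2.seq (L₂ := fun b f => f b) (D₂ := (max _ _) + 1) ?_)
  rintro b v2 ⟨rfl, hb1, -⟩
  refine Yields.ite (Decides.natLt 3 13 _) (fun ht => ?_) (fun ht => ?_)
  · have hb : b = true := by
      cases b
      · simp at ht
      · rfl
    subst hb
    -- With a single candidate left, the probability of going on is zero, so this branch is
    -- impossible.
    have hr0 : 0 < r := by
      rcases Nat.eq_zero_or_pos r with h | h
      · have := hb1 rfl
        rw [hp, h] at this
        simp at this
      · exact h
    have d3 := Det.natAdd (I := I) 5 5 4 (v1.setNat 13 1)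
    have d4 := Det.natSub (I := I) 14 14 4 ((v1.setNat 13 1).setNat 5
      ((v1.setNat 13 1).nat 5 + (v1.setNat 13 1).nat 4))
    refine ((d3.seq d4).yields ⟨⟨fun m hm hm5 => ?_, ?_, fun m hm => ?_, ?_⟩, ?_, ?_⟩).mono
      (le_max_left _ _)
    · have h14 : m ≠ 14 := by omega
      have h13 : m ≠ 13 := by omega
      simp [hv1, h14, h13, hm5]
    · simp [hv1, h4, h5]
    · have : m ≠ 7 := by omega
      simp [hv1, this]
    · rfl
    · simp
    · intro _
      refine ⟨hr0, ?_⟩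
      simp [hv1, h14, h4]
  · have hb : b = false := by
      cases b
      · rfl
      · simp [hv1, h3] at ht
    subst hb
    refine ((Det.nop (v := v1.setNat 13 0) (by simpa [hv1] using h3)).yields
      ⟨⟨fun m hm hm5 => ?_, ?_, fun m hm => ?_, ?_⟩, ?_, ?_⟩).mono (le_max_right _ _)
    · have h13 : m ≠ 13 := by omega
      simp [hv1, h13]
    · simp [hv1, h5]
    · have : m ≠ 7 := by omega
      simp [hv1, this]
    · rfl
    · simp
    · simp

/-- With `r + 1` candidates left, stopping has probability `1 / (r + 1)`; going on has probability
`r / (r + 1)` and by induction leads to a uniform choice among the other `r`. -/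
theorem yields_chooseLoop (r : ℕ) : ∀ (i : ℕ) (v : State n), v.nat 3 = 0 → v.nat 4 = 1 →
    v.nat 13 = 1 → v.nat 14 = r + 1 → v.nat 5 = i →
    Yields I (.loop (.natLt 3 13) chooseBody) v ((r + 1) * (chooseBody.len + 1) + 1)
      (fun j w => j ≤ i + r ∧ Chosen v j w)
      (fun f => ((r : ℝ) + 1)⁻¹ * ∑ m ∈ Finset.range (r + 1), f (i + m)) := by
  induction r with
  | zero =>
    intro i v h3 h4 h13 h14 h5
    have y1 := yields_chooseBody (I := I) 0 i v h3 h4 h14 h5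
    have hlt : v.nat 3 < v.nat 13 := by omega
    refine ((Yields.loop_true (Decides.natLt 3 13 v) hlt y1 (L₂ := fun b f => f i) (D₂ := 1)
      ?_).mono (by omega)).congr fun f => by simp
    rintro b w ⟨h1, h2, h3'⟩
    cases b
    · refine (Det.loop_false (Decides.natLt 3 13 w) ?_).yields ⟨by omega, h1⟩
      rw [h2]; simp
    · exact absurd (h3' rfl).1 (lt_irrefl 0)
  | succ r ih =>
    intro i v h3 h4 h13 h14 h5
    have y1 := yields_chooseBody (I := I) (r + 1) i v h3 h4 h14 h5
    have hlt : v.nat 3 < v.nat 13 := by omega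
    refine ((Yields.loop_true (Decides.natLt 3 13 v) hlt y1 (L₂ := fun b f => if b then
      ((r : ℝ) + 1)⁻¹ * ∑ m ∈ Finset.range (r + 1), f (i + 1 + m) else f i)
      (D₂ := (r + 1) * (chooseBody.len + 1) + 1) ?_).mono ?_).congr fun f => ?_
    · rintro b w ⟨h1, h2, h3'⟩
      cases b
      · refine ((Det.loop_false (Decides.natLt 3 13 w) ?_).yields ⟨by omega, h1⟩).mono (by omega)
        rw [h2]; simp
      · have y2 := ih (i + 1) w ((h1.nat 3 (by norm_num) (by norm_num)).trans h3)
          ((h1.nat 4 (by norm_num) (by norm_num)).trans h4) (by simpa using h2)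
          (h3' rfl).2 (by simpa using h1.idx)
        simp only [if_true]
        exact y2.imp fun j w' hw' => ⟨by omega, h1.trans hw'.2⟩
    · have : (r + 1 + 1) * (chooseBody.len + 1) =
        (r + 1) * (chooseBody.len + 1) + (chooseBody.len + 1) := by ring
      omega
    · simp only [if_true, Bool.false_eq_true, if_false]
      rw [Finset.sum_range_succ' _ (r + 1)]
      have h1 : ∀ m, f (i + (m + 1)) = f (i + 1 + m) := fun m => by
        rw [add_assoc, add_comm 1 m]
      simp only [h1, add_zero]
      push_cast
      have : (r : ℝ) + 1 ≠ 0 := by positivity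
      have : (r : ℝ) + 1 + 1 ≠ 0 := by positivity
      field_simp
      ring

theorem yields_choose {N : ℕ} (hN : 0 < N) (v : State n) (h1 : v.nat 1 = N) (h3 : v.nat 3 = 0)
    (h4 : v.nat 4 = 1) :
    Yields I choose v (N * (chooseBody.len + 1) + 7)
      (fun j w => j < N ∧ Chosen v j w)
      (fun f => (N : ℝ)⁻¹ * ∑ m ∈ Finset.range N, f m) := by
  obtain ⟨r, rfl⟩ : ∃ r, N = r + 1 := ⟨N - 1, by omega⟩
  have d1 := Det.natConst (I := I) 5 0 v
  have d2 := Det.natAdd (I := I) 14 1 3 (v.setNat 5 0)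
  set v2 := (v.setNat 5 0).setNat 14 ((v.setNat 5 0).nat 1 + (v.setNat 5 0).nat 3) with hv2
  have d3 := Det.natConst (I := I) 13 1 v2
  have y4 := yields_chooseLoop (I := I) r 0 (v2.setNat 13 1) (by simpa [hv2] using h3)
    (by simpa [hv2] using h4) (by simp) (by simp [hv2, h1, h3]) (by simp [hv2])
  refine (((d1.seq_yields (d2.seq_yields (d3.seq_yields y4))).imp fun j w hw => ?_).mono
    (by omega)).congr fun f => ?_
  · refine ⟨by omega, ⟨fun m hm hm5 => ?_, hw.2.idx, fun m hm => hw.2.real m hm, hw.2.str⟩⟩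
    rw [hw.2.nat m hm hm5]
    have h14 : m ≠ 14 := by omega
    have h13 : m ≠ 13 := by omega
    simp [hv2, h14, h13, hm5]
  · simp

end Choose

/-! ## The walk -/

section MainLoop

variable {κ n : ℕ} {I : Problem κ n}

/-- The coin of bias `(tail - term) / tail` decides whether the truncated Poisson length exceeds the
number of steps made. Term and tail are then updated recursively, so no random length has to be
drawn in advance. -/
noncomputable def walkBody (κ : ℕ) : Prog :=
  .seq (assign 7 (.div (.sub (.reg 5) (.reg 4)) (.reg 5))) (.seq (.op (.flip 8 (2 * 7)))
    (.ite (.natLt 3 8)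
      (.seq (assign 5 (.sub (.reg 5) (.reg 4))) (.seq (.op (.natAdd 7 7 4))
        (.seq (assign 4 (.div (.mul (.reg 4) (.reg 2)) (.nat 7)))
          (.seq choose (dispatch κ localStep)))))
      (.op (.natConst 3 0))))

/-- The memory at the beginning of a step of the walk: `j` steps have been made, and at most `r`
remain. -/
structure WalkState (I : Problem κ n) (s η lam : ℝ) (x₀ : BitStr n) (flag r j : ℕ)
    (q : BitStr n × ℝ) (v : State n) : Prop where
  numTerms : v.nat 1 = I.H.numTerms
  zero : v.nat 3 = 0
  one : v.nat 4 = 1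
  step : v.nat 7 = j
  flag : v.nat 8 = flag
  scale : v.real 1 = s
  rate : v.real 2 = lam
  eta : v.real 3 = η
  term : v.real 4 = expTerm lam j
  tail : v.real 5 = expTail lam r j
  pos : v.str 0 = q.1
  start : v.str 1 = x₀
  weight : v.real 6 = q.2

/-- The number of steps of the body of the walk. -/
noncomputable def walkBodyTime (κ N : ℕ) : ℕ :=
  (walkBody κ).len + (dispatch κ localStep).len + N * (chooseBody.len + 1) + 20 +
    (assign 5 (.sub (.reg 5) (.reg 4))).len +
    (assign 4 (.div (.mul (.reg 4) (.reg 2)) (.nat 7))).len +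
    (assign 7 (.div (.sub (.reg 5) (.reg 4)) (.reg 5))).len

theorem yields_randomTerm {s η : ℝ} (hs : I.H.ScaleOk s) (hη : 0 < η) (hN : 0 < I.H.numTerms)
    (v : State n) (h1 : v.nat 1 = I.H.numTerms) (h3 : v.nat 3 = 0) (h4 : v.nat 4 = 1)
    (hvs : v.real 1 = s) (hvη : v.real 3 = η) :
    Yields I (.seq choose (dispatch κ localStep)) v
      (I.H.numTerms * (chooseBody.len + 1) + 7 + (dispatch κ localStep).len + 1)
      (fun q w => (∀ r < 9, r ≠ 5 → w.nat r = v.nat r) ∧ (∀ r < 6, w.real r = v.real r) ∧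
        w.real 6 = q.2 ∧ w.str 0 = q.1 ∧ w.str 1 = v.str 1)
      (fun f => stepE I.H s η (v.str 0, v.real 6) f) := by
  refine ((yields_choose hN v h1 h3 h4).seq (L₂ := fun j f => if h : j < I.H.numTerms then
    ∑ z, transProb I.H s η ⟨j, h⟩ (v.str 0 ∘ I.H.site ⟨j, h⟩) z *
        f (flipBits (I.H.site ⟨j, h⟩) z (v.str 0),
          v.real 6 * transWeight I.H s η ⟨j, h⟩ (v.str 0 ∘ I.H.site ⟨j, h⟩) z) else 0)
    ?_).congr fun f => ?_
  · rintro j w ⟨hj, hw⟩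
    simp only [dif_pos hj]
    refine yields_dispatch localStep ⟨j, hj⟩ w hw.idx fun w' hw' => ?_
    have hl := hw'.sameLow
    have h0 : w'.str 0 = v.str 0 := by rw [hl.str 0 (by norm_num), hw.str]
    have h6 : w'.real 6 = v.real 6 := by rw [hl.real 6 (by norm_num), hw.real 6 (by norm_num)]
    have y := yields_localStep (I := I) ⟨j, hj⟩ hs hη w'
      (by rw [hl.nat 5 (by norm_num), hw.idx])
      (by rw [hl.nat 3 (by norm_num), hw.nat 3 (by norm_num) (by norm_num), h3])
      (by rw [hl.nat 4 (by norm_num), hw.nat 4 (by norm_num) (by norm_num), h4])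
      (by rw [hl.real 1 (by norm_num), hw.real 1 (by norm_num), hvs])
      (by rw [hl.real 3 (by norm_num), hw.real 3 (by norm_num), hvη])
    rw [h0, h6] at y
    refine y.imp fun q w'' hq => ⟨fun r hr h5 => ?_, fun r hr => ?_, hq.weight, hq.pos, ?_⟩
    · rw [hq.nat r hr, hl.nat r hr, hw.nat r hr h5]
    · rw [hq.real r hr, hl.real r (by omega), hw.real r (by omega)]
    · rw [hq.start, hl.str 1 (by norm_num), hw.str]
  · rw [Finset.sum_range, stepE, Finset.mul_sum]
    refine Finset.sum_congr rfl fun i _ => ?_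
    rw [dif_pos i.2]

theorem yields_walkBody {s η lam : ℝ} (hs : I.H.ScaleOk s) (hη : 0 < η) (hl : 0 ≤ lam)
    (hN : 0 < lam → 0 < I.H.numTerms) {x₀ : BitStr n} {r j : ℕ} {q : BitStr n × ℝ} {v : State n}
    (hv : WalkState I s η lam x₀ 1 r j q v) (ht : 0 < expTail lam r j) :
    Yields I (walkBody κ) v (walkBodyTime κ I.H.numTerms)
      (fun o w => match o with
        | none => w.nat 8 = 0 ∧ w.nat 3 = 0 ∧ w.str 0 = q.1 ∧ w.real 6 = q.2 ∧ w.str 1 = x₀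
        | some q' => 0 < r ∧ 0 < expTail lam (r - 1) (j + 1) ∧
          WalkState I s η lam x₀ 1 (r - 1) (j + 1) q' w)
      (fun f => (1 - expTerm lam j / expTail lam r j) * stepE I.H s η q (fun q' => f (some q')) +
        expTerm lam j / expTail lam r j * f none) := by
  have hq0 := expTerm_div_nonneg hl r j
  have hq1 := expTerm_div_le_one hl r j
  have d1 := Det.assign (I := I) 7 (.div (.sub (.reg 5) (.reg 4)) (.reg 5)) v
  have hval : (Ex.div (.sub (.reg 5) (.reg 4)) (.reg 5)).eval v =
      1 - expTerm lam j / expTail lam r j := by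
    simp only [Ex.eval, hv.term, hv.tail]
    rw [sub_div, div_self ht.ne']
  rw [hval] at d1
  set p : ℝ := 1 - expTerm lam j / expTail lam r j with hp
  set v1 := v.setReal 7 p with hv1
  have hv1p : v1.real 7 = p := by simp [hv1]
  have hp0 : 0 ≤ p := by linarith
  have hp1 : p ≤ 1 := by linarith
  have y2 := Yields.flip (I := I) (r := 8) (p := 7) (v := v1) (hv1p.symm ▸ hp0) (hv1p.symm ▸ hp1)
  rw [hv1p] at y2
  refine ((d1.seq_yields (y2.seq (L₂ := fun b f => if b then
    stepE I.H s η q (fun q' => f (some q')) else f none)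
    (Q₂ := fun o w => match o with
        | none => w.nat 8 = 0 ∧ w.nat 3 = 0 ∧ w.str 0 = q.1 ∧ w.real 6 = q.2 ∧ w.str 1 = x₀
        | some q' => 0 < r ∧ 0 < expTail lam (r - 1) (j + 1) ∧
          WalkState I s η lam x₀ 1 (r - 1) (j + 1) q' w)
    (D₂ := ((assign 5 (.sub (.reg 5) (.reg 4))).len + (1 +
      ((assign 4 (.div (.mul (.reg 4) (.reg 2)) (.nat 7))).len +
        (I.H.numTerms * (chooseBody.len + 1) + 7 + (dispatch κ localStep).len + 1) + 1) + 1) + 1)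
          + 1) ?_)).mono ?_).congr fun f => ?_
  · rintro b v2 ⟨rfl, hb1, -⟩
    refine Yields.ite (Decides.natLt 3 8 _) (fun hb => ?_) (fun hb => ?_)
    · have hb : b = true := by
        cases b
        · simp at hb
        · rfl
      subst hb
      have hp' : 0 < p := hb1 rfl
      -- When no step remains, the tail equals the current term and the walk stops with probability
      -- one. This bounds the running time on every outcome.
      obtain ⟨r', rfl⟩ : ∃ r', r = r' + 1 := by
        rcases r with _ | r'
        · rw [hp, expTail_zero, div_self] at hp'
          · simp at hp'
          · rw [← expTail_zero]; exact ht.ne'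
        · exact ⟨r', rfl⟩
      have ht' : 0 < expTail lam r' (j + 1) := by
        have : expTerm lam j < expTail lam (r' + 1) j := by
          rw [hp, sub_pos, div_lt_one ht] at hp'
          exact hp'
        rw [expTail_succ] at this
        linarith
      -- For `lam = 0` all terms of positive index vanish and the walk never goes on. Hence whenever
      -- a term must be chosen, there is one.
      have hlam : 0 < lam := by
        rcases hl.eq_or_lt with h | h
        · rw [← h] at ht'
          simp [expTail, expTerm] at ht'
        · exact h
      have d3 := Det.assign (I := I) 5 (.sub (.reg 5) (.reg 4)) (v1.setNat 8 1)
      have hval3 : (Ex.sub (.reg 5) (.reg 4)).eval (v1.setNat 8 1) = expTail lam r' (j + 1) := by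
        simp [Ex.eval, hv1, hv.term, hv.tail, expTail_succ]
      rw [hval3] at d3
      set v3 := (v1.setNat 8 1).setReal 5 (expTail lam r' (j + 1)) with hv3
      have d4 := Det.natAdd (I := I) 7 7 4 v3
      have hval4 : v3.nat 7 + v3.nat 4 = j + 1 := by simp [hv3, hv1, hv.step, hv.one]
      rw [hval4] at d4
      set v4 := v3.setNat 7 (j + 1) with hv4
      have d5 := Det.assign (I := I) 4 (.div (.mul (.reg 4) (.reg 2)) (.nat 7)) v4
      have hval5 : (Ex.div (.mul (.reg 4) (.reg 2)) (.nat 7)).eval v4 = expTerm lam (j + 1) := by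
        simp [Ex.eval, hv4, hv3, hv1, hv.term, hv.rate, expTerm_succ]
      rw [hval5] at d5
      set v5 := v4.setReal 4 (expTerm lam (j + 1)) with hv5
      have y6 := yields_randomTerm hs hη (hN hlam) v5
        (by simpa [hv5, hv4, hv3, hv1] using hv.numTerms)
        (by simpa [hv5, hv4, hv3, hv1] using hv.zero)
        (by simpa [hv5, hv4, hv3, hv1] using hv.one)
        (by simpa [hv5, hv4, hv3, hv1] using hv.scale)
        (by simpa [hv5, hv4, hv3, hv1] using hv.eta)
      have hst : (v5.str 0, v5.real 6) = q := by
        ext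
        · simp [hv5, hv4, hv3, hv1, hv.pos]
        · simp [hv5, hv4, hv3, hv1, hv.weight]
      rw [hst] at y6
      simp only [if_true]
      refine (d3.seq_yields (d4.seq_yields (d5.seq_yields (y6.map some fun q' w hw => ?_))))
      obtain ⟨g1, g2, g3, g4, g5⟩ := hw
      refine ⟨Nat.succ_pos _, ht', ?_⟩
      constructor
      · rw [g1 1 (by norm_num) (by norm_num)]; simp [hv5, hv4, hv3, hv1, hv.numTerms]
      · rw [g1 3 (by norm_num) (by norm_num)]; simp [hv5, hv4, hv3, hv1, hv.zero]
      · rw [g1 4 (by norm_num) (by norm_num)]; simp [hv5, hv4, hv3, hv1, hv.one]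
      · rw [g1 7 (by norm_num) (by norm_num)]; simp [hv5, hv4]
      · rw [g1 8 (by norm_num) (by norm_num)]; simp [hv5, hv4, hv3]
      · rw [g2 1 (by norm_num)]; simp [hv5, hv4, hv3, hv1, hv.scale]
      · rw [g2 2 (by norm_num)]; simp [hv5, hv4, hv3, hv1, hv.rate]
      · rw [g2 3 (by norm_num)]; simp [hv5, hv4, hv3, hv1, hv.eta]
      · rw [g2 4 (by norm_num)]; simp [hv5]
      · rw [g2 5 (by norm_num)]; simp [hv5, hv4, hv3]
      · exact g4
      · rw [g5]; simp [hv5, hv4, hv3, hv1, hv.start]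
      · exact g3
    · have hb : b = false := by
        cases b
        · rfl
        · simp [hv1, hv.zero] at hb
      subst hb
      simp only [Bool.false_eq_true, if_false]
      refine ((Det.nop (v := v1.setNat 8 0) (by simpa [hv1] using hv.zero)).yields
        ⟨?_, ?_, ?_, ?_, ?_⟩).mono (by omega)
      · simp
      · simpa [hv1] using hv.zero
      · simpa [hv1] using hv.pos
      · simpa [hv1] using hv.weight
      · simpa [hv1] using hv.start
  · rw [walkBodyTime]; omega
  · simp only [if_true, Bool.false_eq_true, if_false, hp]
    ring

theorem yields_walk {s η lam : ℝ} (hs : I.H.ScaleOk s) (hη : 0 < η) (hl : 0 ≤ lam)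
    (hN : 0 < lam → 0 < I.H.numTerms) {x₀ : BitStr n} (r : ℕ) :
    ∀ {j : ℕ} {q : BitStr n × ℝ} {v : State n}, WalkState I s η lam x₀ 1 r j q v →
    0 < expTail lam r j →
    Yields I (.loop (.natLt 3 8) (walkBody κ)) v
      ((r + 1) * (walkBodyTime κ I.H.numTerms + 1) + 1)
      (fun q' w => w.str 0 = q'.1 ∧ w.real 6 = q'.2 ∧ w.str 1 = x₀)
      (fun f => chainE I.H s η lam r j q f) := by
  induction r with
  | zero =>
    intro j q v hv ht
    have y1 := yields_walkBody hs hη hl hN hv ht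
    have hlt : v.nat 3 < v.nat 8 := by rw [hv.zero, hv.flag]; norm_num
    refine ((Yields.loop_true (Decides.natLt 3 8 v) hlt y1 (L₂ := fun _ f => f q) (D₂ := 1)
      ?_).mono (by omega)).congr fun f => ?_
    · rintro (_ | q') w hw
      · obtain ⟨g1, g2, g3, g4, g5⟩ := hw
        exact (Det.loop_false (Decides.natLt 3 8 w) (by omega)).yields ⟨g3, g4, g5⟩
      · exact absurd hw.1 (lt_irrefl 0)
    · rw [chainE, ← expTail_zero, div_self ht.ne']; ring
  | succ r ih =>
    intro j q v hv ht
    have y1 := yields_walkBody hs hη hl hN hv ht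
    have hlt : v.nat 3 < v.nat 8 := by rw [hv.zero, hv.flag]; norm_num
    refine ((Yields.loop_true (Decides.natLt 3 8 v) hlt y1
      (L₂ := fun o f => match o with
        | none => f q
        | some q' => chainE I.H s η lam r (j + 1) q' f)
      (D₂ := (r + 1) * (walkBodyTime κ I.H.numTerms + 1) + 1) ?_).mono ?_).congr fun f => ?_
    · rintro (_ | q') w hw
      · obtain ⟨g1, g2, g3, g4, g5⟩ := hw
        exact ((Det.loop_false (Decides.natLt 3 8 w) (by omega)).yields ⟨g3, g4, g5⟩).mono
          (by omega)
      · exact ih hw.2.2 hw.2.1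
    · have : (r + 1 + 1) * (walkBodyTime κ I.H.numTerms + 1) =
        (r + 1) * (walkBodyTime κ I.H.numTerms + 1) + (walkBodyTime κ I.H.numTerms + 1) := by ring
      omega
    · rw [chainE]; ring

end MainLoop

/-! ## Computing the parameters of the walk -/

section Parameters

variable {κ n : ℕ} {I : Problem κ n}

/-- From the view `v` the program leads to a view with the property `Q` in at most `D` steps. -/
def Ensures (I : Problem κ n) (c : Prog) (v : State n) (D : ℕ) (Q : State n → Prop) : Prop :=
  Yields I c v D (fun _ : Unit => Q) fun f => f ()

theorem Det.ensures {c : Prog} {v v' : State n} {D : ℕ} {Q : State n → Prop} (h : Det I c v D v')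
    (hQ : Q v') : Ensures I c v D Q := h.yields hQ

theorem Ensures.seq_yields {α : Type*} {a b : Prog} {v : State n} {D₁ D₂ : ℕ}
    {Q₁ : State n → Prop} {Q : α → State n → Prop} {L : (α → ℝ) → ℝ} (ha : Ensures I a v D₁ Q₁)
    (hb : ∀ v', Q₁ v' → Yields I b v' D₂ Q L) : Yields I (.seq a b) v (D₁ + D₂ + 1) Q L :=
  Yields.seq (L₂ := fun _ => L) (show Yields I a v D₁ (fun _ : Unit => Q₁) fun f => f () from ha)
    fun _ v' h => hb v' h

/-- A loop that is run `m` times. -/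
theorem ensures_loop {t : Test} {a : Prog} {D m : ℕ} {Inv : ℕ → State n → Prop}
    {p : State n → Prop} (ht : ∀ v, Decides t v (p v)) (hp : ∀ i ≤ m, ∀ v, Inv i v → (p v ↔ i < m))
    (ha : ∀ i < m, ∀ v, Inv i v → Ensures I a v D (Inv (i + 1))) {v : State n} (hv : Inv 0 v) :
    Ensures I (.loop t a) v (m * (D + 1) + 1) (Inv m) := by
  have key : ∀ r i, i + r = m → ∀ v, Inv i v →
      Ensures I (.loop t a) v (r * (D + 1) + 1) (Inv m) := by
    intro r
    induction r with
    | zero =>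
      rintro i rfl v hv
      exact Yields.mono ((Det.loop_false (ht v)
        (by rw [hp i (by omega) v hv]; omega)).ensures hv) (by omega)
    | succ r ih =>
      intro i hi v hv
      refine Yields.mono (Yields.loop_true (L₂ := fun _ f => f ()) (ht v)
        ((hp i (by omega) v hv).2 (by omega))
        (show Yields I a v D (fun _ : Unit => Inv (i + 1)) fun f => f () from
          ha i (by omega) v hv) fun _ v' hv' => ih (i + 1) (by omega) v' hv') ?_
      have : (r + 1) * (D + 1) = r * (D + 1) + (D + 1) := by ring
      omega
  exact key m 0 (by omega) v hv

/-- Add the trace of the current term to the scale. -/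
noncomputable def addTrace (a : ℕ) : Prog :=
  .seq (load a) (assign 1 (.add (.reg 1) (Ex.bigSum fun z : BitStr a => .reg (hReg (z, z)))))

/-- Compute the scale. -/
noncomputable def computeScale (κ : ℕ) : Prog :=
  .seq (.op (.natConst 4 1)) (.seq (.op (.natConst 5 0)) (.seq (assign 1 (.const 1))
    (.loop (.natLt 5 1) (.seq (dispatch κ addTrace) (.op (.natAdd 5 5 4))))))

/-- The input and the constants are in their registers. -/
structure Input (I : Problem κ n) (k : ℕ) (ε : ℝ) (v : State n) : Prop where
  numTerms : v.nat 1 = I.H.numTerms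
  time : v.nat 2 = k
  zero : v.nat 3 = 0
  one : v.nat 4 = 1
  error : v.real 0 = ε

/-- The sum of the traces of all terms, plus one. -/
noncomputable def Problem.scale (I : Problem κ n) : ℝ := 1 + ∑ i, (I.H.term i).trace

/-- Positive semidefinite terms have non-negative traces, so each trace is at most their sum; the
added one makes the inequality strict. -/
theorem Problem.scaleOk (I : Problem κ n) (h₁ : I.H.IsStoquastic) (h₂ : I.H.TermsNonneg) :
    I.H.ScaleOk I.scale := by
  have h0 : ∀ i, 0 ≤ (I.H.term i).trace := fun i => (h₂ i).trace_nonneg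
  refine ⟨?_, h₁, h₂, fun i => ?_⟩
  · have := Finset.sum_nonneg fun i (_ : i ∈ Finset.univ) => h0 i
    rw [Problem.scale]; linarith
  · have := Finset.single_le_sum (fun i _ => h0 i) (Finset.mem_univ i)
    rw [Problem.scale]; linarith

theorem ensures_addTrace (i : Fin I.H.numTerms) (v : State n) (h5 : v.nat 5 = i)
    (h3 : v.nat 3 = 0) (h4 : v.nat 4 = 1) :
    Ensures I (addTrace (I.H.arity i)) v (addTrace (I.H.arity i)).len fun w =>
      (∀ r < 9, w.nat r = v.nat r) ∧ w.real 0 = v.real 0 ∧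
        w.real 1 = v.real 1 + (I.H.term i).trace := by
  obtain ⟨v1, d1, s1, l1⟩ := det_load i v h5 h3 h4
  refine Det.ensures (d1.seq (Det.assign 1 _ v1)) ⟨s1.nat, ?_, ?_⟩
  · simpa using s1.real 0 (by norm_num)
  · rw [State.real_setReal, if_pos rfl, Ex.eval, Ex.eval_bigSum, Ex.eval, s1.real 1 (by norm_num)]
    simp only [Ex.eval, l1.mat]
    exact congrArg _ (Equiv.sum_comp (xorEquiv (v.str 0 ∘ I.H.site i)) fun y => I.H.term i y y)

theorem ensures_computeScale {k : ℕ} {ε : ℝ} {v : State n} (h1 : v.nat 1 = I.H.numTerms)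
    (h2 : v.nat 2 = k) (h3 : v.nat 3 = 0) (hε : v.real 0 = ε) :
    Ensures I (computeScale κ) v
      (I.H.numTerms * ((dispatch κ addTrace).len + 3) + (assign 1 (.const 1)).len + 6)
      fun w => Input I k ε w ∧ w.real 1 = I.scale := by
  set tr : ℕ → ℝ := fun j => if h : j < I.H.numTerms then (I.H.term ⟨j, h⟩).trace else 0 with htr
  have hloop := ensures_loop (I := I) (t := .natLt 5 1)
    (a := .seq (dispatch κ addTrace) (.op (.natAdd 5 5 4)))
    (D := (dispatch κ addTrace).len + 1 + 1) (m := I.H.numTerms)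
    (Inv := fun i w => Input I k ε w ∧ w.nat 5 = i ∧ w.real 1 = 1 + ∑ j ∈ Finset.range i, tr j)
    (fun w => Decides.natLt 5 1 w) (fun i _ w hw => by rw [hw.1.numTerms, hw.2.1])
    (fun i hi w hw => by
      obtain ⟨hw, w5, w1⟩ := hw
      refine Ensures.seq_yields (Q₁ := fun w' => (∀ r < 9, w'.nat r = w.nat r) ∧
        w'.real 0 = w.real 0 ∧ w'.real 1 = w.real 1 + tr i) ?_ fun w' hw' => ?_
      · refine yields_dispatch addTrace ⟨i, hi⟩ w w5 fun u hu => ?_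
        refine Yields.imp (ensures_addTrace ⟨i, hi⟩ u ((hu.1 5 (by norm_num)).trans w5)
          ((hu.1 3 (by norm_num)).trans hw.zero) ((hu.1 4 (by norm_num)).trans hw.one))
          fun _ w' hw' => ⟨fun r hr => (hw'.1 r hr).trans (hu.1 r hr), ?_, ?_⟩
        · rw [hw'.2.1, hu.2.1]
        · rw [hw'.2.2, hu.2.1, htr]
          simp only [dif_pos hi]
      · obtain ⟨g1, g2, g3⟩ := hw'
        refine Det.ensures (Det.natAdd 5 5 4 w') ⟨⟨?_, ?_, ?_, ?_, ?_⟩, ?_, ?_⟩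
        · simp [g1, hw.numTerms]
        · simp [g1, hw.time]
        · simp [g1, hw.zero]
        · simp [g1, hw.one]
        · simp [g2, hw.error]
        · simp [g1, w5, hw.one]
        · rw [State.real_setNat, g3, w1, Finset.sum_range_succ, add_assoc])
    (v := ((v.setNat 4 1).setNat 5 0).setReal 1 ((Ex.const 1).eval ((v.setNat 4 1).setNat 5 0)))
    ⟨⟨by simp [h1], by simp [h2], by simp [h3], by simp, by simp [hε]⟩, by simp,
      by simp [Ex.eval]⟩
  have hsum : 1 + ∑ j ∈ Finset.range I.H.numTerms, tr j = I.scale := by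
    rw [Finset.sum_range, Problem.scale]
    simp only [htr, Fin.is_lt, dif_pos, Fin.eta]
  refine ((Det.natConst 4 1 v).seq_yields ((Det.natConst 5 0 _).seq_yields
    ((Det.assign 1 (.const 1) _).seq_yields
      (Yields.imp hloop fun _ w hw => ⟨hw.1, hw.2.2.trans hsum⟩)))).mono ?_
  · have : I.H.numTerms * ((dispatch κ addTrace).len + 1 + 1 + 1) =
      I.H.numTerms * ((dispatch κ addTrace).len + 3) := by ring
    omega

/-- The parameter `lam` of the walk. -/
noncomputable def Problem.rate (I : Problem κ n) (k : ℕ) : ℝ := k * I.H.numTerms * I.scale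

/-- The number of doublings that take `ε` to at least `2`. -/
noncomputable def doublings (ε : ℝ) : ℕ := ⌈Real.logb 2 (2 / ε)⌉₊

theorem lt_doublings_iff {ε : ℝ} (hε : 0 < ε) (i : ℕ) : i < doublings ε ↔ 2 ^ i * ε < 2 := by
  rw [doublings, Nat.lt_ceil, Real.lt_logb_iff_rpow_lt (by norm_num) (by positivity),
    Real.rpow_natCast, lt_div_iff₀ hε]

/-- The instructions contain no logarithm, so `⌈log₂ (2 / ε)⌉` is found by doubling `ε` until it
reaches `2`. -/
noncomputable def countDoublings : Prog :=
  .seq (.op (.natConst 6 0)) (.seq (assign 9 (.reg 0)) (.seq (assign 8 (.const 2))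
    (.loop (.realLt (2 * 9) (2 * 8))
      (.seq (assign 9 (.add (.reg 9) (.reg 9))) (.op (.natAdd 6 6 4))))))

/-- The ceiling of `2 lam` is found by subtracting ones until nothing positive is left; it is added
to the count of doublings. -/
noncomputable def countUnits : Prog :=
  .seq (assign 9 (.mul (.const 2) (.reg 2))) (.seq (assign 8 (.const 0))
    (.loop (.realLt (2 * 8) (2 * 9))
      (.seq (assign 9 (.sub (.reg 9) (.const 1))) (.op (.natAdd 6 6 4)))))

noncomputable def sumTerms : Prog :=
  .seq (assign 4 (.const 1)) (.seq (assign 5 (.const 1)) (.seq (.op (.natConst 7 0))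
    (.loop (.natLt 7 6) (.seq (.op (.natAdd 7 7 4))
      (.seq (assign 4 (.div (.mul (.reg 4) (.reg 2)) (.nat 7)))
        (assign 5 (.add (.reg 5) (.reg 4))))))))

theorem ensures_countDoublings {k : ℕ} {ε s lam : ℝ} (hε : 0 < ε) {v : State n}
    (hv : Input I k ε v) (h1 : v.real 1 = s) (h2 : v.real 2 = lam) :
    Ensures I countDoublings v
      (doublings ε * ((assign 9 (.add (.reg 9) (.reg 9))).len + 3) +
        (assign 9 (.reg 0)).len + (assign 8 (.const 2)).len + 5)
      fun w => Input I k ε w ∧ w.real 1 = s ∧ w.real 2 = lam ∧ w.nat 6 = doublings ε := by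
  have hloop := ensures_loop (I := I) (t := .realLt (2 * 9) (2 * 8))
    (a := .seq (assign 9 (.add (.reg 9) (.reg 9))) (.op (.natAdd 6 6 4)))
    (D := (assign 9 (.add (.reg 9) (.reg 9))).len + 1 + 1) (m := doublings ε)
    (Inv := fun i w => Input I k ε w ∧ w.real 1 = s ∧ w.real 2 = lam ∧ w.nat 6 = i ∧
      w.real 9 = 2 ^ i * ε ∧ w.real 8 = 2)
    (fun w => Decides.realLt 9 8 w) (fun i _ w hw => by
      rw [lt_doublings_iff hε, hw.2.2.2.2.1, hw.2.2.2.2.2])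
    (fun i hi w hw => by
      obtain ⟨hw, w1, w2, w6, w9, w8⟩ := hw
      refine Det.ensures ((Det.assign 9 (.add (.reg 9) (.reg 9)) w).seq (Det.natAdd 6 6 4 _))
        ⟨⟨?_, ?_, ?_, ?_, ?_⟩, ?_, ?_, ?_, ?_, ?_⟩
      · simp [hw.numTerms]
      · simp [hw.time]
      · simp [hw.zero]
      · simp [hw.one]
      · simp [hw.error]
      · simp [w1]
      · simp [w2]
      · simp [w6, hw.one]
      · simp [Ex.eval, w9]; ring
      · simp [w8])
    (v := ((v.setNat 6 0).setReal 9 ((Ex.reg 0).eval (v.setNat 6 0))).setReal 8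
      ((Ex.const 2).eval ((v.setNat 6 0).setReal 9 ((Ex.reg 0).eval (v.setNat 6 0)))))
    ⟨⟨by simp [hv.numTerms], by simp [hv.time], by simp [hv.zero], by simp [hv.one],
      by simp [hv.error]⟩, by simp [h1], by simp [h2], by simp, by simp [Ex.eval, hv.error],
      by simp [Ex.eval]⟩
  refine ((Det.natConst 6 0 v).seq_yields ((Det.assign 9 (.reg 0) _).seq_yields
    ((Det.assign 8 (.const 2) _).seq_yields
      (Yields.imp hloop fun _ w hw => ⟨hw.1, hw.2.1, hw.2.2.1, hw.2.2.2.1⟩)))).mono ?_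
  have : doublings ε * ((assign 9 (.add (.reg 9) (.reg 9))).len + 1 + 1 + 1) =
      doublings ε * ((assign 9 (.add (.reg 9) (.reg 9))).len + 3) := by ring
  omega

theorem ensures_countUnits {k : ℕ} {ε s lam : ℝ} {L : ℕ} {v : State n}
    (hv : Input I k ε v) (h1 : v.real 1 = s) (h2 : v.real 2 = lam) (h6 : v.nat 6 = L) :
    Ensures I countUnits v
      (⌈2 * lam⌉₊ * ((assign 9 (.sub (.reg 9) (.const 1))).len + 3) +
        (assign 9 (.mul (.const 2) (.reg 2))).len + (assign 8 (.const 0)).len + 3)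
      fun w => Input I k ε w ∧ w.real 1 = s ∧ w.real 2 = lam ∧ w.nat 6 = L + ⌈2 * lam⌉₊ := by
  have hloop := ensures_loop (I := I) (t := .realLt (2 * 8) (2 * 9))
    (a := .seq (assign 9 (.sub (.reg 9) (.const 1))) (.op (.natAdd 6 6 4)))
    (D := (assign 9 (.sub (.reg 9) (.const 1))).len + 1 + 1) (m := ⌈2 * lam⌉₊)
    (Inv := fun i w => Input I k ε w ∧ w.real 1 = s ∧ w.real 2 = lam ∧ w.nat 6 = L + i ∧
      w.real 9 = 2 * lam - i ∧ w.real 8 = 0)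
    (fun w => Decides.realLt 8 9 w) (fun i _ w hw => by
      rw [Nat.lt_ceil, hw.2.2.2.2.1, hw.2.2.2.2.2, sub_pos])
    (fun i hi w hw => by
      obtain ⟨hw, w1, w2, w6, w9, w8⟩ := hw
      refine Det.ensures ((Det.assign 9 (.sub (.reg 9) (.const 1)) w).seq (Det.natAdd 6 6 4 _))
        ⟨⟨?_, ?_, ?_, ?_, ?_⟩, ?_, ?_, ?_, ?_, ?_⟩
      · simp [hw.numTerms]
      · simp [hw.time]
      · simp [hw.zero]
      · simp [hw.one]
      · simp [hw.error]
      · simp [w1]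
      · simp [w2]
      · simp [w6, hw.one, add_assoc]
      · simp [Ex.eval, w9]; ring
      · simp [w8])
    (v := (v.setReal 9 ((Ex.mul (.const 2) (.reg 2)).eval v)).setReal 8
      ((Ex.const 0).eval (v.setReal 9 ((Ex.mul (.const 2) (.reg 2)).eval v))))
    ⟨⟨by simp [hv.numTerms], by simp [hv.time], by simp [hv.zero], by simp [hv.one],
      by simp [hv.error]⟩, by simp [h1], by simp [h2], by simp [h6], by simp [Ex.eval, h2],
      by simp [Ex.eval]⟩
  refine ((Det.assign 9 (.mul (.const 2) (.reg 2)) v).seq_yields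
    ((Det.assign 8 (.const 0) _).seq_yields
      (Yields.imp hloop fun _ w hw => ⟨hw.1, hw.2.1, hw.2.2.1, hw.2.2.2.1⟩))).mono ?_
  have : ⌈2 * lam⌉₊ * ((assign 9 (.sub (.reg 9) (.const 1))).len + 1 + 1 + 1) =
      ⌈2 * lam⌉₊ * ((assign 9 (.sub (.reg 9) (.const 1))).len + 3) := by ring
  omega

theorem ensures_sumTerms {k : ℕ} {ε s lam η : ℝ} {R : ℕ} {v : State n}
    (hv : Input I k ε v) (h1 : v.real 1 = s) (h2 : v.real 2 = lam) (h3 : v.real 3 = η)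
    (h6 : v.nat 6 = R) :
    Ensures I sumTerms v
      (R * ((assign 4 (.div (.mul (.reg 4) (.reg 2)) (.nat 7))).len +
        (assign 5 (.add (.reg 5) (.reg 4))).len + 4) +
        (assign 4 (.const 1)).len + (assign 5 (.const 1)).len + 5)
      fun w => Input I k ε w ∧ w.real 1 = s ∧ w.real 2 = lam ∧ w.real 3 = η ∧
        w.real 5 = expTail lam R 0 := by
  set A := (assign 4 (.div (.mul (.reg 4) (.reg 2)) (.nat 7))).len
  set B := (assign 5 (.add (.reg 5) (.reg 4))).len
  have hloop := ensures_loop (I := I) (t := .natLt 7 6)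
    (a := .seq (.op (.natAdd 7 7 4)) (.seq (assign 4 (.div (.mul (.reg 4) (.reg 2)) (.nat 7)))
        (assign 5 (.add (.reg 5) (.reg 4)))))
    (D := 1 + (A + B + 1) + 1) (m := R)
    (Inv := fun i w => Input I k ε w ∧ w.real 1 = s ∧ w.real 2 = lam ∧ w.real 3 = η ∧
      w.nat 6 = R ∧ w.nat 7 = i ∧ w.real 4 = expTerm lam i ∧ w.real 5 = expTail lam i 0)
    (fun w => Decides.natLt 7 6 w) (fun i _ w hw => by
      rw [hw.2.2.2.2.1, hw.2.2.2.2.2.1])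
    (fun i hi w hw => by
      obtain ⟨hw, w1, w2, w3, w6, w7, w4, w5⟩ := hw
      have hterm : expTerm lam i * lam / ((i : ℝ) + 1) = expTerm lam (i + 1) :=
        (expTerm_succ lam i).symm
      refine Det.ensures ((Det.natAdd 7 7 4 w).seq
        ((Det.assign 4 (.div (.mul (.reg 4) (.reg 2)) (.nat 7)) _).seq
          (Det.assign 5 (.add (.reg 5) (.reg 4)) _)))
        ⟨⟨?_, ?_, ?_, ?_, ?_⟩, ?_, ?_, ?_, ?_, ?_, ?_, ?_⟩
      · simp [hw.numTerms]
      · simp [hw.time]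
      · simp [hw.zero]
      · simp [hw.one]
      · simp [hw.error]
      · simp [w1]
      · simp [w2]
      · simp [w3]
      · simp [w6]
      · simp [w7, hw.one]
      · simp [Ex.eval, w4, w2, w7, hw.one, hterm]
      · simp only [Ex.eval, State.real_setReal, State.real_setNat, State.nat_setNat, if_true, w4,
          w2, w7, hw.one, w5]
        norm_num [hterm]
        rw [expTail, expTail, Finset.sum_range_succ _ (i + 1), zero_add])
    (v := ((v.setReal 4 ((Ex.const 1).eval v)).setReal 5
      ((Ex.const 1).eval (v.setReal 4 ((Ex.const 1).eval v)))).setNat 7 0)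
    ⟨⟨by simp [hv.numTerms], by simp [hv.time], by simp [hv.zero], by simp [hv.one],
      by simp [hv.error]⟩, by simp [h1], by simp [h2], by simp [h3], by simp [h6], by simp,
      by simp [Ex.eval, expTerm], by simp [Ex.eval, expTail, expTerm]⟩
  refine ((Det.assign 4 (.const 1) v).seq_yields
    ((Det.assign 5 (.const 1) _).seq_yields ((Det.natConst 7 0 _).seq_yields
      (Yields.imp hloop fun _ w hw =>
        ⟨hw.1, hw.2.1, hw.2.2.1, hw.2.2.2.1, hw.2.2.2.2.2.2.2⟩)))).mono ?_
  have : R * (1 + (A + B + 1) + 1 + 1) = R * (A + B + 4) := by ring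
  omega

end Parameters

/-! ## The whole program -/

section Program

variable {κ n : ℕ} {I : Problem κ n}

/-- The random walk, from a random starting configuration, and the evaluation of its outcome. -/
noncomputable def sampleWalk (κ : ℕ) : Prog :=
  .seq (.op (.natConst 7 0)) (.seq (assign 4 (.const 1)) (.seq (assign 6 (.const 1))
    (.seq (.op (.natConst 8 1)) (.seq (.op (.sample 0)) (.seq (.op (.strCopy 1 0))
      (.seq (.loop (.natLt 3 8) (walkBody κ)) (.seq (.op (.queryRatio (2 * 8) (2 * 9) 1 0))
        (assign 0 (.mul (.reg 6) (.reg 8))))))))))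

theorem yields_sampleWalk {k : ℕ} {ε s lam η : ℝ} (hs : I.H.ScaleOk s) (hη : 0 < η) (hl : 0 ≤ lam)
    (hN : 0 < lam → 0 < I.H.numTerms) {R : ℕ} {v : State n}
    (hv : Input I k ε v) (h1 : v.real 1 = s) (h2 : v.real 2 = lam) (h3 : v.real 3 = η)
    (h5 : v.real 5 = expTail lam R 0) :
    Yields I (sampleWalk κ) v
      ((R + 1) * (walkBodyTime κ I.H.numTerms + 1) + (assign 4 (.const 1)).len +
        (assign 6 (.const 1)).len + (assign 0 (.mul (.reg 6) (.reg 8))).len + 14)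
      (fun y w => w.real 0 = y) (fun f => outE I s η lam R f) := by
  have d1 := Det.natConst (I := I) 7 0 v
  have d2 := Det.assign (I := I) 4 (.const 1) (v.setNat 7 0)
  have hc2 : (Ex.const 1).eval (v.setNat 7 0) = 1 := by simp [Ex.eval]
  rw [hc2] at d2
  set v2 := (v.setNat 7 0).setReal 4 1 with hv2
  have d3 := Det.assign (I := I) 6 (.const 1) v2
  have hc3 : (Ex.const 1).eval v2 = 1 := by simp [Ex.eval]
  rw [hc3] at d3
  have d4 := Det.natConst (I := I) 8 1 (v2.setReal 6 1)
  set v4 := (v2.setReal 6 1).setNat 8 1 with hv4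
  have y5 := Yields.sample (I := I) (x := 0) (v := v4)
  refine ((d1.seq_yields (d2.seq_yields (d3.seq_yields (d4.seq_yields (y5.seq
    (L₂ := fun x f => chainE I.H s η lam R 0 (x, 1) fun q => f (q.2 * (I.ratio x q.1).re))
    (Q₂ := fun y w => w.real 0 = y)
    (D₂ := 1 + ((R + 1) * (walkBodyTime κ I.H.numTerms + 1) + 1 +
      (1 + (assign 0 (.mul (.reg 6) (.reg 8))).len + 1) + 1) + 1)
    ?_))))).mono (by omega)).congr fun f => rfl
  rintro x w ⟨rfl, -⟩
  have d6 := Det.strCopy (I := I) 1 0 (v4.setStr 0 x)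
  set v6 := (v4.setStr 0 x).setStr 1 ((v4.setStr 0 x).str 0) with hv6
  have hwalk : WalkState I s η lam x 1 R 0 (x, 1) v6 := by
    constructor
    · simp [hv6, hv4, hv2, hv.numTerms]
    · simp [hv6, hv4, hv2, hv.zero]
    · simp [hv6, hv4, hv2, hv.one]
    · simp [hv6, hv4, hv2]
    · simp [hv6, hv4]
    · simp [hv6, hv4, hv2, h1]
    · simp [hv6, hv4, hv2, h2]
    · simp [hv6, hv4, hv2, h3]
    · simp [hv6, hv4, hv2, expTerm]
    · simp [hv6, hv4, hv2, h5]
    · simp [hv6]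
    · simp [hv6]
    · simp [hv6, hv4]
  have y7 := yields_walk hs hη hl hN R hwalk (expTail_zero_pos hl R)
  refine d6.seq_yields (y7.seq (L₂ := fun q f => f (q.2 * (I.ratio x q.1).re)) ?_)
  rintro q w ⟨g0, g6, g1⟩
  have d8 := Det.queryRatio (I := I) 8 9 1 0 w
  refine (d8.seq (Det.assign 0 (.mul (.reg 6) (.reg 8)) _)).yields ?_
  simp [Ex.eval, g0, g6, g1]

/-- The program that estimates the signal. -/
noncomputable def estimate (κ : ℕ) : Prog :=
  .seq (computeScale κ) (.seq (assign 2 (.mul (.mul (.nat 2) (.nat 1)) (.reg 1)))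
    (.seq countDoublings (.seq countUnits (.seq
      (assign 3 (.div (.const 1) (.mul (.const 2) (.nat 6)))) (.seq sumTerms (sampleWalk κ))))))

/-- The maximal length of the random walk. -/
noncomputable def Problem.walkLength (I : Problem κ n) (k : ℕ) (ε : ℝ) : ℕ :=
  doublings ε + ⌈2 * I.rate k⌉₊

/-- The doublings account for the factor `2 / ε`, and `e^{1/2} ≤ 2` gives `e^lam ≤ 2 ^ ⌈2 lam⌉`. -/
theorem two_mul_exp_le {ε : ℝ} (hε : 0 < ε) (lam : ℝ) :
    2 * Real.exp lam ≤ ε * 2 ^ (doublings ε + ⌈2 * lam⌉₊) := by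
  have h1 : 2 ≤ 2 ^ doublings ε * ε := by
    have := (lt_doublings_iff hε (doublings ε)).not.1 (lt_irrefl _)
    linarith
  have h2 : Real.exp lam ≤ 2 ^ ⌈2 * lam⌉₊ := by
    have h3 : lam ≤ ⌈2 * lam⌉₊ * (1 / 2) := by
      have := Nat.le_ceil (2 * lam)
      linarith
    have h4 : Real.exp (1 / 2) ≤ 2 := by
      rw [← Real.le_log_iff_exp_le (by norm_num)]; linarith [Real.log_two_gt_d9]
    calc Real.exp lam ≤ Real.exp (⌈2 * lam⌉₊ * (1 / 2)) := Real.exp_le_exp.2 h3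
      _ = Real.exp (1 / 2) ^ ⌈2 * lam⌉₊ := Real.exp_nat_mul _ _
      _ ≤ 2 ^ ⌈2 * lam⌉₊ := by gcongr
  calc 2 * Real.exp lam ≤ (2 ^ doublings ε * ε) * 2 ^ ⌈2 * lam⌉₊ := by gcongr
    _ = ε * 2 ^ (doublings ε + ⌈2 * lam⌉₊) := by rw [pow_add]; ring

theorem exists_estimate_time (κ : ℕ) : ∃ c : ℕ, ∀ {n : ℕ} (I : Problem κ n),
    I.H.IsStoquastic → I.H.TermsNonneg → ∀ (k : ℕ) {ε : ℝ}, 0 < ε → ε ≤ 1 →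
    ∀ v : State n, v.nat 1 = I.H.numTerms → v.nat 2 = k → v.nat 3 = 0 → v.real 0 = ε →
    Yields I (estimate κ) v (c * (I.walkLength k ε + 1) * (I.H.numTerms + 1))
      (fun y w => w.real 0 = y)
      (fun f => outE I I.scale (1 / (2 * I.walkLength k ε)) (I.rate k) (I.walkLength k ε) f) := by
  obtain ⟨A, B, hAB⟩ : ∃ A B, ∀ N, walkBodyTime κ N + 1 = A + N * B :=
    ⟨walkBodyTime κ 0 + 1, chooseBody.len + 1, fun N => by rw [walkBodyTime, walkBodyTime]; ring⟩
  set c1 := (dispatch κ addTrace).len + 3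
  set c2 := (assign 9 (.add (.reg 9) (.reg 9))).len + 3
  set c3 := (assign 9 (.sub (.reg 9) (.const 1))).len + 3
  set c4 := (assign 4 (.div (.mul (.reg 4) (.reg 2)) (.nat 7))).len +
    (assign 5 (.add (.reg 5) (.reg 4))).len + 4
  set e1 := (assign 1 (.const 1)).len + 6
  set e2 := (assign 2 (.mul (.mul (.nat 2) (.nat 1)) (.reg 1))).len
  set e3 := (assign 9 (.reg 0)).len + (assign 8 (.const 2)).len + 5
  set e4 := (assign 9 (.mul (.const 2) (.reg 2))).len + (assign 8 (.const 0)).len + 3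
  set e5 := (assign 3 (.div (.const 1) (.mul (.const 2) (.nat 6)))).len
  set e6 := (assign 4 (.const 1)).len + (assign 5 (.const 1)).len + 5
  set e7 := (assign 4 (.const 1)).len +
    (assign 6 (.const 1)).len + (assign 0 (.mul (.reg 6) (.reg 8))).len + 14
  refine ⟨c1 + c2 + c3 + c4 + A + B + (e1 + e2 + e3 + e4 + e5 + e6 + e7 + 6), ?_⟩
  intro n I hst hnn k ε hε hε1 v h1 h2 h3 h0
  have hs := I.scaleOk hst hnn
  set R := I.walkLength k ε with hR
  -- At least one doubling is needed because `ε ≤ 1 < 2`. Hence `R` is positive and `η = 1/(2R)` is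
  -- a positive number.
  have hL : 0 < doublings ε := by
    rw [lt_doublings_iff hε]; linarith [pow_zero (2 : ℝ)]
  have hR0 : 0 < R := by rw [hR, Problem.walkLength]; omega
  have hη : (0 : ℝ) < 1 / (2 * R) := by positivity
  have hl : 0 ≤ I.rate k := by
    have := hs.pos
    rw [Problem.rate]; positivity
  have hN : 0 < I.rate k → 0 < I.H.numTerms := by
    intro h
    rcases Nat.eq_zero_or_pos I.H.numTerms with h0 | h0
    · simp [Problem.rate, h0] at h
    · exact h0
  refine Yields.mono (Ensures.seq_yields (ensures_computeScale h1 h2 h3 h0) fun v1 hv1 =>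
    (Det.assign 2 (.mul (.mul (.nat 2) (.nat 1)) (.reg 1)) v1).seq_yields
      (Ensures.seq_yields (ensures_countDoublings (k := k) (s := I.scale) (lam := I.rate k) hε
        ⟨?_, ?_, ?_, ?_, ?_⟩ ?_ ?_) fun v2 hv2 =>
      Ensures.seq_yields (ensures_countUnits hv2.1 hv2.2.1 hv2.2.2.1 hv2.2.2.2) fun v3 hv3 =>
      (Det.assign 3 (.div (.const 1) (.mul (.const 2) (.nat 6))) v3).seq_yields
      (Ensures.seq_yields (ensures_sumTerms (k := k) (ε := ε) (s := I.scale) (lam := I.rate k)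
        (η := 1 / (2 * R)) (R := R) ⟨?_, ?_, ?_, ?_, ?_⟩ ?_ ?_ ?_ ?_) fun v4 hv4 =>
      yields_sampleWalk hs hη hl hN hv4.1 hv4.2.1 hv4.2.2.1 hv4.2.2.2.1 hv4.2.2.2.2))) ?_
  · simp [hv1.1.numTerms]
  · simp [hv1.1.time]
  · simp [hv1.1.zero]
  · simp [hv1.1.one]
  · simp [hv1.1.error]
  · simp [hv1.2]
  · simp [Ex.eval, hv1.1.numTerms, hv1.1.time, hv1.2, Problem.rate]
  · simp [hv3.1.numTerms]
  · simp [hv3.1.time]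
  · simp [hv3.1.zero]
  · simp [hv3.1.one]
  · simp [hv3.1.error]
  · simp [hv3.2.1]
  · simp [hv3.2.2.1]
  · simp only [State.real_setReal, if_true, Ex.eval, hv3.2.2.2, hR, Problem.walkLength]
    norm_num
  · simp [hv3.2.2.2, hR, Problem.walkLength]
  -- Every stage takes at most a constant times `(R + 1) * (N + 1)` steps, with a constant depending
  -- only on the lengths of program pieces.
  · rw [hAB]
    set N := I.H.numTerms
    set L := doublings ε
    set M := ⌈2 * I.rate k⌉₊
    have hRLM : R = L + M := rfl
    have g1 : N * c1 ≤ c1 * ((R + 1) * (N + 1)) := by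
      nlinarith [Nat.zero_le (R * N * c1), Nat.zero_le (R * c1)]
    have g2 : L * c2 ≤ c2 * ((R + 1) * (N + 1)) := by
      rw [hRLM]
      nlinarith [Nat.zero_le ((L + M) * N * c2), Nat.zero_le (M * c2), Nat.zero_le (N * c2)]
    have g3 : M * c3 ≤ c3 * ((R + 1) * (N + 1)) := by
      rw [hRLM]
      nlinarith [Nat.zero_le ((L + M) * N * c3), Nat.zero_le (L * c3), Nat.zero_le (N * c3)]
    have g4 : R * c4 ≤ c4 * ((R + 1) * (N + 1)) := by
      nlinarith [Nat.zero_le (R * N * c4), Nat.zero_le (N * c4)]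
    have g5 : (R + 1) * (A + N * B) ≤ (A + B) * ((R + 1) * (N + 1)) := by
      nlinarith [Nat.zero_le ((R + 1) * N * A), Nat.zero_le ((R + 1) * B)]
    have g6 : e1 + e2 + e3 + e4 + e5 + e6 + e7 + 6 ≤
        (e1 + e2 + e3 + e4 + e5 + e6 + e7 + 6) * ((R + 1) * (N + 1)) :=
      Nat.le_mul_of_pos_right _ (by positivity)
    calc _ = N * c1 + L * c2 + M * c3 + R * c4 + (R + 1) * (A + N * B) +
          (e1 + e2 + e3 + e4 + e5 + e6 + e7 + 6) := by simp only [e1, e3, e4, e6, e7]; ring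
      _ ≤ _ := add_le_add (add_le_add (add_le_add (add_le_add (add_le_add g1 g2) g3) g4) g5) g6
      _ = _ := by ring

/-- The distribution of the output of the program. -/
theorem exists_estimate (κ : ℕ) : ∃ c : ℕ, ∀ {n : ℕ} (I : Problem κ n),
    I.H.IsStoquastic → I.H.TermsNonneg → ∀ (k : ℕ) {ε : ℝ}, 0 < ε → ε ≤ 1 →
    ∃ μ : PMF ℝ, RunsWithin I (estimate κ) k ε
        (c * (I.walkLength k ε + 1) * (I.H.numTerms + 1) * I.unitCost) μ ∧
      μ.support.Finite ∧ |pexp μ id - I.realSignal k| ≤ ε ∧ pexp μ (fun y => y ^ 2) ≤ 3 := by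
  obtain ⟨c, hc⟩ := exists_estimate_time κ
  refine ⟨c, fun {n} I hst hnn k {ε} hε hε1 => ?_⟩
  set s₀ := (startConfig I (estimate κ) k ε).state with hs₀
  obtain ⟨J, h1, h2, h3, h4⟩ := hc I hst hnn k hε hε1 (view s₀) rfl rfl rfl rfl s₀ rfl
  have hs := I.scaleOk hst hnn
  have hL : 0 < doublings ε := by
    rw [lt_doublings_iff hε]; linarith [pow_zero (2 : ℝ)]
  have hR0 : 0 < I.walkLength k ε := by rw [Problem.walkLength]; omega
  have hl : 0 ≤ I.rate k := by
    have := hs.pos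
    rw [Problem.rate]; positivity
  have hμ : ∀ f : ℝ → ℝ, pexp ((J.map Prod.snd).map fun t : State n => t.real 0) f =
      outE I I.scale (1 / (2 * I.walkLength k ε)) (I.rate k) (I.walkLength k ε) f := by
    intro f
    rw [pexp_map _ (support_map_finite _ h1), pexp_map _ h1]
    refine (pexp_congr fun p hp => ?_).trans (h4 f)
    have : p.2.real 0 = p.1 := h3 p hp
    simp [this]
  refine ⟨_, h2.runsWithin, support_map_finite _ (support_map_finite _ h1), ?_, ?_⟩
  · rw [hμ]
    exact abs_outE_sub_le I hs (by positivity) k rfl (two_mul_exp_le hε _)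
  · rw [hμ]
    exact outE_sq_le I hl hs hR0

end Program

/-! ## The depth of the program -/

section Depth

variable {κ n : ℕ} {I : Problem κ n}

/-- A trace is a sum of at most `2 ^ κ` bounded entries, and there are at most `p(n)` terms. -/
theorem scale_le {p : Polynomial ℕ} (hp : I.PolyBounded p) :
    I.scale ≤ 1 + 2 ^ κ * ((p.eval n : ℕ) : ℝ) ^ 2 := by
  set P : ℝ := ((p.eval n : ℕ) : ℝ)
  have hP : 0 ≤ P := Nat.cast_nonneg _
  have h1 : ∀ i, (I.H.term i).trace ≤ 2 ^ κ * P := by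
    intro i
    calc (I.H.term i).trace ≤ ∑ _z : BitStr (I.H.arity i), P :=
          Finset.sum_le_sum fun z _ => (le_abs_self _).trans (hp.entry_le i z z)
      _ = 2 ^ I.H.arity i * P := by
          rw [Finset.sum_const, Finset.card_univ, nsmul_eq_mul]
          simp [BitStr]
      _ ≤ 2 ^ κ * P := by
          gcongr
          · exact one_le_two
          · exact I.H.arity_le i
  have h2 : (I.H.numTerms : ℝ) ≤ P := Nat.cast_le.2 hp.numTerms_le
  calc I.scale ≤ 1 + ∑ _i : Fin I.H.numTerms, 2 ^ κ * P :=
        add_le_add le_rfl (Finset.sum_le_sum fun i _ => h1 i)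
    _ = 1 + I.H.numTerms * (2 ^ κ * P) := by simp
    _ ≤ 1 + P * (2 ^ κ * P) := by gcongr
    _ = _ := by ring

theorem walkLength_add_one_le {p : Polynomial ℕ} (hst : I.H.IsStoquastic)
    (hnn : I.H.TermsNonneg) (hp : I.PolyBounded p) (k : ℕ) {ε γ : ℝ} (hε : 0 < ε) (hε1 : ε ≤ 1)
    (hγ : 0 < γ) :
    (I.walkLength k ε + 1 : ℝ) ≤ (6 + (γ * Real.log 2)⁻¹) * ((k : ℝ) + 1) * ε ^ (-γ) *
      ((1 + ((p.eval n : ℕ) : ℝ)) * (1 + 2 ^ κ * ((p.eval n : ℕ) : ℝ) ^ 2)) := by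
  set P : ℝ := ((p.eval n : ℕ) : ℝ)
  have hP : 0 ≤ P := Nat.cast_nonneg _
  have hs := (I.scaleOk hst hnn).pos
  have hlog2 := Real.log_pos one_lt_two
  set E : ℝ := ε ^ (-γ) with hE
  have hE1 : 1 ≤ E := Real.one_le_rpow_of_pos_of_le_one_of_nonpos hε hε1 (by linarith)
  set G : ℝ := (1 + P) * (1 + 2 ^ κ * P ^ 2) with hG
  have hG1 : 1 ≤ G := one_le_mul_of_one_le_of_one_le (by linarith) (by
    have : 0 ≤ 2 ^ κ * P ^ 2 := by positivity
    linarith)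
  have hk : (1 : ℝ) ≤ (k : ℝ) + 1 := by
    have : (0 : ℝ) ≤ k := Nat.cast_nonneg _
    linarith
  -- The only place where `γ` is needed: the logarithm of `1 / ε` is bounded by an arbitrarily small
  -- power.
  have hlog : Real.log ε⁻¹ ≤ E / γ := by
    have := Real.log_le_rpow_div (inv_nonneg.2 hε.le) hγ
    rwa [Real.inv_rpow hε.le, ← Real.rpow_neg hε.le] at this
  have hL : (doublings ε : ℝ) ≤ 2 + (γ * Real.log 2)⁻¹ * E := by
    have h0 : Real.logb 2 (2 / ε) = 1 + Real.log ε⁻¹ / Real.log 2 := by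
      rw [Real.logb, div_eq_mul_inv 2 ε, Real.log_mul two_ne_zero (inv_ne_zero hε.ne'), add_div,
        div_self hlog2.ne']
    have h1 : 0 ≤ Real.log ε⁻¹ := Real.log_nonneg ((one_le_inv₀ hε).2 hε1)
    have h2 := (Nat.ceil_lt_add_one (a := Real.logb 2 (2 / ε)) (by rw [h0]; positivity)).le
    have h3 : Real.log ε⁻¹ / Real.log 2 ≤ E / γ / Real.log 2 := by gcongr
    have h4 : E / γ / Real.log 2 = (γ * Real.log 2)⁻¹ * E := by
      rw [div_div, div_eq_inv_mul]
    rw [doublings]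
    linarith
  have hrate : I.rate k ≤ k * G := by
    have h2 : (I.H.numTerms : ℝ) ≤ 1 + P := by
      have : (I.H.numTerms : ℝ) ≤ P := Nat.cast_le.2 hp.numTerms_le
      linarith
    rw [Problem.rate, hG, mul_assoc]
    gcongr
    exact scale_le hp
  have hrate0 : 0 ≤ I.rate k := by rw [Problem.rate]; positivity
  have hM : (⌈2 * I.rate k⌉₊ : ℝ) ≤ 2 * (k * G) + 1 := by
    have := (Nat.ceil_lt_add_one (a := 2 * I.rate k) (by positivity)).le
    linarith
  rw [Problem.walkLength]
  push_cast
  have ha : 0 ≤ (γ * Real.log 2)⁻¹ := by positivity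
  set a := (γ * Real.log 2)⁻¹
  have hEG : 1 ≤ E * G := one_le_mul_of_one_le_of_one_le hE1 hG1
  calc (doublings ε : ℝ) + ⌈2 * I.rate k⌉₊ + 1 ≤ 4 + a * E + 2 * (k * G) := by linarith
    _ ≤ 4 * (E * G) * ((k : ℝ) + 1) + a * (E * G) * ((k : ℝ) + 1) +
        2 * (E * G) * ((k : ℝ) + 1) := by
        have h1 : 4 ≤ 4 * (E * G) * ((k : ℝ) + 1) := by
          nlinarith [mul_le_mul hEG hk zero_le_one (by positivity)]
        have h2 : a * E ≤ a * (E * G) * ((k : ℝ) + 1) := by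
          calc a * E = a * (E * 1) * 1 := by ring
            _ ≤ _ := by gcongr
        have h3 : 2 * (k * G) ≤ 2 * (E * G) * ((k : ℝ) + 1) := by
          calc 2 * (k * G) = 2 * (1 * G) * k := by ring
            _ ≤ _ := by gcongr; linarith
        linarith
    _ = _ := by ring

/-- The polynomial factor of the depth. -/
noncomputable def depthPoly (κ : ℕ) (p : Polynomial ℕ) : Polynomial ℕ :=
  (1 + p) * (1 + 2 ^ κ * p ^ 2) * (p + 1) * (Polynomial.X + p + 1)

/-- The last two factors of the polynomial bound the number of terms, scanned in each uniform
choice, and the cost of a single step, which covers string copies and queries. -/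
theorem depth_le (c : ℕ) {p : Polynomial ℕ} (hst : I.H.IsStoquastic)
    (hnn : I.H.TermsNonneg) (hp : I.PolyBounded p) (k : ℕ) {ε γ : ℝ} (hε : 0 < ε) (hε1 : ε ≤ 1)
    (hγ : 0 < γ) :
    ((c * (I.walkLength k ε + 1) * (I.H.numTerms + 1) * I.unitCost : ℕ) : ℝ) ≤
      ((c + 1) * (6 + (γ * Real.log 2)⁻¹)) * ((k : ℝ) + 1) ^ (1 + γ) * ε ^ (-γ) *
        (((depthPoly κ p).eval n : ℕ) : ℝ) := by
  set P : ℝ := ((p.eval n : ℕ) : ℝ) with hPdef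
  have hP : 0 ≤ P := Nat.cast_nonneg _
  have hlog2 := Real.log_pos one_lt_two
  have h1 := walkLength_add_one_le hst hnn hp k hε hε1 hγ
  have hN : (I.H.numTerms : ℝ) ≤ P := Nat.cast_le.2 hp.numTerms_le
  have hQ : (I.queryCost : ℝ) ≤ P := Nat.cast_le.2 hp.queryCost_le
  have hk : (k : ℝ) + 1 ≤ ((k : ℝ) + 1) ^ (1 + γ) := by
    have hk1 : (1 : ℝ) ≤ (k : ℝ) + 1 := by
      have : (0 : ℝ) ≤ k := Nat.cast_nonneg _
      linarith
    calc (k : ℝ) + 1 = ((k : ℝ) + 1) ^ (1 : ℝ) := (Real.rpow_one _).symm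
      _ ≤ _ := Real.rpow_le_rpow_of_exponent_le hk1 (by linarith)
  have hq : (((depthPoly κ p).eval n : ℕ) : ℝ) =
      ((1 + P) * (1 + 2 ^ κ * P ^ 2)) * (P + 1) * (n + P + 1) := by
    simp [depthPoly, hPdef]
  rw [hq]
  push_cast [Problem.unitCost]
  have hc : (c : ℝ) ≤ c + 1 := by linarith
  have hE : 0 ≤ ε ^ (-γ) := Real.rpow_nonneg hε.le _
  calc (c : ℝ) * (I.walkLength k ε + 1) * (I.H.numTerms + 1) * (n + I.queryCost + 1)
      ≤ (c + 1) * ((6 + (γ * Real.log 2)⁻¹) * ((k : ℝ) + 1) ^ (1 + γ) * ε ^ (-γ) *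
        ((1 + P) * (1 + 2 ^ κ * P ^ 2))) * (P + 1) * (n + P + 1) := by
        gcongr
        refine h1.trans ?_
        gcongr
    _ = _ := by ring

end Depth

/-! ## The error of the estimator -/

section Estimator

open MeasureTheory

/-- The exceptional events are not assumed measurable, so a measurable hull of the same measure is
used. -/
theorem measure_pi_eval_le {ι : Type*} [Fintype ι] {Ω : ι → Type*} [∀ i, MeasurableSpace (Ω i)]
    (ν : ∀ i, Measure (Ω i)) [∀ i, IsProbabilityMeasure (ν i)] (i : ι) (E : Set (Ω i)) :
    Measure.pi ν {ω | ω i ∈ E} ≤ ν i E := by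
  calc Measure.pi ν {ω | ω i ∈ E} ≤ Measure.pi ν (Function.eval i ⁻¹' toMeasurable (ν i) E) :=
        measure_mono fun ω hω => subset_toMeasurable _ _ hω
    _ = ν i (toMeasurable (ν i) E) :=
        (measurePreserving_eval ν i).measure_preimage
          (measurableSet_toMeasurable _ _).nullMeasurableSet
    _ = ν i E := measure_toMeasurable _

variable {κ n : ℕ} {I : Problem κ n}

theorem norm_sub_signal_le {k : ℕ} {ε εtrot e x : ℝ} (h₁ : |x - e| ≤ ε)
    (h₂ : |e - I.realSignal k| ≤ εtrot) : ‖(x : ℂ) - I.signal k‖ ≤ ε + εtrot := by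
  rw [signal_eq, ← Complex.ofReal_sub, Complex.norm_real, Real.norm_eq_abs]
  exact (abs_sub_le _ e _).trans (add_le_add h₁ h₂)

theorem medianOfMeans_error {μ : PMF ℝ} {k : ℕ} {ε εtrot δ : ℝ} (hμ : μ.support.Finite)
    (hV : pexp μ (fun y => y ^ 2) ≤ 3) (hb : |pexp μ id - I.realSignal k| ≤ εtrot)
    (hε : 0 < ε) (hδ : 0 < δ) (hδ' : δ ≤ 1 / 2) :
    ENNReal.ofReal (1 - δ) ≤ independentRuns (groupCount δ⁻¹) (groupSize ε) μ
      {ω | ‖((medianOfMeans ω : ℝ) : ℂ) - I.signal k‖ ≤ ε + εtrot} := by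
  have hy : 2 ≤ δ⁻¹ := by
    rw [le_inv_comm₀ two_pos hδ]; linarith
  obtain ⟨E, hE, h⟩ := exists_badEvent hμ hV (groupCount_pos hy) hε (le_groupSize hε)
  refine le_measure_of_compl_subset hδ.le (E := E) (fun ω hω => ?_) (hE.trans ?_)
  · by_contra hωE
    exact hω (norm_sub_signal_le (h ω hωE) hb)
  · refine ENNReal.ofReal_le_ofReal ((half_pow_groupCount_le (inv_pos.2 hδ)).trans ?_)
    rw [inv_inv]

/-- A union bound over the `K + 1` values of `k`, with failure probability `δ / (K + 1)` for each of
them. -/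
theorem medianOfMeans_error_all {μ : ℕ → PMF ℝ} {K : ℕ} {ε εtrot δ : ℝ}
    (hμ : ∀ k, (μ k).support.Finite) (hV : ∀ k, pexp (μ k) (fun y => y ^ 2) ≤ 3)
    (hb : ∀ k, |pexp (μ k) id - I.realSignal k| ≤ εtrot)
    (hε : 0 < ε) (hδ : 0 < δ) (hδ' : δ ≤ 1 / 2) :
    ENNReal.ofReal (1 - δ) ≤ Measure.pi (fun k : Fin (K + 1) =>
        independentRuns (groupCount ((K + 1) / δ)) (groupSize ε) (μ (k : ℕ)))
      {ω | ∀ k : Fin (K + 1),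
        ‖((medianOfMeans (ω k) : ℝ) : ℂ) - I.signal (k : ℕ)‖ ≤ ε + εtrot} := by
  have hK : (1 : ℝ) ≤ (K : ℝ) + 1 := by
    have : (0 : ℝ) ≤ K := Nat.cast_nonneg _
    linarith
  have hy : 2 ≤ ((K : ℝ) + 1) / δ := by
    rw [le_div_iff₀ hδ]; linarith
  have hg := half_pow_groupCount_le (y := ((K : ℝ) + 1) / δ) (by linarith)
  choose E hE h using fun k : Fin (K + 1) =>
    exists_badEvent (hμ k) (hV k) (groupCount_pos hy) hε (le_groupSize hε)
  refine le_measure_of_compl_subset hδ.le (E := ⋃ k, {ω | ω k ∈ E k}) (fun ω hω => ?_) ?_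
  · by_contra hωE
    simp only [Set.mem_iUnion, Set.mem_ofPred_eq, not_exists] at hωE
    exact hω fun k => norm_sub_signal_le (h k _ (hωE k)) (hb k)
  · calc _ ≤ ∑ k : Fin (K + 1), Measure.pi (fun k : Fin (K + 1) =>
          independentRuns (groupCount ((K + 1) / δ)) (groupSize ε) (μ (k : ℕ)))
            {ω | ω k ∈ E k} := measure_iUnion_fintype_le _ _
      _ ≤ ∑ _k : Fin (K + 1), ENNReal.ofReal (((K : ℝ) + 1) / δ)⁻¹ :=
          Finset.sum_le_sum fun k _ => (measure_pi_eval_le (fun k : Fin (K + 1) =>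
            independentRuns (groupCount ((K + 1) / δ)) (groupSize ε) (μ (k : ℕ))) k (E k)).trans
            ((hE k).trans (ENNReal.ofReal_le_ofReal hg))
      _ = ENNReal.ofReal δ := by
          rw [Finset.sum_const, Finset.card_univ, Fintype.card_fin, nsmul_eq_mul,
            ← ENNReal.ofReal_natCast, ← ENNReal.ofReal_mul (Nat.cast_nonneg _)]
          congr 1
          push_cast
          field_simp

theorem log_add_log_le {K : ℕ} (hK : 1 ≤ K) {δ : ℝ} (hδ : 0 < δ) :
    Real.log δ⁻¹ + Real.log K ≤ Real.log (((K : ℝ) + 1) / δ) := by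
  have hK' : (1 : ℝ) ≤ K := by exact_mod_cast hK
  rw [div_eq_mul_inv, Real.log_mul (by linarith) (inv_ne_zero hδ.ne'), add_comm]
  have := Real.log_le_log (by linarith) (by linarith : (K : ℝ) ≤ (K : ℝ) + 1)
  linarith

/-- From `K + 1 ≤ 2K` the excess is at most `log 2`, and `δ ≤ 1/2` bounds `log 2` by `log δ⁻¹`. -/
theorem log_le_two_mul_log_add_log {K : ℕ} (hK : 1 ≤ K) {δ : ℝ} (hδ : 0 < δ) (hδ' : δ ≤ 1 / 2) :
    Real.log (((K : ℝ) + 1) / δ) ≤ 2 * (Real.log δ⁻¹ + Real.log K) := by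
  have hK' : (1 : ℝ) ≤ K := by exact_mod_cast hK
  have hy : 2 ≤ δ⁻¹ := by
    rw [le_inv_comm₀ two_pos hδ]; linarith
  rw [div_eq_mul_inv, Real.log_mul (by linarith) (inv_ne_zero hδ.ne')]
  have h1 := Real.log_le_log (by linarith) (by linarith : (K : ℝ) + 1 ≤ 2 * K)
  rw [Real.log_mul two_ne_zero (by linarith)] at h1
  have h2 := Real.log_le_log two_pos hy
  have h3 := Real.log_nonneg hK'
  linarith

end Estimator

end StoqMC

theorem theorem2 :
    ∃ (c₁ c₂ : ℝ) (groups size : ℝ → ℝ → ℕ) (groupsAll sizeAll : ℕ → ℝ → ℝ → ℕ),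
      0 < c₁ ∧ 0 < c₂ ∧
      -- the number of runs is `Θ(ε⁻² log δ⁻¹)` for one `k`
      (∀ ε δ : ℝ, 0 < ε → ε ≤ 1 → 0 < δ → δ ≤ 1 / 2 →
        c₁ * (ε⁻¹ ^ 2 * Real.log δ⁻¹) ≤ ((groups ε δ * size ε δ : ℕ) : ℝ) ∧
        ((groups ε δ * size ε δ : ℕ) : ℝ) ≤ c₂ * (ε⁻¹ ^ 2 * Real.log δ⁻¹)) ∧
      -- the number of runs is `Θ(ε⁻² (log δ⁻¹ + log K))` per `k` for all `k ≤ K`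
      (∀ K : ℕ, 1 ≤ K → ∀ ε δ : ℝ, 0 < ε → ε ≤ 1 → 0 < δ → δ ≤ 1 / 2 →
        c₁ * (ε⁻¹ ^ 2 * (Real.log δ⁻¹ + Real.log K)) ≤
          ((groupsAll K ε δ * sizeAll K ε δ : ℕ) : ℝ) ∧
        ((groupsAll K ε δ * sizeAll K ε δ : ℕ) : ℝ) ≤
          c₂ * (ε⁻¹ ^ 2 * (Real.log δ⁻¹ + Real.log K))) ∧
      -- one program for each locality; `p` bounds the instances, `q` is the `poly(n)` of the depth
      ∀ κ : ℕ, ∃ P : StoqMC.Prog, ∀ p : Polynomial ℕ, ∃ q : Polynomial ℕ,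
        ∀ γ : ℝ, 0 < γ → ∃ C : ℝ, 0 < C ∧
          ∀ (n : ℕ) (I : StoqMC.Problem κ n),
            I.H.IsStoquastic → I.H.TermsNonneg → I.PolyBounded p →
            ∀ εtrot : ℝ, 0 < εtrot → εtrot ≤ 1 →
              ∃ (D : ℕ → ℕ) (μ : ℕ → PMF ℝ),
                (∀ k : ℕ,
                  StoqMC.RunsWithin I P k εtrot (D k) (μ k) ∧
                  (D k : ℝ) ≤
                    C * ((k : ℝ) + 1) ^ (1 + γ) * εtrot ^ (-γ) * ((q.eval n : ℕ) : ℝ)) ∧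
                ∀ ε δ : ℝ, 0 < ε → ε ≤ 1 → 0 < δ → δ ≤ 1 / 2 →
                  (∀ k : ℕ,
                    ENNReal.ofReal (1 - δ) ≤
                      StoqMC.independentRuns (groups ε δ) (size ε δ) (μ k)
                        {ω | ‖((StoqMC.medianOfMeans ω : ℝ) : ℂ) - I.signal k‖ ≤ ε + εtrot}) ∧
                  (∀ K : ℕ, 1 ≤ K →
                    ENNReal.ofReal (1 - δ) ≤
                      MeasureTheory.Measure.pi
                        (fun k : Fin (K + 1) =>
                          StoqMC.independentRuns (groupsAll K ε δ) (sizeAll K ε δ) (μ (k : ℕ)))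
                        {ω | ∀ k : Fin (K + 1),
                          ‖((StoqMC.medianOfMeans (ω k) : ℝ) : ℂ) - I.signal (k : ℕ)‖ ≤
                            ε + εtrot}) := by
  -- The upper constant is `2 * 196`: the bound `196` for the ceilings, and a factor two for
  -- comparing `log ((K + 1) / δ)` with `log δ⁻¹ + log K`.
  refine ⟨1, 392, fun _ δ => StoqMC.groupCount δ⁻¹, fun ε _ => StoqMC.groupSize ε,
    fun K _ δ => StoqMC.groupCount ((K + 1) / δ), fun _ ε _ => StoqMC.groupSize ε, one_pos,
    by norm_num, fun ε δ hε hε1 hδ hδ' => ?_, fun K hK ε δ hε hε1 hδ hδ' => ?_, fun κ => ?_⟩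
  · have hy : 2 ≤ δ⁻¹ := by
      rw [le_inv_comm₀ two_pos hδ]; linarith
    refine ⟨(one_mul _).trans_le (StoqMC.le_groupCount_mul_groupSize hy),
      (StoqMC.groupCount_mul_groupSize_le hy hε hε1).trans ?_⟩
    have : 0 ≤ Real.log δ⁻¹ := Real.log_nonneg (by linarith)
    gcongr
    norm_num
  · have hK' : (1 : ℝ) ≤ K := by exact_mod_cast hK
    have hy : 2 ≤ ((K : ℝ) + 1) / δ := by
      rw [le_div_iff₀ hδ]; linarith
    constructor
    · refine le_trans ?_ (StoqMC.le_groupCount_mul_groupSize hy)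
      rw [one_mul]
      gcongr
      exact StoqMC.log_add_log_le hK hδ
    · refine (StoqMC.groupCount_mul_groupSize_le hy hε hε1).trans ?_
      have h1 : ε⁻¹ ^ 2 * Real.log (((K : ℝ) + 1) / δ) ≤
          ε⁻¹ ^ 2 * (2 * (Real.log δ⁻¹ + Real.log K)) := by
        gcongr
        exact StoqMC.log_le_two_mul_log_add_log hK hδ hδ'
      linarith
  · obtain ⟨c, hc⟩ := StoqMC.exists_estimate κ
    refine ⟨StoqMC.estimate κ, fun p => ⟨StoqMC.depthPoly κ p, fun γ hγ =>
      ⟨(c + 1) * (6 + (γ * Real.log 2)⁻¹), ?_, fun n I hst hnn hp εtrot ht ht1 => ?_⟩⟩⟩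
    · have := Real.log_pos one_lt_two
      positivity
    · choose μ hrun hfin hbias hvar using fun k => hc I hst hnn k ht ht1
      exact ⟨_, μ, fun k => ⟨hrun k, StoqMC.depth_le c hst hnn hp k ht ht1 hγ⟩,
        fun ε δ hε _ hδ hδ' => ⟨fun k =>
          StoqMC.medianOfMeans_error (hfin k) (hvar k) (hbias k) hε hδ hδ', fun K _ =>
          StoqMC.medianOfMeans_error_all hfin hvar hbias hε hδ hδ'⟩⟩
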